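/- Let $X$ be a complex manifold (of finite dimension) with structure sheaf $\mathcal O_X$ of holomorphic functions and holomorphic tangent bundle $\Theta_X$. Let $\mathscr A$ be a holomorphic Lie algebroid on $X$: a holomorphic vector bundle of finite rank with a holomorphic vector bundle morphism $a\colon\mathscr A\to\Theta_X$ (the anchor) and a structure of sheaf of complex Lie algebras $\{\,,\}$ on its sheaf of holomorphic sections, such that $a$ is compatible with the brackets and $\{\alpha,f\beta\}=f\{\alpha,\beta\}+a(\alpha)(f)\,\beta$ for all local sections $\alpha,\beta$ of $\mathscr A$ and all local holomorphic functions $f$. Assume that $\mathscr A$ is regular, i.e. that the anchor has constant rank on $X$. Let $\mathscr D\subset\Theta_X$ be the image of $a$, and let $\partial_{\mathscr D}\colon\Lambda^k\mathscr D^*\to\Lambda^{k+1}\mathscr D^*$ be the differential $$(\partial_{\mathscr D}\xi)(v_0,\dots,v_k)=\sum_{i}(-1)^i\,v_i\bigl(\xi(v_0,\dots,\hat v_i,\dots,v_k)\bigr)+\sum_{i<j}(-1)^{i+j}\,\xi([v_i,v_j],v_0,\dots,\hat v_i,\dots,\hat v_j,\dots,v_k)$$ for local sections $v_0,\dots,v_k$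 of $\mathscr D$; in particular $\Lambda^0\mathscr D^*=\mathcal O_X$. Then $\mathscr D$ is tangent to the leaves of a regular holomorphic foliation of $X$. For every regular holomorphic foliation $\mathcal F$ of $X$ whose leaves are tangent to $\mathscr D$ the following hold. 1. The kernel of $\partial_{\mathscr D}\colon\mathcal O_X\to\mathscr D^*$ is the sheaf $\mathcal O_{\mathcal F}$ of holomorphic functions that are locally constant along the leaves of $\mathcal F$. 2. The complex of sheaves $(\Lambda^\bullet\mathscr D^*,\partial_{\mathscr D})$ is exact in positive degree. 3. For every $k\ge 0$ there is an isomorphism of complex vector spaces $H^k(X,\mathcal O_{\mathcal F})\simeq\mathbb H^k(X,\Lambda^\bullet\mathscr D^*)$, where $\mathbb H^k$ denotes hypercohomology. -/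

import Mathlib

namespace LieRinehartCochain

set_option linter.unusedSectionVars false

variable {A L : Type*} [CommRing A] [LieRing L] [Module A L] [LieRingModule L A]

/-- The alternating `A`-multilinear cochains of degree `k`. -/
abbrev Cochain (A L : Type*) [CommRing A] [LieRing L] [Module A L] (k : ℕ) : Type _ :=
  L [⋀^Fin k]→ₗ[A] A

/-- The value of the differential,
`∑ᵢ (-1)ⁱ vᵢ · ω(v₀, …, v̂ᵢ, …, vₖ) + ∑_{i<j} (-1)^(i+j) ω(⁅vᵢ, vⱼ⁆, v₀, …, v̂ᵢ, …, v̂ⱼ, …, vₖ)`.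
In the second sum the bracket is moved to the `i`-th slot, which gives a sign `(-1)ⁱ`. -/
def formula {k : ℕ} (ω : Cochain A L k) (v : Fin (k + 1) → L) : A :=
  (∑ i : Fin (k + 1), (-1) ^ (i : ℕ) * ⁅v i, ω (i.removeNth v)⁆) +
    ∑ j : Fin (k + 1), ∑ i : Fin (k + 1), if i < j then
      (-1) ^ (j : ℕ) * ω (j.removeNth (Function.update v i ⁅v i, v j⁆)) else 0

variable [LieRinehartRing A L]

theorem lie_update_sum {k : ℕ} (ω : Cochain A L k) (x : L) (m : Fin k → L) (i : Fin k) (y : L) :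
    ∑ j, ω (Function.update (Function.update m i y) j ⁅x, Function.update m i y j⁆) =
      ω (Function.update m i ⁅x, y⁆) +
        ∑ j ∈ Finset.univ.erase i, ω (Function.update (Function.update m j ⁅x, m j⁆) i y) := by
  rw [← Finset.add_sum_erase _ _ (Finset.mem_univ i)]
  congr 1
  · simp
  · refine Finset.sum_congr rfl fun j hj => ?_
    have hj' := Finset.ne_of_mem_erase hj
    rw [Function.update_of_ne hj', Function.update_comm hj']

/-- The Lie derivative of a cochain along `x`. -/
def lieDeriv {k : ℕ} (x : L) (ω : Cochain A L k) : Cochain A L k where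
  toFun v := ⁅x, ω v⁆ - ∑ i, ω (Function.update v i ⁅x, v i⁆)
  map_update_add' := by
    intro _ m i y z
    have : (‹_› : DecidableEq (Fin k)) = instDecidableEqFin k := Subsingleton.elim _ _
    subst this
    simp only [lie_update_sum, lie_add, AlternatingMap.map_update_add, Finset.sum_add_distrib]
    abel
  map_update_smul' := by
    intro _ m i c y
    have : (‹_› : DecidableEq (Fin k)) = instDecidableEqFin k := Subsingleton.elim _ _
    subst this
    simp only [lie_update_sum, LieRinehartRing.leibniz_smul_right, AlternatingMap.map_update_add,
      AlternatingMap.map_update_smul, smul_eq_mul, LieRinehartRing.leibniz_mul_right,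
      ← Finset.mul_sum]
    ring
  map_eq_zero_of_eq' := by
    intro v i j hv hij
    rw [ω.map_eq_zero_of_eq v hv hij, lie_zero, zero_sub, neg_eq_zero]
    rw [← Finset.add_sum_erase _ _ (Finset.mem_univ i), ← Finset.add_sum_erase _ _
      (Finset.mem_erase.2 ⟨hij.symm, Finset.mem_univ j⟩), ← add_assoc, Finset.sum_eq_zero, add_zero]
    · have : Function.update v j ⁅x, v j⁆ = Function.update v i ⁅x, v i⁆ ∘ Equiv.swap i j := by
        ext l
        rcases eq_or_ne l i with rfl | hi
        · simp [hij, hij.symm, hv]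
        rcases eq_or_ne l j with rfl | hj
        · simp [hv]
        · simp [hi, hj, Equiv.swap_apply_of_ne_of_ne hi hj]
      rw [this, AlternatingMap.map_swap _ _ hij, add_neg_cancel]
    · intro l hl
      simp only [Finset.mem_erase, Finset.mem_univ, and_true] at hl
      exact ω.map_eq_zero_of_eq _ (by simp [hl.1.symm, hl.2.symm, hv]) hij

theorem lieDeriv_apply {k : ℕ} (x : L) (ω : Cochain A L k) (v : Fin k → L) :
    lieDeriv x ω v = ⁅x, ω v⁆ - ∑ i, ω (Function.update v i ⁅x, v i⁆) := rfl

theorem cons_update {k : ℕ} (ω : Cochain A L (k + 1)) (y : L) (w : Fin (k + 1) → L) (j : Fin (k + 1)) :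
    ω (Function.update w j y) = (-1) ^ (j : ℕ) * ω (Fin.cons y (j.removeNth w)) := by
  have := ω.map_insertNth j y (j.removeNth w)
  rw [Fin.insertNth_removeNth] at this
  simpa [Matrix.vecCons] using this

theorem removeNth_succ_cons {α : Type*} {k : ℕ} (i : Fin (k + 1)) (x : α) (w : Fin (k + 1) → α) :
    i.succ.removeNth (Fin.cons x w : Fin (k + 2) → α) = Fin.cons x (i.removeNth w) := by
  ext l
  refine Fin.cases ?_ (fun l => ?_) l <;> simp [Fin.removeNth]

theorem formula_cons {k : ℕ} (ω : Cochain A L (k + 1)) (x : L) (w : Fin (k + 1) → L) :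
    formula ω (Fin.cons x w) = lieDeriv x ω w - formula (ω.curryLeft x) w := by
  have hc (w' : Fin k → L) : ω.curryLeft x w' = ω (Fin.cons x w') := rfl
  simp only [formula, Fin.sum_univ_succ (n := k + 1), lieDeriv_apply, removeNth_succ_cons,
    Fin.cons_zero, Fin.cons_succ, Fin.removeNth_zero, Fin.tail_cons, Fin.val_zero, pow_zero, one_mul,
    Fin.val_succ, hc, ← Fin.cons_update, Fin.update_cons_zero, Fin.not_lt_zero, if_false,
    Finset.sum_const_zero, Fin.succ_lt_succ_iff, Fin.succ_pos, if_true, add_zero, zero_add,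
    cons_update, Finset.sum_add_distrib, pow_succ, mul_neg, mul_one, neg_mul, Finset.sum_neg_distrib]
  have h (p : Prop) [Decidable p] (a : A) : (if p then -a else 0) = -(if p then a else 0) := by
    split_ifs <;> simp
  simp only [h, Finset.sum_neg_distrib]
  ring

theorem curryLeft_lieDeriv {k : ℕ} (ω : Cochain A L (k + 1)) (x y : L) :
    (lieDeriv x ω).curryLeft y = lieDeriv x (ω.curryLeft y) - ω.curryLeft ⁅x, y⁆ := by
  ext w
  change lieDeriv x ω (Fin.cons y w) = ⁅x, ω (Fin.cons y w)⁆ -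
    ∑ i, ω (Fin.cons y (Function.update w i ⁅x, w i⁆)) - ω (Fin.cons ⁅x, y⁆ w)
  simp only [lieDeriv_apply, Fin.sum_univ_succ, Fin.cons_zero, Fin.cons_succ, Fin.update_cons_zero,
    Fin.cons_update]
  ring

theorem formula_add {k : ℕ} (ω ω' : Cochain A L k) (v : Fin (k + 1) → L) :
    formula (ω + ω') v = formula ω v + formula ω' v := by
  have h (p : Prop) [Decidable p] (a b : A) :
      (if p then a + b else 0) = (if p then a else 0) + if p then b else 0 := by
    split_ifs <;> simp
  simp only [formula, AlternatingMap.add_apply, lie_add, mul_add, Finset.sum_add_distrib, h]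
  abel

theorem formula_smul {k : ℕ} (c : A) (ω : Cochain A L k) (v : Fin (k + 1) → L) :
    formula (c • ω) v = c * formula ω v +
      ∑ i : Fin (k + 1), (-1) ^ (i : ℕ) * (⁅v i, c⁆ * ω (i.removeNth v)) := by
  simp only [formula, AlternatingMap.smul_apply, smul_eq_mul, LieRinehartRing.leibniz_mul_right,
    mul_add, Finset.sum_add_distrib, Finset.mul_sum, mul_ite, mul_zero, mul_left_comm c]
  ring

theorem exists_cons {k : ℕ} (η : L → Cochain A L k) (hadd : ∀ x y, η (x + y) = η x + η y)
    (hsmul : ∀ (c : A) x, η (c • x) = c • η x) (halt : ∀ w j, η (w j) w = 0) :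
    ∃ ξ : Cochain A L (k + 1), ∀ x w, ξ (Fin.cons x w) = η x w := by
  let f : L →ₗ[A] MultilinearMap A (fun _ : Fin k => L) A :=
    { toFun := fun x => (η x).toMultilinearMap
      map_add' := fun x y => by rw [hadd]; rfl
      map_smul' := fun c x => by rw [hsmul]; rfl }
  refine ⟨{ LinearMap.uncurryLeft (M := fun _ : Fin (k + 1) => L) f with
    map_eq_zero_of_eq' := ?_ }, fun x w => rfl⟩
  intro v i j hv hij
  change η (v 0) (Fin.tail v) = 0
  induction i using Fin.cases with
  | zero =>
    induction j using Fin.cases with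
    | zero => exact absurd rfl hij
    | succ j => rw [hv]; exact halt (Fin.tail v) j
  | succ i =>
    induction j using Fin.cases with
    | zero => rw [← hv]; exact halt (Fin.tail v) i
    | succ j => exact (η (v 0)).map_eq_zero_of_eq _ hv (fun h => hij (by rw [h]))

theorem smul_lie' (c : A) (x y : L) : ⁅c • x, y⁆ = c • ⁅x, y⁆ - ⁅y, c⁆ • x := by
  rw [← lie_skew, LieRinehartRing.leibniz_smul_right, ← lie_skew x y, smul_neg, neg_add,
    sub_eq_add_neg]

theorem exists_differential (k : ℕ) : ∀ ω : Cochain A L k,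
    ∃ η : Cochain A L (k + 1), ∀ v, η v = formula ω v := by
  induction k with
  | zero =>
    intro ω
    have h (x : L) (w : Fin 0 → L) : formula ω (Fin.cons x w) = ⁅x, ω ![]⁆ := by
      simp [formula, Subsingleton.elim _ (![] : Fin 0 → L)]
    obtain ⟨ξ, hξ⟩ := exists_cons (k := 0)
      (fun x : L => AlternatingMap.constOfIsEmpty A L (Fin 0) ⁅x, ω ![]⁆)
      (fun x y => by ext; simp) (fun c x => by ext; simp)
      (fun w j => j.elim0)
    refine ⟨ξ, fun v => ?_⟩
    rw [← Fin.cons_self_tail v, hξ, h]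
    rfl
  | succ k ih =>
    intro ω
    choose η hη using fun x => ih (ω.curryLeft x)
    have hadd (x y : L) : lieDeriv (x + y) ω - η (x + y) =
        (lieDeriv x ω - η x) + (lieDeriv y ω - η y) := by
      ext w
      simp only [AlternatingMap.sub_apply, AlternatingMap.add_apply, hη, map_add, formula_add,
        lieDeriv_apply, add_lie, AlternatingMap.map_update_add, Finset.sum_add_distrib]
      ring
    have hsmul (c : A) (x : L) : lieDeriv (c • x) ω - η (c • x) = c • (lieDeriv x ω - η x) := by
      ext w
      simp only [AlternatingMap.sub_apply, AlternatingMap.smul_apply, hη, map_smul, formula_smul,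
        lieDeriv_apply, smul_lie', AlternatingMap.map_update_sub, AlternatingMap.map_update_smul,
        Finset.sum_sub_distrib, LieRinehartRing.lie_smul_eq_mul, smul_eq_mul, mul_sub,
        Finset.mul_sum]
      have : ∑ i, ⁅w i, c⁆ * ω (Function.update w i x) =
          ∑ i : Fin (k + 1), (-1) ^ (i : ℕ) * (⁅w i, c⁆ * (ω.curryLeft x) (i.removeNth w)) := by
        refine Finset.sum_congr rfl fun i _ => ?_
        rw [cons_update, mul_left_comm]
        rfl
      rw [this]
      ring
    have key (w : Fin (k + 1) → L) : (lieDeriv (w 0) ω - η (w 0)) w = 0 := by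
      have hw : w = Fin.cons (w 0) (Fin.tail w) := (Fin.cons_self_tail w).symm
      generalize w 0 = x, Fin.tail w = u at hw
      subst hw
      have h1 := DFunLike.congr_fun (curryLeft_lieDeriv ω x x) u
      rw [AlternatingMap.sub_apply, lie_self, map_zero, AlternatingMap.zero_apply, sub_zero] at h1
      rw [AlternatingMap.sub_apply, hη, sub_eq_zero]
      refine h1.trans ?_
      cases k with
      | zero =>
        simp only [formula, lieDeriv_apply, Subsingleton.elim _ (![] : Fin 0 → L)]
        simp
      | succ k =>
        rw [formula_cons, AlternatingMap.curryLeft_same]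
        simp [formula]
    have halt (w : Fin (k + 1) → L) (j : Fin (k + 1)) : (lieDeriv (w j) ω - η (w j)) w = 0 := by
      have h1 : w = (w ∘ Equiv.swap 0 j) ∘ Equiv.swap 0 j := by ext; simp
      have h2 := key (w ∘ Equiv.swap 0 j)
      simp only [Function.comp_apply, Equiv.swap_apply_left] at h2
      conv_lhs => arg 2; rw [h1]
      rw [AlternatingMap.map_perm, h2, smul_zero]
    obtain ⟨ξ, hξ⟩ := exists_cons (fun x : L => lieDeriv x ω - η x) hadd hsmul halt
    refine ⟨ξ, fun v => ?_⟩
    rw [← Fin.cons_self_tail v, hξ, formula_cons, AlternatingMap.sub_apply, hη]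

/-- The Chevalley–Eilenberg–Cartan differential. -/
def differential {k : ℕ} (ω : Cochain A L k) : Cochain A L (k + 1) where
  toFun := formula ω
  map_update_add' v i x y := by
    obtain ⟨η, hη⟩ := exists_differential k ω
    simp only [← hη, AlternatingMap.map_update_add]
  map_update_smul' v i c x := by
    obtain ⟨η, hη⟩ := exists_differential k ω
    simp only [← hη, AlternatingMap.map_update_smul]
  map_eq_zero_of_eq' v i j hv hij := by
    obtain ⟨η, hη⟩ := exists_differential k ω
    simp only [← hη, AlternatingMap.map_eq_zero_of_eq η v hv hij]

theorem differential_apply {k : ℕ} (ω : Cochain A L k) (v) : differential ω v = formula ω v := rfl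

theorem curryLeft_differential {k : ℕ} (ω : Cochain A L (k + 1)) (x : L) :
    (differential ω).curryLeft x = lieDeriv x ω - differential (ω.curryLeft x) := by
  ext w
  exact formula_cons ω x w

theorem curryLeft_ext {k : ℕ} {ω ω' : Cochain A L (k + 1)}
    (h : ∀ x, ω.curryLeft x = ω'.curryLeft x) : ω = ω' := by
  ext v
  rw [← Fin.cons_self_tail v]
  exact DFunLike.congr_fun (h (v 0)) (Fin.tail v)

theorem lieDeriv_add {k : ℕ} (x : L) (ω ω' : Cochain A L k) :
    lieDeriv x (ω + ω') = lieDeriv x ω + lieDeriv x ω' := by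
  ext w
  simp only [lieDeriv_apply, AlternatingMap.add_apply, lie_add, Finset.sum_add_distrib]
  ring

theorem differential_add {k : ℕ} (ω ω' : Cochain A L k) :
    differential (ω + ω') = differential ω + differential ω' := by
  ext w
  exact formula_add ω ω' w

theorem lieDeriv_sub {k : ℕ} (x : L) (ω ω' : Cochain A L k) :
    lieDeriv x (ω - ω') = lieDeriv x ω - lieDeriv x ω' :=
  eq_sub_of_add_eq (by rw [← lieDeriv_add, sub_add_cancel])

theorem differential_sub {k : ℕ} (ω ω' : Cochain A L k) :
    differential (ω - ω') = differential ω - differential ω' :=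
  eq_sub_of_add_eq (by rw [← differential_add, sub_add_cancel])

theorem lieDeriv_lieDeriv {k : ℕ} (ω : Cochain A L k) (x y : L) :
    lieDeriv x (lieDeriv y ω) = lieDeriv y (lieDeriv x ω) + lieDeriv ⁅x, y⁆ ω := by
  induction k with
  | zero =>
    ext w
    simp [lieDeriv_apply]
  | succ k ih =>
    refine curryLeft_ext fun z => ?_
    simp only [curryLeft_lieDeriv, AlternatingMap.curryLeft_add, LinearMap.add_apply, lieDeriv_sub,
      ih, leibniz_lie x y z, map_add]
    abel

theorem lieDeriv_differential {k : ℕ} (ω : Cochain A L k) (x : L) :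
    lieDeriv x (differential ω) = differential (lieDeriv x ω) := by
  induction k with
  | zero =>
    refine curryLeft_ext fun y => ?_
    ext w
    change lieDeriv x (differential ω) (Fin.cons y w) = formula (lieDeriv x ω) (Fin.cons y w)
    simp [lieDeriv_apply, formula, differential_apply, Subsingleton.elim _ (![] : Fin 0 → L)]
  | succ k ih =>
    refine curryLeft_ext fun y => ?_
    simp only [curryLeft_lieDeriv, curryLeft_differential, lieDeriv_sub, differential_sub, ih,
      lieDeriv_lieDeriv ω x y]
    abel

theorem differential_differential {k : ℕ} (ω : Cochain A L k) :
    differential (differential ω) = 0 := by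
  induction k with
  | zero =>
    refine curryLeft_ext fun x => ?_
    simp only [curryLeft_differential, lieDeriv_differential]
    have : (differential ω).curryLeft x = lieDeriv x ω := by
      ext w
      change formula ω (Fin.cons x w) = _
      simp [lieDeriv_apply, formula, Subsingleton.elim _ (![] : Fin 0 → L)]
    rw [this]
    simp
  | succ k ih =>
    refine curryLeft_ext fun x => ?_
    simp only [curryLeft_differential, lieDeriv_differential, differential_sub, ih]
    simp

end LieRinehartCochain

open scoped Manifold ContDiff Topology
open TopologicalSpace Bundle

universe u

namespace HolGeom

set_option linter.unusedSectionVars false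

section
open VectorField Set

variable {X : Type u} [TopologicalSpace X]

open Classical in
/-- Extension by zero of a section over an open set; it allows the notions for sections defined on
the whole of `X` to be used on `U`. -/
noncomputable def extendZero {V : X → Type*} [∀ x, Zero (V x)] {U : Opens X} (s : Π x : U, V x) (x : X) : V x :=
  if h : x ∈ U then s ⟨x, h⟩ else 0

/-- Restriction of sections. -/
def restrict {V : X → Type*} {W U : Opens X} (h : W ≤ U) (s : Π x : U, V x) : Π x : W, V x :=
  fun x => s ⟨x, h x.2⟩

section
variable {V : X → Type*} {U W : Opens X}
theorem extendZero_of_mem [∀ x, Zero (V x)] (s : Π x : U, V x) {x : X} (h : x ∈ U) :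
    extendZero s x = s ⟨x, h⟩ := dif_pos h

theorem extendZero_coe [∀ x, Zero (V x)] (s : Π x : U, V x) (x : U) :
    extendZero s (x : X) = s x := dif_pos x.2

theorem extendZero_zero [∀ x, Zero (V x)] : extendZero (0 : Π x : U, V x) = 0 := by
  funext x; simp [extendZero]

theorem extendZero_add [∀ x, AddCommGroup (V x)] (s t : Π x : U, V x) :
    extendZero (s + t) = extendZero s + extendZero t := by
  funext x
  by_cases h : x ∈ U <;> simp [extendZero, h]

theorem extendZero_smul {V : X → Type*} [∀ x, AddCommGroup (V x)] [∀ x, Module ℂ (V x)]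
    (f : U → ℂ) (s : Π x : U, V x) :
    extendZero (V := V) (f • s) = (extendZero (V := fun _ => ℂ) f) • extendZero s := by
  funext x
  by_cases h : x ∈ U <;> simp [extendZero, h]

theorem extendZero_restrict_eventuallyEq [∀ x, Zero (V x)] (h : W ≤ U) (s : Π x : U, V x)
    {x : X} (hx : x ∈ W) : ∀ᶠ y in 𝓝 x, extendZero (restrict h s) y = extendZero s y := by
  filter_upwards [W.isOpen.mem_nhds hx] with y hy
  rw [extendZero_of_mem _ hy, extendZero_of_mem _ (h hy)]; rfl
end

variable (E : Type*) [NormedAddCommGroup E] [NormedSpace ℂ E] [ChartedSpace E X]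

/-- The ring of holomorphic functions on `U`. -/
def holFun (U : Opens X) : Subalgebra ℂ (U → ℂ) where
  carrier := {f | ContMDiffOn 𝓘(ℂ, E) 𝓘(ℂ, ℂ) ω (extendZero (V := fun _ => ℂ) f) U}
  mul_mem' {f g} hf hg := by
    refine (ContMDiffOn.mul hf hg).congr fun x hx => ?_
    simp only [Pi.mul_apply, extendZero_of_mem _ hx]
  add_mem' {f g} hf hg := by
    refine (ContMDiffOn.add hf hg).congr fun x hx => ?_
    simp only [Pi.add_apply, extendZero_of_mem _ hx]
  algebraMap_mem' c := by
    refine (contMDiffOn_const (c := c)).congr fun x hx => ?_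
    simp only [extendZero_of_mem _ hx]
    rfl

variable (F : Type*) [NormedAddCommGroup F] [NormedSpace ℂ F] (V : X → Type*)
  [∀ x, AddCommGroup (V x)] [∀ x, Module ℂ (V x)] [∀ x, TopologicalSpace (V x)]
  [TopologicalSpace (TotalSpace F V)] [FiberBundle F V] [VectorBundle ℂ F V]

/-- The holomorphic sections over `U` of the vector bundle `V`. -/
def holSec (U : Opens X) : Submodule (holFun E U) (Π x : U, V x) where
  carrier := {s | ContMDiffOn 𝓘(ℂ, E) (𝓘(ℂ, E).prod 𝓘(ℂ, F)) ω
    (fun x => (⟨x, extendZero s x⟩ : TotalSpace F V)) U}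
  add_mem' {s t} hs ht := by
    change ContMDiffOn _ _ _ _ _
    rw [extendZero_add]
    exact ContMDiffOn.add_section hs ht
  zero_mem' := by
    change ContMDiffOn _ _ _ _ _
    rw [extendZero_zero]
    exact (contMDiff_zeroSection ℂ V).contMDiffOn
  smul_mem' f s hs := by
    change ContMDiffOn _ _ _ _ _
    have : extendZero (f • s) = (extendZero (V := fun _ => ℂ) (f : U → ℂ)) • extendZero s :=
      extendZero_smul _ _
    rw [this]
    exact ContMDiffOn.smul_section f.2 hs

instance (U : Opens X) : SMul (holFun E U) (holSec E F V U) := (Submodule.module (holSec E F V U)).toSMul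

instance (U : Opens X) : Module (holFun E U) (holSec E F V U) := Submodule.module (holSec E F V U)

variable {E} [IsManifold 𝓘(ℂ, E) ω X]

/-- The derivative of `f` along the vector field `s`. -/
noncomputable def dirDeriv {U : Opens X} (s : Π x : U, TangentSpace 𝓘(ℂ, E) (x : X)) (f : U → ℂ) : U → ℂ :=
  fun x => mvfderiv 𝓘(ℂ, E) (extendZero (V := fun _ => ℂ) f) x (s x)

/-- The Lie bracket of vector fields. -/
noncomputable def lieBr {U : Opens X} (s t : Π x : U, TangentSpace 𝓘(ℂ, E) (x : X)) :
    Π x : U, TangentSpace 𝓘(ℂ, E) (x : X) :=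
  fun x => mlieBracket 𝓘(ℂ, E) (extendZero s) (extendZero t) x

instance : IsManifold 𝓘(ℂ, E) 1 X := IsManifold.of_le (n := ω) le_top

theorem dirDeriv_mem {U : Opens X} {s : Π x : U, TangentSpace 𝓘(ℂ, E) (x : X)}
    (hs : s ∈ holSec E E (fun x : X => TangentSpace 𝓘(ℂ, E) x) U) {f : U → ℂ} (hf : f ∈ holFun E U) :
    dirDeriv s f ∈ holFun E U := by
  have h1 := ContMDiffOn.contMDiffOn_tangentMapWithin (m := ω) hf le_top U.isOpen.uniqueMDiffOn
  have h2 := h1.comp (hs : ContMDiffOn _ _ _ _ _) (fun x hx => hx)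
  change ContMDiffOn _ _ _ _ _
  intro x hx
  have h3 := h2 x hx
  rw [contMDiffWithinAt_totalSpace] at h3
  refine h3.2.congr ?_ ?_
  · intro y hy
    rw [extendZero_of_mem _ hy]
    simp [tangentMapWithin, dirDeriv, mvfderiv, mfderivWithin_of_isOpen U.isOpen hy]
    rw [extendZero_of_mem s hy]
    rfl
  · rw [extendZero_of_mem _ hx]
    simp [tangentMapWithin, dirDeriv, mvfderiv, mfderivWithin_of_isOpen U.isOpen hx]
    rw [extendZero_of_mem s hx]
    rfl

theorem mvfderiv_eq {g : X → ℂ} {x : X} (hg : MDifferentiableAt 𝓘(ℂ, E) 𝓘(ℂ, ℂ) g x)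
    (v : TangentSpace 𝓘(ℂ, E) x) :
    mvfderiv 𝓘(ℂ, E) g x v =
      fderiv ℂ (g ∘ (extChartAt 𝓘(ℂ, E) x).symm) (extChartAt 𝓘(ℂ, E) x x) (show E from v) := by
  simp only [mvfderiv, hg.mfderiv]
  simp
  rfl

theorem mvfderiv_mlieBracket [CompleteSpace E] {f : X → ℂ} {S T : Π x : X, TangentSpace 𝓘(ℂ, E) x} {x : X}
    (hf : ContMDiffAt 𝓘(ℂ, E) 𝓘(ℂ, ℂ) ω f x)
    (hS : MDifferentiableAt 𝓘(ℂ, E) (𝓘(ℂ, E).prod 𝓘(ℂ, E)) (fun x => (⟨x, S x⟩ : TangentBundle 𝓘(ℂ, E) X)) x)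
    (hT : MDifferentiableAt 𝓘(ℂ, E) (𝓘(ℂ, E).prod 𝓘(ℂ, E)) (fun x => (⟨x, T x⟩ : TangentBundle 𝓘(ℂ, E) X)) x)
    (hfS : MDifferentiableAt 𝓘(ℂ, E) 𝓘(ℂ, ℂ) (fun y => mvfderiv 𝓘(ℂ, E) f y (S y)) x)
    (hfT : MDifferentiableAt 𝓘(ℂ, E) 𝓘(ℂ, ℂ) (fun y => mvfderiv 𝓘(ℂ, E) f y (T y)) x) :
    mvfderiv 𝓘(ℂ, E) f x (mlieBracket 𝓘(ℂ, E) S T x) =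
      mvfderiv 𝓘(ℂ, E) (fun y => mvfderiv 𝓘(ℂ, E) f y (T y)) x (S x) -
      mvfderiv 𝓘(ℂ, E) (fun y => mvfderiv 𝓘(ℂ, E) f y (S y)) x (T x) := by
  have : IsManifold 𝓘(ℂ, E) 2 X := IsManifold.of_le (n := ω) le_top
  rw [mvfderiv_eq hfS, mvfderiv_eq hfT, mvfderiv_eq (hf.mdifferentiableAt (by simp))]
  rw [← mlieBracketWithin_univ, mlieBracketWithin_apply, mfderiv_extChartAt_self]
  have key : ∀ S : Π x : X, TangentSpace 𝓘(ℂ, E) x,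
    ((fun y => mvfderiv 𝓘(ℂ, E) f y (S y)) ∘ (extChartAt 𝓘(ℂ, E) x).symm) =ᶠ[𝓝 (extChartAt 𝓘(ℂ, E) x x)]
      fun z => fderiv ℂ (f ∘ (extChartAt 𝓘(ℂ, E) x).symm) z (mpullbackWithin 𝓘(ℂ, E) 𝓘(ℂ, E) (extChartAt 𝓘(ℂ, E) x).symm S (range 𝓘(ℂ, E)) z) := by
    intro S
    have hev : ∀ᶠ y in 𝓝 x, ContMDiffAt 𝓘(ℂ, E) 𝓘(ℂ, ℂ) 1 f y :=
      (contMDiffAt_iff_contMDiffAt_nhds (by simp)).1 (hf.of_le le_top)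
    have hc : Filter.Tendsto (extChartAt 𝓘(ℂ, E) x).symm (𝓝 (extChartAt 𝓘(ℂ, E) x x)) (𝓝 x) := by
      have := continuousAt_extChartAt_symm (I := 𝓘(ℂ, E)) x
      rwa [ContinuousAt, extChartAt_to_inv] at this
    filter_upwards [hc.eventually hev, extChartAt_target_mem_nhds (I := 𝓘(ℂ, E)) x] with z hz hzt
    have h1 : MDifferentiableAt 𝓘(ℂ, E) 𝓘(ℂ, E) (extChartAt 𝓘(ℂ, E) x).symm z :=
      (mdifferentiableWithinAt_extChartAt_symm (I := 𝓘(ℂ, E)) hzt).mdifferentiableAt (by simp)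
    have hinv := isInvertible_mfderivWithin_extChartAt_symm (I := 𝓘(ℂ, E)) hzt
    have hr : range 𝓘(ℂ, E) = univ := by simp
    rw [hr, mfderivWithin_univ] at hinv
    have h2 := mfderiv_comp z (hz.mdifferentiableAt (by simp)) h1
    rw [mfderiv_eq_fderiv] at h2
    rw [h2]
    simp only [mpullbackWithin_apply, Function.comp_apply, hr, mfderivWithin_univ]
    exact congrArg (mfderiv 𝓘(ℂ, E) 𝓘(ℂ, ℂ) f ((extChartAt 𝓘(ℂ, E) x).symm z))
      (hinv.self_apply_inverse (S ((extChartAt 𝓘(ℂ, E) x).symm z))).symm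
  have hx (S : Π x : X, TangentSpace 𝓘(ℂ, E) x) : mpullbackWithin 𝓘(ℂ, E) 𝓘(ℂ, E) (extChartAt 𝓘(ℂ, E) x).symm S (range 𝓘(ℂ, E)) (extChartAt 𝓘(ℂ, E) x x) = (show E from S x) := by
    have h1 : (show E from S ((extChartAt 𝓘(ℂ, E) x).symm (extChartAt 𝓘(ℂ, E) x x))) = S x :=
      congrArg (fun y => (show E from S y)) (extChartAt_to_inv x)
    exact (congrArg _ h1).trans (mfderivWithin_extChartAt_symm_inverse_apply (I := 𝓘(ℂ, E)) (S x))
  have hinvid : (ContinuousLinearMap.id ℂ E).inverse = ContinuousLinearMap.id ℂ E :=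
    ContinuousLinearMap.inverse_id
  have huniv (S' T' : E → E) (p : E) :
      lieBracketWithin ℂ S' T' univ p = lieBracket ℂ S' T' p := by rw [lieBracketWithin_univ]
  have hset : (extChartAt 𝓘(ℂ, E) x).symm ⁻¹' univ ∩ range 𝓘(ℂ, E) = univ := by simp
  have hdiff {S : Π x : X, TangentSpace 𝓘(ℂ, E) x} (hS : MDifferentiableAt 𝓘(ℂ, E)
      (𝓘(ℂ, E).prod 𝓘(ℂ, E)) (fun x => (⟨x, S x⟩ : TangentBundle 𝓘(ℂ, E) X)) x) :=
    (hS.mdifferentiableWithinAt (s := univ)).differentiableWithinAt_mpullbackWithin_vectorField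
      |>.differentiableAt (by simp)
  rw [(key S).fderiv_eq, (key T).fderiv_eq]
  have := fderiv_apply_lieBracket (𝕜 := ℂ) (n := ω) (f := f ∘ (extChartAt 𝓘(ℂ, E) x).symm)
    (x := extChartAt 𝓘(ℂ, E) x x)
    (V := mpullbackWithin 𝓘(ℂ, E) 𝓘(ℂ, E) (extChartAt 𝓘(ℂ, E) x).symm S (range 𝓘(ℂ, E)))
    (W := mpullbackWithin 𝓘(ℂ, E) 𝓘(ℂ, E) (extChartAt 𝓘(ℂ, E) x).symm T (range 𝓘(ℂ, E)))
    ?_ le_top (hdiff hT) (hdiff hS)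
  · rw [hx, hx] at this
    refine Eq.trans ?_ this
    rw [hset]
    refine Eq.trans (congrArg (fun A : E →L[ℂ] E => fderiv ℂ (f ∘ (extChartAt 𝓘(ℂ, E) x).symm)
      (extChartAt 𝓘(ℂ, E) x x) (A (lieBracketWithin ℂ
        (mpullbackWithin 𝓘(ℂ, E) 𝓘(ℂ, E) (extChartAt 𝓘(ℂ, E) x).symm S (range 𝓘(ℂ, E)))
        (mpullbackWithin 𝓘(ℂ, E) 𝓘(ℂ, E) (extChartAt 𝓘(ℂ, E) x).symm T (range 𝓘(ℂ, E)))
        univ (extChartAt 𝓘(ℂ, E) x x)))) hinvid) ?_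
    exact congrArg (fderiv ℂ (f ∘ (extChartAt 𝓘(ℂ, E) x).symm) (extChartAt 𝓘(ℂ, E) x x)) (huniv _ _ _)
  · have := hf
    rw [contMDiffAt_iff] at this
    exact this.2.contDiffAt (by simp)

theorem contMDiffAt_extendZero {U : Opens X} {f : U → ℂ} (hf : f ∈ holFun E U) {x : X} (hx : x ∈ U) :
    ContMDiffAt 𝓘(ℂ, E) 𝓘(ℂ, ℂ) ω (extendZero (V := fun _ => ℂ) f) x :=
  ContMDiffOn.contMDiffAt hf (U.isOpen.mem_nhds hx)

theorem mdiffAt_extendZero {U : Opens X} {f : U → ℂ} (hf : f ∈ holFun E U) {x : X} (hx : x ∈ U) :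
    MDifferentiableAt 𝓘(ℂ, E) 𝓘(ℂ, ℂ) (extendZero (V := fun _ => ℂ) f) x :=
  (contMDiffAt_extendZero hf hx).mdifferentiableAt (by simp)

/-- The holomorphic vector fields on `U`. -/
noncomputable abbrev holVec (E : Type*) [NormedAddCommGroup E] [NormedSpace ℂ E] [ChartedSpace E X]
    [IsManifold 𝓘(ℂ, E) ω X] (U : Opens X) :=
  holSec E E (fun x : X => TangentSpace 𝓘(ℂ, E) x) U

theorem contMDiffAt_vec {U : Opens X} {s : Π x : U, TangentSpace 𝓘(ℂ, E) (x : X)}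
    (hs : s ∈ holVec E U) {x : X} (hx : x ∈ U) :
    ContMDiffAt 𝓘(ℂ, E) (𝓘(ℂ, E).prod 𝓘(ℂ, E)) ω
      (fun x => (⟨x, extendZero s x⟩ : TangentBundle 𝓘(ℂ, E) X)) x :=
  ContMDiffOn.contMDiffAt hs (U.isOpen.mem_nhds hx)

theorem mdiffAt_vec {U : Opens X} {s : Π x : U, TangentSpace 𝓘(ℂ, E) (x : X)}
    (hs : s ∈ holVec E U) {x : X} (hx : x ∈ U) :
    MDifferentiableAt 𝓘(ℂ, E) (𝓘(ℂ, E).prod 𝓘(ℂ, E))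
      (fun x => (⟨x, extendZero s x⟩ : TangentBundle 𝓘(ℂ, E) X)) x :=
  (contMDiffAt_vec hs hx).mdifferentiableAt (by simp)

theorem extendZero_dirDeriv {U : Opens X} (s : Π x : U, TangentSpace 𝓘(ℂ, E) (x : X)) (f : U → ℂ)
    {x : X} (hx : x ∈ U) :
    extendZero (V := fun _ => ℂ) (dirDeriv s f) =ᶠ[𝓝 x]
      fun y => mvfderiv 𝓘(ℂ, E) (extendZero (V := fun _ => ℂ) f) y (extendZero s y) := by
  filter_upwards [U.isOpen.mem_nhds hx] with y hy
  rw [extendZero_of_mem _ hy, extendZero_of_mem _ hy]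
  rfl

theorem mvfderiv_congr {f g : X → ℂ} {x : X} (h : f =ᶠ[𝓝 x] g) (v : TangentSpace 𝓘(ℂ, E) x) :
    mvfderiv 𝓘(ℂ, E) f x v = mvfderiv 𝓘(ℂ, E) g x v := by
  simp only [mvfderiv, h.mfderiv_eq, ContinuousLinearMap.comp_apply]
  rfl

theorem dirDeriv_lieBr [CompleteSpace E] {U : Opens X} {s t : Π x : U, TangentSpace 𝓘(ℂ, E) (x : X)}
    (hs : s ∈ holVec E U) (ht : t ∈ holVec E U) {f : U → ℂ} (hf : f ∈ holFun E U) :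
    dirDeriv (lieBr s t) f = dirDeriv s (dirDeriv t f) - dirDeriv t (dirDeriv s f) := by
  funext ⟨x, hx⟩
  have h1 := extendZero_dirDeriv s f hx
  have h2 := extendZero_dirDeriv t f hx
  have := mvfderiv_mlieBracket (contMDiffAt_extendZero hf hx) (mdiffAt_vec hs hx) (mdiffAt_vec ht hx)
    (h1.mdifferentiableAt_iff.1 (mdiffAt_extendZero (dirDeriv_mem hs hf) hx))
    (h2.mdifferentiableAt_iff.1 (mdiffAt_extendZero (dirDeriv_mem ht hf) hx))
  rw [← mvfderiv_congr h1, ← mvfderiv_congr h2, extendZero_of_mem s hx, extendZero_of_mem t hx] at this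
  exact this

theorem lieBr_mem [CompleteSpace E] {U : Opens X} {s t : Π x : U, TangentSpace 𝓘(ℂ, E) (x : X)}
    (hs : s ∈ holVec E U) (ht : t ∈ holVec E U) : lieBr s t ∈ holVec E U := by
  have : IsManifold 𝓘(ℂ, E) (ω + 1) X := ‹IsManifold 𝓘(ℂ, E) ω X›
  intro x hx
  have := ContMDiffWithinAt.mlieBracketWithin_vectorField (m := ω) (n := ω) (hs x hx) (ht x hx)
    U.isOpen.uniqueMDiffOn hx le_top
  refine this.congr ?_ ?_
  · intro y hy
    rw [extendZero_of_mem _ hy, mlieBracketWithin_of_isOpen U.isOpen hy]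
    rfl
  · rw [extendZero_of_mem _ hx, mlieBracketWithin_of_isOpen U.isOpen hx]
    rfl

theorem lieBr_add_left [CompleteSpace E] {U : Opens X} {s s' : Π x : U, TangentSpace 𝓘(ℂ, E) (x : X)}
    (hs : s ∈ holVec E U) (hs' : s' ∈ holVec E U) (t : Π x : U, TangentSpace 𝓘(ℂ, E) (x : X)) :
    lieBr (s + s') t = lieBr s t + lieBr s' t := by
  funext ⟨x, hx⟩
  simp only [lieBr, extendZero_add, Pi.add_apply]
  exact mlieBracket_add_left (mdiffAt_vec hs hx) (mdiffAt_vec hs' hx)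

theorem lieBr_add_right [CompleteSpace E] {U : Opens X} {t t' : Π x : U, TangentSpace 𝓘(ℂ, E) (x : X)}
    (s : Π x : U, TangentSpace 𝓘(ℂ, E) (x : X)) (ht : t ∈ holVec E U) (ht' : t' ∈ holVec E U)  :
    lieBr s (t + t') = lieBr s t + lieBr s t' := by
  funext ⟨x, hx⟩
  simp only [lieBr, extendZero_add, Pi.add_apply]
  exact mlieBracket_add_right (mdiffAt_vec ht hx) (mdiffAt_vec ht' hx)

theorem lieBr_self {U : Opens X} (s : Π x : U, TangentSpace 𝓘(ℂ, E) (x : X)) : lieBr s s = 0 := by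
  funext x
  simp [lieBr]

theorem lieBr_smul_right [CompleteSpace E] {U : Opens X} {t : Π x : U, TangentSpace 𝓘(ℂ, E) (x : X)}
    (s : Π x : U, TangentSpace 𝓘(ℂ, E) (x : X)) (ht : t ∈ holVec E U)
    {f : U → ℂ} (hf : f ∈ holFun E U) :
    lieBr s (f • t) = f • lieBr s t + dirDeriv s f • t := by
  funext ⟨x, hx⟩
  have := mlieBracket_smul_right (V := extendZero s) (mdiffAt_extendZero hf hx) (mdiffAt_vec ht hx)
  simp only [lieBr, extendZero_smul, dirDeriv, Pi.add_apply, Pi.smul_apply']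
  rw [this, add_comm, extendZero_of_mem s hx, extendZero_of_mem t hx,
    extendZero_of_mem (V := fun _ => ℂ) f hx]

theorem extendZero_lieBr {U : Opens X} (s t : Π x : U, TangentSpace 𝓘(ℂ, E) (x : X))
    {x : X} (hx : x ∈ U) :
    ∀ᶠ y in 𝓝 x, extendZero (lieBr s t) y =
      mlieBracket 𝓘(ℂ, E) (extendZero s) (extendZero t) y := by
  filter_upwards [U.isOpen.mem_nhds hx] with y hy
  rw [extendZero_of_mem _ hy]
  rfl

theorem lieBr_leibniz [CompleteSpace E] {U : Opens X} {s t r : Π x : U, TangentSpace 𝓘(ℂ, E) (x : X)}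
    (hs : s ∈ holVec E U) (ht : t ∈ holVec E U) (hr : r ∈ holVec E U) :
    lieBr s (lieBr t r) = lieBr (lieBr s t) r + lieBr t (lieBr s r) := by
  have : IsManifold 𝓘(ℂ, E) (minSmoothness ℂ 3) X := IsManifold.of_le (n := ω) le_top
  funext ⟨x, hx⟩
  have := leibniz_identity_mlieBracket_apply (I := 𝓘(ℂ, E)) ((contMDiffAt_vec hs hx).of_le le_top)
    ((contMDiffAt_vec ht hx).of_le le_top) ((contMDiffAt_vec hr hx).of_le le_top)
  have h1 := Filter.EventuallyEq.mlieBracket_vectorField_eq (I := 𝓘(ℂ, E))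
    (Filter.EventuallyEq.refl _ (extendZero s)) (extendZero_lieBr t r hx)
  have h2 := Filter.EventuallyEq.mlieBracket_vectorField_eq (I := 𝓘(ℂ, E))
    (extendZero_lieBr s t hx) (Filter.EventuallyEq.refl _ (extendZero r))
  have h3 := Filter.EventuallyEq.mlieBracket_vectorField_eq (I := 𝓘(ℂ, E))
    (Filter.EventuallyEq.refl _ (extendZero t)) (extendZero_lieBr s r hx)
  exact h1.trans (this.trans (congrArg₂ (fun a b : TangentSpace 𝓘(ℂ, E) x => a + b) h2.symm h3.symm))

theorem lieBr_restrict {U W : Opens X} (h : W ≤ U) (s t : Π x : U, TangentSpace 𝓘(ℂ, E) (x : X)) :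
    lieBr (restrict h s) (restrict h t) = restrict h (lieBr s t) := by
  funext ⟨x, hx⟩
  exact Filter.EventuallyEq.mlieBracket_vectorField_eq
    (extendZero_restrict_eventuallyEq h s hx) (extendZero_restrict_eventuallyEq h t hx)

theorem dirDeriv_restrict {U W : Opens X} (h : W ≤ U) (s : Π x : U, TangentSpace 𝓘(ℂ, E) (x : X))
    (f : U → ℂ) :
    dirDeriv (restrict h s) (restrict (V := fun _ => ℂ) h f) =
      restrict (V := fun _ => ℂ) h (dirDeriv s f) := by
  funext ⟨x, hx⟩
  exact mvfderiv_congr (extendZero_restrict_eventuallyEq (V := fun _ => ℂ) h f hx) _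

theorem dirDeriv_add {U : Opens X} (s : Π x : U, TangentSpace 𝓘(ℂ, E) (x : X))
    {f g : U → ℂ} (hf : f ∈ holFun E U) (hg : g ∈ holFun E U) :
    dirDeriv s (f + g) = dirDeriv s f + dirDeriv s g := by
  funext ⟨x, hx⟩
  have := mvfderiv_add (mdiffAt_extendZero hf hx) (mdiffAt_extendZero hg hx)
  simp only [dirDeriv, Pi.add_apply]
  rw [extendZero_add (V := fun _ => ℂ), this]
  rfl

theorem dirDeriv_mul {U : Opens X} (s : Π x : U, TangentSpace 𝓘(ℂ, E) (x : X))
    {f g : U → ℂ} (hf : f ∈ holFun E U) (hg : g ∈ holFun E U) :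
    dirDeriv s (f * g) = f * dirDeriv s g + dirDeriv s f * g := by
  funext ⟨x, hx⟩
  have h1 : extendZero (V := fun _ => ℂ) (f * g) =
      extendZero (V := fun _ => ℂ) f * extendZero (V := fun _ => ℂ) g :=
    extendZero_smul (V := fun _ => ℂ) f g
  have := mvfderiv_mul (mdiffAt_extendZero hf hx) (mdiffAt_extendZero hg hx)
  simp only [dirDeriv, Pi.add_apply, Pi.mul_apply]
  rw [h1, this, extendZero_of_mem (V := fun _ => ℂ) f hx, extendZero_of_mem (V := fun _ => ℂ) g hx]
  simp [mul_comm]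

theorem dirDeriv_const {U : Opens X} (s : Π x : U, TangentSpace 𝓘(ℂ, E) (x : X)) (c : ℂ) :
    dirDeriv s (fun _ => c) = 0 := by
  funext ⟨x, hx⟩
  have : extendZero (V := fun _ => ℂ) (fun _ : U => c) =ᶠ[𝓝 x] fun _ => c := by
    filter_upwards [U.isOpen.mem_nhds hx] with y hy
    rw [extendZero_of_mem _ hy]
  simp only [dirDeriv]
  rw [mvfderiv_congr this, mvfderiv_const]
  rfl

theorem restrict_mem_holFun {U W : Opens X} (h : W ≤ U) {f : U → ℂ} (hf : f ∈ holFun E U) :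
    restrict (V := fun _ => ℂ) h f ∈ holFun E W := by
  refine (ContMDiffOn.mono hf h).congr fun x hx => ?_
  rw [extendZero_of_mem _ hx, extendZero_of_mem (V := fun _ => ℂ) f (h hx)]
  rfl

theorem restrict_mem_holSec {U W : Opens X} (h : W ≤ U) {s : Π x : U, V x} (hs : s ∈ holSec E F V U) :
    restrict h s ∈ holSec E F V W := by
  refine (ContMDiffOn.mono hs h).congr fun x hx => ?_
  rw [extendZero_of_mem _ hx, extendZero_of_mem s (h hx)]
  rfl

theorem mem_holFun_of_local {U : Opens X} {f : U → ℂ}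
    (h : ∀ x : U, ∃ (W : Opens X) (hW : W ≤ U), (x : X) ∈ W ∧ restrict (V := fun _ => ℂ) hW f ∈ holFun E W) :
    f ∈ holFun E U := by
  intro x hx
  obtain ⟨W, hW, hxW, hf⟩ := h ⟨x, hx⟩
  refine ContMDiffAt.contMDiffWithinAt ?_
  exact (contMDiffAt_extendZero hf hxW).congr_of_eventuallyEq
    (Filter.EventuallyEq.symm (extendZero_restrict_eventuallyEq (V := fun _ => ℂ) hW f hxW))

theorem mem_holSec_of_local {U : Opens X} {s : Π x : U, V x}
    (h : ∀ x : U, ∃ (W : Opens X) (hW : W ≤ U), (x : X) ∈ W ∧ restrict hW s ∈ holSec E F V W) :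
    s ∈ holSec E F V U := by
  intro x hx
  obtain ⟨W, hW, hxW, hf⟩ := h ⟨x, hx⟩
  refine ContMDiffAt.contMDiffWithinAt ?_
  refine (ContMDiffOn.contMDiffAt hf (W.isOpen.mem_nhds hxW)).congr_of_eventuallyEq ?_
  filter_upwards [extendZero_restrict_eventuallyEq hW s hxW] with y hy
  rw [hy]

variable (E) in
/-- A holomorphic Lie algebroid structure on the holomorphic vector bundle `V`: a holomorphic anchor
to the holomorphic tangent bundle, and a sheaf of Lie algebras structure on the holomorphic
sections, subject to the Leibniz rule (which makes the bracket `ℂ`-bilinear). -/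
structure HolomorphicLieAlgebroid where
  anchor (x : X) : V x →ₗ[ℂ] TangentSpace 𝓘(ℂ, E) x
  contMDiff_anchor : ContMDiff (𝓘(ℂ, E).prod 𝓘(ℂ, F)) (𝓘(ℂ, E).prod 𝓘(ℂ, E)) ω
    (fun p : TotalSpace F V => (⟨p.proj, anchor p.proj p.snd⟩ : TangentBundle 𝓘(ℂ, E) X))
  bracket (U : Opens X) : holSec E F V U → holSec E F V U → holSec E F V U
  bracket_restrict {U W : Opens X} (h : W ≤ U) (s t : holSec E F V U) :
    bracket W ⟨restrict h s, restrict_mem_holSec F V h s.2⟩ ⟨restrict h t, restrict_mem_holSec F V h t.2⟩ =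
      restrict h (bracket U s t : Π x : U, V x)
  bracket_add_left {U : Opens X} (s s' t : holSec E F V U) :
    bracket U (s + s') t = bracket U s t + bracket U s' t
  bracket_add_right {U : Opens X} (s t t' : holSec E F V U) :
    bracket U s (t + t') = bracket U s t + bracket U s t'
  bracket_self {U : Opens X} (s : holSec E F V U) : bracket U s s = 0
  jacobi {U : Opens X} (s t r : holSec E F V U) :
    bracket U s (bracket U t r) = bracket U (bracket U s t) r + bracket U t (bracket U s r)
  anchor_bracket {U : Opens X} (s t : holSec E F V U) (x : U) :
    anchor x ((bracket U s t : Π x : U, V x) x) =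
      lieBr (fun y : U => anchor y ((s : Π x : U, V x) y)) (fun y : U => anchor y ((t : Π x : U, V x) y)) x
  leibniz {U : Opens X} (s t : holSec E F V U) (f : holFun E U) (x : U) :
    (bracket U s ⟨(f : U → ℂ) • (t : Π x : U, V x), (holSec E F V U).smul_mem f t.2⟩ :
      Π x : U, V x) x =
      (f : U → ℂ) x • (bracket U s t : Π x : U, V x) x +
        dirDeriv (fun y : U => anchor y ((s : Π x : U, V x) y)) f x • (t : Π x : U, V x) x

namespace HolomorphicLieAlgebroid
variable {F V} (A : HolomorphicLieAlgebroid E F V)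

/-- The anchor has constant rank. -/
def IsRegular : Prop := ∃ r : ℕ, ∀ x : X, Module.finrank ℂ (LinearMap.range (A.anchor x)) = r

theorem anchor_mem {U : Opens X} {s : Π x : U, V x} (hs : s ∈ holSec E F V U) :
    (fun y : U => A.anchor y (s y)) ∈ holVec E U := by
  have := A.contMDiff_anchor.comp_contMDiffOn (hs : ContMDiffOn _ _ _ _ _)
  refine this.congr fun x hx => ?_
  simp only [Function.comp_apply]
  rw [extendZero_of_mem _ hx, extendZero_of_mem s hx]

/-- The sections over `U` of the image sheaf `𝒟` of the anchor: the vector fields that locally are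
of the form `a(s)` with `s` a holomorphic section. -/
noncomputable def image (U : Opens X) : Submodule (holFun E U) (Π x : U, TangentSpace 𝓘(ℂ, E) (x : X)) where
  carrier := {v | ∀ x : U, ∃ (W : Opens X) (hW : W ≤ U), (x : X) ∈ W ∧
    ∃ s ∈ holSec E F V W, restrict hW v = fun y : W => A.anchor y (s y)}
  add_mem' {v v'} hv hv' x := by
    obtain ⟨W, hW, hx, s, hs, hsv⟩ := hv x
    obtain ⟨W', hW', hx', s', hs', hsv'⟩ := hv' x
    refine ⟨W ⊓ W', inf_le_left.trans hW, ⟨hx, hx'⟩, restrict inf_le_left s + restrict inf_le_right s',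
      add_mem (restrict_mem_holSec F V _ hs) (restrict_mem_holSec F V _ hs'), ?_⟩
    funext y
    have h1 := congrFun hsv ⟨y, y.2.1⟩
    have h2 := congrFun hsv' ⟨y, y.2.2⟩
    simp only [restrict, Pi.add_apply, map_add] at h1 h2 ⊢
    rw [h1, h2]
  zero_mem' x := by
    refine ⟨U, le_rfl, x.2, 0, zero_mem _, ?_⟩
    funext y
    simp [restrict]
  smul_mem' f v hv x := by
    obtain ⟨W, hW, hx, s, hs, hsv⟩ := hv x
    refine ⟨W, hW, hx, (restrict (V := fun _ => ℂ) hW f : W → ℂ) • s,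
      (holSec E F V W).smul_mem ⟨_, restrict_mem_holFun hW f.2⟩ hs, ?_⟩
    funext y
    have h1 := congrFun hsv y
    simp only [Pi.smul_apply', map_smul]
    rw [← h1]
    rfl

theorem image_le {U : Opens X} : A.image U ≤ holVec E U := by
  intro v hv
  refine mem_holSec_of_local _ _ fun x => ?_
  obtain ⟨W, hW, hx, s, hs, hsv⟩ := hv x
  exact ⟨W, hW, hx, hsv ▸ A.anchor_mem hs⟩

theorem restrict_mem_image {U W : Opens X} (h : W ≤ U) {v : Π x : U, TangentSpace 𝓘(ℂ, E) (x : X)}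
    (hv : v ∈ A.image U) : restrict h v ∈ A.image W := by
  intro x
  obtain ⟨W', hW', hx', s', hs', hsv'⟩ := hv ⟨x, h x.2⟩
  refine ⟨W ⊓ W', inf_le_left, ⟨x.2, hx'⟩, restrict inf_le_right s',
      restrict_mem_holSec F V _ hs', ?_⟩
  funext y
  exact congrFun hsv' ⟨y, y.2.2⟩

theorem lieBr_mem_image {U : Opens X} {v w : Π x : U, TangentSpace 𝓘(ℂ, E) (x : X)}
    (hv : v ∈ A.image U) (hw : w ∈ A.image U) : lieBr v w ∈ A.image U := by
  intro x
  obtain ⟨W, hW, hx, s, hs, hsv⟩ := hv x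
  obtain ⟨W', hW', hx', s', hs', hsv'⟩ := hw x
  have hs1 := restrict_mem_holSec F V (inf_le_left : W ⊓ W' ≤ W) hs
  have hs2 := restrict_mem_holSec F V (inf_le_right : W ⊓ W' ≤ W') hs'
  refine ⟨W ⊓ W', inf_le_left.trans hW, ⟨hx, hx'⟩, A.bracket _ ⟨_, hs1⟩ ⟨_, hs2⟩, Subtype.coe_prop _, ?_⟩
  funext y
  rw [← lieBr_restrict, A.anchor_bracket]
  congr 1
  · funext z
    exact congrFun hsv ⟨z, z.2.1⟩
  · funext z
    exact congrFun hsv' ⟨z, z.2.2⟩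

noncomputable instance (U : Opens X) : SMul (holFun E U) (A.image U) := (Submodule.module (A.image U)).toSMul

noncomputable instance (U : Opens X) : Module (holFun E U) (A.image U) := Submodule.module (A.image U)

variable [FiniteDimensional ℂ E]

noncomputable instance (U : Opens X) : LieRing (A.image U) :=
  have : CompleteSpace E := FiniteDimensional.complete ℂ E
  { bracket := fun v w => ⟨lieBr v.1 w.1, A.lieBr_mem_image v.2 w.2⟩
    add_lie := fun v v' w => Subtype.ext (lieBr_add_left (A.image_le v.2) (A.image_le v'.2) w.1)
    lie_add := fun v w w' => Subtype.ext (lieBr_add_right v.1 (A.image_le w.2) (A.image_le w'.2))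
    lie_self := fun v => Subtype.ext (lieBr_self v.1)
    leibniz_lie := fun u v w =>
      Subtype.ext (lieBr_leibniz (A.image_le u.2) (A.image_le v.2) (A.image_le w.2)) }

noncomputable instance (U : Opens X) : Bracket (A.image U) (holFun E U) :=
  ⟨fun v f => ⟨dirDeriv v.1 f.1, dirDeriv_mem (A.image_le v.2) f.2⟩⟩

theorem coe_lie {U : Opens X} (v w : A.image U) : (⁅v, w⁆ : A.image U).1 = lieBr v.1 w.1 := rfl

theorem coe_lie_fun {U : Opens X} (v : A.image U) (f : holFun E U) :
    (⁅v, f⁆ : holFun E U).1 = dirDeriv v.1 f.1 := rfl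

theorem dirDeriv_add_left {U : Opens X} (s t : Π x : U, TangentSpace 𝓘(ℂ, E) (x : X)) (f : U → ℂ) :
    dirDeriv (s + t) f = dirDeriv s f + dirDeriv t f := by
  funext x
  exact map_add (mvfderiv 𝓘(ℂ, E) _ (x : X)) _ _

noncomputable instance (U : Opens X) : LieRingModule (A.image U) (holFun E U) :=
  have : CompleteSpace E := FiniteDimensional.complete ℂ E
  { add_lie := fun v v' f => Subtype.ext (dirDeriv_add_left v.1 v'.1 f.1)
    lie_add := fun v f g => Subtype.ext (dirDeriv_add v.1 f.2 g.2)
    leibniz_lie := fun v w f => Subtype.ext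
      (by
        have h := dirDeriv_lieBr (A.image_le v.2) (A.image_le w.2) f.2
        exact (sub_eq_iff_eq_add.1 h.symm)) }

instance (U : Opens X) : LieRinehartRing (holFun E U) (A.image U) :=
  have : CompleteSpace E := FiniteDimensional.complete ℂ E
  { lie_smul_eq_mul' := fun f g v => Subtype.ext (by
      funext x
      exact map_smul (mvfderiv 𝓘(ℂ, E) _ (x : X)) _ _)
    leibniz_mul_right' := fun v f g => Subtype.ext (dirDeriv_mul v.1 f.2 g.2)
    leibniz_smul_right' := fun v w f => Subtype.ext (lieBr_smul_right v.1 (A.image_le w.2) f.2) }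

end HolomorphicLieAlgebroid

end

section
open VectorField Set LieRinehartCochain

variable {X : Type u} [TopologicalSpace X] {E : Type u} [NormedAddCommGroup E] [NormedSpace ℂ E]
  [ChartedSpace E X] [IsManifold 𝓘(ℂ, E) ω X]

/-- Restriction of holomorphic functions. -/
def resFun {U W : Opens X} (h : W ≤ U) (f : holFun E U) : holFun E W :=
  ⟨restrict (V := fun _ => ℂ) h f.1, restrict_mem_holFun h f.2⟩

variable [FiniteDimensional ℂ E] {F : Type*} [NormedAddCommGroup F] [NormedSpace ℂ F] {V : X → Type*}
  [∀ x, AddCommGroup (V x)] [∀ x, Module ℂ (V x)] [∀ x, TopologicalSpace (V x)]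
  [TopologicalSpace (TotalSpace F V)] [FiberBundle F V] [VectorBundle ℂ F V]

theorem resFun_add {U W : Opens X} (h : W ≤ U) (f g : holFun E U) :
    resFun h (f + g) = resFun h f + resFun h g := rfl

theorem resFun_mul {U W : Opens X} (h : W ≤ U) (f g : holFun E U) :
    resFun h (f * g) = resFun h f * resFun h g := rfl

theorem resFun_smul {U W : Opens X} (h : W ≤ U) (c : ℂ) (g : holFun E U) :
    resFun h (c • g) = c • resFun h g := rfl

theorem resFun_sum {U W : Opens X} (h : W ≤ U) {ι : Type*} (s : Finset ι) (f : ι → holFun E U) :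
    resFun h (∑ i ∈ s, f i) = ∑ i ∈ s, resFun h (f i) :=
  map_sum ({ toFun := resFun h, map_zero' := rfl, map_add' := resFun_add h } :
    holFun E U →+ holFun E W) f s

theorem holFun_ext_local {U : Opens X} {f g : holFun E U}
    (h : ∀ x : U, ∃ (W : Opens X) (hW : W ≤ U), (x : X) ∈ W ∧ resFun hW f = resFun hW g) : f = g := by
  refine Subtype.ext (funext fun x => ?_)
  obtain ⟨W, hW, hx, he⟩ := h x
  exact congrFun (congrArg Subtype.val he) ⟨x, hx⟩

/-- Holomorphic functions that agree on overlaps glue. -/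
theorem exists_glue {U : Opens X} {ι : Type*} (W : ι → Opens X) (hW : ∀ i, W i ≤ U)
    (hc : ∀ x ∈ U, ∃ i, x ∈ W i) (f : ∀ i, holFun E (W i))
    (hf : ∀ i j, resFun (inf_le_left : W i ⊓ W j ≤ W i) (f i) = resFun inf_le_right (f j)) :
    ∃ g : holFun E U, ∀ i, resFun (hW i) g = f i := by
  choose i hi using hc
  have key (x : X) (j j' : ι) (hj : x ∈ W j) (hj' : x ∈ W j') : (f j).1 ⟨x, hj⟩ = (f j').1 ⟨x, hj'⟩ :=
    congrFun (congrArg Subtype.val (hf j j')) ⟨x, hj, hj'⟩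
  let g : U → ℂ := fun x => (f (i x x.2)).1 ⟨x, hi x x.2⟩
  have hg (j : ι) : restrict (V := fun _ => ℂ) (hW j) g = (f j).1 := by
    funext x
    exact key x _ j _ x.2
  refine ⟨⟨g, mem_holFun_of_local fun x => ⟨W (i x x.2), hW _, hi x x.2, ?_⟩⟩, fun j => Subtype.ext (hg j)⟩
  rw [hg]
  exact (f _).2

namespace HolomorphicLieAlgebroid
variable (A : HolomorphicLieAlgebroid E F V)

/-- Restriction of sections of the image of the anchor. -/
def resImage {U W : Opens X} (h : W ≤ U) (v : A.image U) : A.image W :=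
  ⟨restrict h v.1, A.restrict_mem_image h v.2⟩

theorem resImage_add {U W : Opens X} (h : W ≤ U) (v w : A.image U) :
    A.resImage h (v + w) = A.resImage h v + A.resImage h w := rfl

theorem resImage_smul {U W : Opens X} (h : W ≤ U) (c : holFun E U) (v : A.image U) :
    A.resImage h (c • v) = resFun h c • A.resImage h v := rfl

theorem resImage_update {U W : Opens X} (h : W ≤ U) {k : ℕ} (v : Fin k → A.image U) (l : Fin k)
    (x : A.image U) : (fun m => A.resImage h (Function.update v l x m)) =
      Function.update (fun m => A.resImage h (v m)) l (A.resImage h x) := by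
  funext m
  simp only [Function.update_apply]
  split_ifs <;> rfl

theorem resFun_lie {U W : Opens X} (h : W ≤ U) (v : A.image U) (f : holFun E U) :
    resFun h ⁅v, f⁆ = ⁅A.resImage h v, resFun h f⁆ :=
  Subtype.ext (dirDeriv_restrict h v.1 f.1).symm

theorem resImage_lie {U W : Opens X} (h : W ≤ U) (v w : A.image U) :
    A.resImage h ⁅v, w⁆ = ⁅A.resImage h v, A.resImage h w⁆ :=
  Subtype.ext (lieBr_restrict h v.1 w.1).symm

theorem lie_smul_complex {U : Opens X} (v : A.image U) (c : ℂ) (f : holFun E U) :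
    ⁅v, c • f⁆ = c • ⁅v, f⁆ := by
  have h1 : c • f = algebraMap ℂ (holFun E U) c * f := Algebra.smul_def c f
  have h2 : ⁅v, algebraMap ℂ (holFun E U) c⁆ = 0 := Subtype.ext (dirDeriv_const v.1 c)
  rw [h1, LieRinehartRing.leibniz_mul_right, h2, zero_mul, add_zero, Algebra.smul_def]
  rfl

/-- The sections over `U` of the `k`-th exterior power of the dual of the image of the anchor:
alternating `𝒪`-multilinear morphisms of sheaves `𝒟 × ⋯ × 𝒟 → 𝒪` over `U`. -/
def form (k : ℕ) (U : Opens X) :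
    Submodule ℂ (Π W : {W : Opens X // W ≤ U}, Cochain (holFun E W.1) (A.image W.1) k) where
  carrier := {α | ∀ (W W' : {W : Opens X // W ≤ U}) (h : W'.1 ≤ W.1) (v : Fin k → A.image W.1),
    resFun h (α W v) = α W' (fun i => A.resImage h (v i))}
  add_mem' {α β} hα hβ W W' h v := by
    simp only [Pi.add_apply, AlternatingMap.add_apply, resFun_add, hα W W' h, hβ W W' h]
  zero_mem' W W' h v := rfl
  smul_mem' c α hα W W' h v := by
    simp only [Pi.smul_apply, AlternatingMap.smul_apply, resFun_smul, hα W W' h]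

theorem formula_smul_complex {U : Opens X} {k : ℕ} (c : ℂ) (α : Cochain (holFun E U) (A.image U) k)
    (v : Fin (k + 1) → A.image U) : formula (c • α) v = c • formula α v := by
  have h (p : Prop) [Decidable p] (a : holFun E U) : (if p then c • a else 0) = c • if p then a else 0 := by
    split_ifs <;> simp
  simp only [formula, AlternatingMap.smul_apply, lie_smul_complex, mul_smul_comm, smul_add,
    Finset.smul_sum, h]

theorem resFun_formula {U W : Opens X} (h : W ≤ U) {k : ℕ} (α : Cochain (holFun E U) (A.image U) k)
    (β : Cochain (holFun E W) (A.image W) k)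
    (hαβ : ∀ v, resFun h (α v) = β (fun i => A.resImage h (v i))) (v : Fin (k + 1) → A.image U) :
    resFun h (formula α v) = formula β (fun i => A.resImage h (v i)) := by
  have h0 : resFun h (0 : holFun E U) = 0 := rfl
  have h1 (m : ℕ) : resFun h ((-1) ^ m : holFun E U) = (-1) ^ m := rfl
  have hu (i j : Fin (k + 1)) : (fun l => A.resImage h (j.removeNth (Function.update v i ⁅v i, v j⁆) l)) =
      j.removeNth (Function.update (fun l => A.resImage h (v l)) i
        ⁅A.resImage h (v i), A.resImage h (v j)⁆) := by
    funext l
    simp only [Fin.removeNth, Function.update_apply]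
    split_ifs
    · exact A.resImage_lie h _ _
    · rfl
  simp only [formula, resFun_add, resFun_sum, resFun_mul, h1, resFun_lie, hαβ, apply_ite (resFun h), h0, hu]
  rfl

/-- The differential `∂_𝒟` of the Lie algebroid `𝒟` on `k`-forms. -/
noncomputable def dForm (k : ℕ) (U : Opens X) : A.form k U →ₗ[ℂ] A.form (k + 1) U where
  toFun α := ⟨fun W => differential (α.1 W), fun W W' h v =>
    A.resFun_formula h (α.1 W) (α.1 W') (α.2 W W' h) v⟩
  map_add' _ _ := Subtype.ext (funext fun _ => differential_add _ _)
  map_smul' c α := Subtype.ext (funext fun W => AlternatingMap.ext fun v =>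
    A.formula_smul_complex c (α.1 W) v)

theorem dForm_dForm (k : ℕ) (U : Opens X) (α : A.form k U) : A.dForm (k + 1) U (A.dForm k U α) = 0 :=
  Subtype.ext (funext fun _ => differential_differential _)

/-- Restriction of forms. -/
noncomputable def resForm (k : ℕ) {U U' : Opens X} (h : U' ≤ U) : A.form k U →ₗ[ℂ] A.form k U' where
  toFun α := ⟨fun W => α.1 ⟨W.1, W.2.trans h⟩, fun W W' h' v => α.2 ⟨W.1, _⟩ ⟨W'.1, _⟩ h' v⟩
  map_add' _ _ := rfl
  map_smul' _ _ := rfl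

/-- The holomorphic functions are the `0`-forms. -/
noncomputable def zeroForm (U : Opens X) : holFun E U ≃ₗ[ℂ] A.form 0 U where
  toFun f := ⟨fun W => AlternatingMap.constOfIsEmpty (holFun E W.1) (A.image W.1) (Fin 0) (resFun W.2 f),
    fun _ _ _ _ => rfl⟩
  invFun α := α.1 ⟨U, le_rfl⟩ ![]
  map_add' _ _ := rfl
  map_smul' _ _ := rfl
  left_inv _ := rfl
  right_inv α := by
    refine Subtype.ext (funext fun W => AlternatingMap.ext fun v => ?_)
    refine (α.2 ⟨U, le_rfl⟩ W W.2 ![]).trans ?_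
    exact congrArg (α.1 W) (Subsingleton.elim _ _)

set_option maxHeartbeats 1000000 in
theorem form_glue (k : ℕ) {U : Opens X} {ι : Type*} (N : ι → Opens X) (hN : ∀ i, N i ≤ U)
    (hc : ∀ x ∈ U, ∃ i, x ∈ N i) (α : ∀ i, A.form k (N i))
    (hα : ∀ i j, A.resForm k (inf_le_left : N i ⊓ N j ≤ N i) (α i) =
      A.resForm k (inf_le_right : N i ⊓ N j ≤ N j) (α j)) :
    ∃! β : A.form k U, ∀ i, A.resForm k (hN i) β = α i := by
  have hinf (W : Opens X) (i) : W ⊓ N i ≤ N i := inf_le_right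
  have hloc (W W' : Opens X) (h : W' ≤ W) (i j) (hi : W' ≤ N i) (hj : W' ≤ N j) :
      (α i).1 ⟨W', hi⟩ = (α j).1 ⟨W', hj⟩ :=
    congrFun (congrArg Subtype.val (hα i j)) ⟨W', le_inf hi hj⟩
  have hex (W : {W : Opens X // W ≤ U}) (v : Fin k → A.image W.1) : ∃ g : holFun E W.1, ∀ i,
      resFun inf_le_left g = (α i).1 ⟨W.1 ⊓ N i, hinf _ i⟩ (fun l => A.resImage inf_le_left (v l)) := by
    refine exists_glue (fun i => W.1 ⊓ N i) (fun i => inf_le_left) (fun x hx => ?_) _ (fun i j => ?_)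
    · obtain ⟨i, hi⟩ := hc x (W.2 hx)
      exact ⟨i, hx, hi⟩
    · have h1 := (α i).2 ⟨W.1 ⊓ N i, hinf _ i⟩ ⟨(W.1 ⊓ N i) ⊓ (W.1 ⊓ N j), inf_le_left.trans (hinf _ i)⟩
        inf_le_left (fun l => A.resImage inf_le_left (v l))
      have h2 := (α j).2 ⟨W.1 ⊓ N j, hinf _ j⟩ ⟨(W.1 ⊓ N i) ⊓ (W.1 ⊓ N j), inf_le_right.trans (hinf _ j)⟩
        inf_le_right (fun l => A.resImage inf_le_left (v l))
      rw [h1, h2, hloc _ _ inf_le_left i j (inf_le_left.trans (hinf _ i)) (inf_le_right.trans (hinf _ j))]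
      rfl
  choose g hg using hex
  have huniq (W : {W : Opens X // W ≤ U}) (f f' : holFun E W.1)
      (h : ∀ i, resFun (inf_le_left : W.1 ⊓ N i ≤ W.1) f = resFun inf_le_left f') : f = f' := by
    refine holFun_ext_local fun x => ?_
    obtain ⟨i, hi⟩ := hc x (W.2 x.2)
    exact ⟨W.1 ⊓ N i, inf_le_left, ⟨x.2, hi⟩, h i⟩
  let β (W : {W : Opens X // W ≤ U}) : Cochain (holFun E W.1) (A.image W.1) k :=
    { toFun := g W
      map_update_add' := by
        intro _ v l x y
        have : (‹_› : DecidableEq (Fin k)) = instDecidableEqFin k := Subsingleton.elim _ _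
        subst this
        refine huniq W _ _ fun i => ?_
        rw [resFun_add, hg, hg, hg, resImage_update, resImage_update, resImage_update, resImage_add,
          AlternatingMap.map_update_add]
      map_update_smul' := by
        intro _ v l c x
        have : (‹_› : DecidableEq (Fin k)) = instDecidableEqFin k := Subsingleton.elim _ _
        subst this
        refine huniq W _ _ fun i => ?_
        rw [smul_eq_mul, resFun_mul, hg, hg, resImage_update, resImage_update, resImage_smul,
          AlternatingMap.map_update_smul, smul_eq_mul]
      map_eq_zero_of_eq' := by
        intro v l m hv hlm
        refine huniq W _ _ fun i => ?_
        rw [hg]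
        exact AlternatingMap.map_eq_zero_of_eq _ _ (by rw [hv]) hlm }
  have hβ : β ∈ A.form k U := by
    intro W W' h v
    refine huniq W' _ _ fun i => ?_
    change _ = resFun _ (g W' _)
    rw [hg]
    have h1 := (α i).2 ⟨W.1 ⊓ N i, hinf _ i⟩ ⟨W'.1 ⊓ N i, hinf _ i⟩ (inf_le_inf_right _ h)
      (fun l => A.resImage inf_le_left (v l))
    rw [← hg W v i] at h1
    exact h1
  refine ⟨⟨β, hβ⟩, fun i => ?_, fun γ hγ => ?_⟩
  · refine Subtype.ext (funext fun W => AlternatingMap.ext fun v => ?_)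
    change g ⟨W.1, _⟩ v = (α i).1 W v
    refine huniq ⟨W.1, W.2.trans (hN i)⟩ _ _ fun j => ?_
    rw [hg, (α i).2 W ⟨W.1 ⊓ N j, inf_le_left.trans W.2⟩ inf_le_left v]
    rw [hloc _ _ inf_le_left j i (hinf _ j) (inf_le_left.trans W.2)]
  · refine Subtype.ext (funext fun W => AlternatingMap.ext fun v => ?_)
    change γ.1 W v = g W v
    refine huniq W _ _ fun j => ?_
    rw [hg, γ.2 W ⟨W.1 ⊓ N j, inf_le_left.trans W.2⟩ inf_le_left v, ← hγ j]
    rfl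

end HolomorphicLieAlgebroid

end

section
open Set CategoryTheory


/-- Sheaves of complex vector spaces on `X`. -/
abbrev VectSheaf (X : Type u) [TopologicalSpace X] : Type _ :=
  Sheaf (Opens.grothendieckTopology X) (ModuleCat.{u} ℂ)

variable {X : Type u} [TopologicalSpace X]

instance : Limits.PreservesFilteredColimitsOfSize.{u, u} (forget (ModuleCat.{u} ℂ)) :=
  let e := (ModuleCat.restrictScalarsEquivalenceOfRingEquiv.{u}
    (ULift.ringEquiv.{0, u} (R := ℂ))).functor
  let i : forget (ModuleCat.{u} ℂ) ≅ e ⋙ forget (ModuleCat.{u} (ULift.{u} ℂ)) := Iso.refl _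
  have : Limits.PreservesFilteredColimitsOfSize.{u, u} (forget (ModuleCat.{u} (ULift.{u} ℂ))) :=
    ModuleCat.FilteredColimits.forget_preservesFilteredColimits
  ⟨fun _ _ _ => Limits.preservesColimitsOfShape_of_natIso i.symm⟩

/-- The constant sheaf `ℂ`. -/
noncomputable def constSheaf (X : Type u) [TopologicalSpace X] : VectSheaf X :=
  (constantSheaf (Opens.grothendieckTopology X) (ModuleCat.{u} ℂ)).obj (ModuleCat.of ℂ (ULift.{u} ℂ))

noncomputable instance : HasExt.{u + 1} (VectSheaf X) := HasExt.standard _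
/-- Sheaf cohomology `Hᵏ(X, G) = Extᵏ(ℂ_X, G)`. -/
abbrev Cohomology (G : VectSheaf X) (k : ℕ) : Type _ := Abelian.Ext (constSheaf X) G k

noncomputable instance : HasDerivedCategory (VectSheaf X) := HasDerivedCategory.standard _

/-- Hypercohomology `ℍᵏ(X, K) = Hom(ℂ_X, K[k])` in the derived category. -/
abbrev Hypercohomology (K : CochainComplex (VectSheaf X) ℕ) (k : ℕ) : Type _ :=
  ShiftedHom ((DerivedCategory.singleFunctor (VectSheaf X) 0).obj (constSheaf X))
    (DerivedCategory.Q.obj (K.extend ComplexShape.embeddingUpNat)) (k : ℤ)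

theorem isSheaf_of_glue (P : (Opens X)ᵒᵖ ⥤ ModuleCat.{u} ℂ)
    (h : ∀ (U : Opens X) (ι : Type u) (N : ι → Opens X) (hN : ∀ i, N i ≤ U), (∀ x ∈ U, ∃ i, x ∈ N i) →
      ∀ s : ∀ i, P.obj (.op (N i)),
      (∀ i j, P.map (homOfLE (inf_le_left : N i ⊓ N j ≤ N i)).op (s i) =
        P.map (homOfLE (inf_le_right : N i ⊓ N j ≤ N j)).op (s j)) →
      ∃! t : P.obj (.op U), ∀ i, P.map (homOfLE (hN i)).op t = s i) :
    Presheaf.IsSheaf (Opens.grothendieckTopology X) P := by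
  refine (TopCat.Presheaf.isSheaf_iff_isSheafUniqueGluing (X := TopCat.of X) P).2 ?_
  intro ι N s hs
  exact h (iSup N) ι N (le_iSup N) (fun x hx => Opens.mem_iSup.1 hx) s hs

variable {E : Type u} [NormedAddCommGroup E] [NormedSpace ℂ E]
  [ChartedSpace E X] [IsManifold 𝓘(ℂ, E) ω X]
variable [FiniteDimensional ℂ E] {F : Type*} [NormedAddCommGroup F] [NormedSpace ℂ F] {V : X → Type*}
  [∀ x, AddCommGroup (V x)] [∀ x, Module ℂ (V x)] [∀ x, TopologicalSpace (V x)]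
  [TopologicalSpace (TotalSpace F V)] [FiberBundle F V] [VectorBundle ℂ F V]

namespace HolomorphicLieAlgebroid
variable (A : HolomorphicLieAlgebroid E F V)

noncomputable instance (k : ℕ) (U : Opens X) : AddCommGroup (A.form k U) :=
  Module.addCommMonoidToAddCommGroup ℂ

/-- The sheaf `Λᵏ𝒟*`. -/
noncomputable def formSheaf (k : ℕ) : VectSheaf X where
  obj :=
    { obj := fun U => ModuleCat.of ℂ (A.form k U.unop)
      map := fun i => ModuleCat.ofHom (A.resForm k i.unop.le)
      map_id := fun _ => rfl
      map_comp := fun _ _ => rfl }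
  property := isSheaf_of_glue _ fun _ _ N hN hc s hs => A.form_glue k N hN hc s hs

/-- The differential as a morphism of sheaves. -/
noncomputable def dSheaf (k : ℕ) : A.formSheaf k ⟶ A.formSheaf (k + 1) where
  hom :=
    { app := fun U => ModuleCat.ofHom (A.dForm k U.unop)
      naturality := fun _ _ _ => rfl }

/-- The complex `(Λ^•𝒟*, ∂_𝒟)`. -/
noncomputable def formComplex : CochainComplex (VectSheaf X) ℕ :=
  CochainComplex.of A.formSheaf A.dSheaf fun k => by
    ext U α
    exact A.dForm_dForm k U.unop α

end HolomorphicLieAlgebroid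

variable (X E) in
/-- A (regular) holomorphic foliation of the complex manifold `X` with leaves of dimension `m` and
codimension `q`, given by a foliated atlas: the changes of charts locally have the form
`(x, y) ↦ (g(x, y), h(y))`. -/
structure HolomorphicFoliation where
  m : ℕ
  q : ℕ
  atlas : Set (OpenPartialHomeomorph X ((Fin m → ℂ) × (Fin q → ℂ)))
  holomorphic : ∀ φ ∈ atlas, ContMDiffOn 𝓘(ℂ, E) 𝓘(ℂ, (Fin m → ℂ) × (Fin q → ℂ)) ω φ φ.source
  holomorphic_symm : ∀ φ ∈ atlas,
    ContMDiffOn 𝓘(ℂ, (Fin m → ℂ) × (Fin q → ℂ)) 𝓘(ℂ, E) ω φ.symm φ.target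
  cover : ∀ x : X, ∃ φ ∈ atlas, x ∈ φ.source
  compatible : ∀ φ ∈ atlas, ∀ ψ ∈ atlas, ∀ p ∈ φ.source ∩ ψ.source, ∃ N ∈ 𝓝 p,
    ∀ x ∈ N, ∀ y ∈ N, (φ x).2 = (φ y).2 → (ψ x).2 = (ψ y).2

namespace HolomorphicFoliation
variable (ℱ : HolomorphicFoliation X E)

/-- The leaf topology of `X`, generated by the open subsets of the plaques. -/
@[reducible]
def leafTopology : TopologicalSpace X :=
  TopologicalSpace.generateFrom {P | ∃ φ ∈ ℱ.atlas, ∃ W : Set ((Fin ℱ.m → ℂ) × (Fin ℱ.q → ℂ)),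
    IsOpen W ∧ ∃ c : Fin ℱ.q → ℂ, P = {x | x ∈ φ.source ∧ φ x ∈ W ∧ (φ x).2 = c}}

/-- The leaf through `x`. -/
def leaf (x : X) : Set X := @connectedComponent X ℱ.leafTopology x

theorem mem_nhds_leaf {N : Set X} {x : X} (h : N ∈ 𝓝 x) : N ∈ @nhds X ℱ.leafTopology x := by
  obtain ⟨W, hWN, hW, hx⟩ := mem_nhds_iff.1 h
  obtain ⟨φ, hφ, hxφ⟩ := ℱ.cover x
  refine Filter.mem_of_superset (@IsOpen.mem_nhds X ℱ.leafTopology x _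
    (TopologicalSpace.isOpen_generateFrom_of_mem
    ⟨φ, hφ, φ.target ∩ φ.symm ⁻¹' W, φ.isOpen_inter_preimage_symm hW, (φ x).2, rfl⟩)
    ⟨hxφ, ⟨φ.map_source hxφ, ?_⟩, rfl⟩) ?_
  · simpa only [mem_preimage, φ.left_inv hxφ] using hx
  · rintro y ⟨hy, ⟨_, hyW⟩, _⟩
    rw [mem_preimage, φ.left_inv hy] at hyW
    exact hWN hyW

/-- `f` is locally constant along the leaves: every `x` has a neighbourhood in the leaf through `x`
on which `f` is constant. -/
def IsLeafwiseLocallyConstant {U : Opens X} (f : U → ℂ) : Prop :=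
  ∀ x : U, ∃ N ∈ @nhds X ℱ.leafTopology (x : X), ∀ y : U, (y : X) ∈ N → (y : X) ∈ ℱ.leaf x → f y = f x

/-- The holomorphic functions on `U` that are locally constant along the leaves. -/
def leafFun (U : Opens X) : Submodule ℂ (holFun E U) where
  carrier := {f | ℱ.IsLeafwiseLocallyConstant f.1}
  add_mem' {f g} hf hg x := by
    obtain ⟨N, hN, h⟩ := hf x
    obtain ⟨N', hN', h'⟩ := hg x
    refine ⟨N ∩ N', Filter.inter_mem hN hN', fun y hy hl => ?_⟩
    exact congrArg₂ (· + ·) (h y hy.1 hl) (h' y hy.2 hl)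
  zero_mem' x := ⟨univ, Filter.univ_mem, fun _ _ _ => rfl⟩
  smul_mem' c f hf x := by
    obtain ⟨N, hN, h⟩ := hf x
    exact ⟨N, hN, fun y hy hl => congrArg (c • ·) (h y hy hl)⟩

/-- Restriction in `𝒪_ℱ`. -/
def resLeafFun {U W : Opens X} (h : W ≤ U) : ℱ.leafFun U →ₗ[ℂ] ℱ.leafFun W where
  toFun f := ⟨resFun h f.1, fun x => by
    obtain ⟨N, hN, hf⟩ := f.2 ⟨x, h x.2⟩
    exact ⟨N, hN, fun y hy hl => hf ⟨y, h y.2⟩ hy hl⟩⟩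
  map_add' _ _ := rfl
  map_smul' _ _ := rfl

theorem leafFun_glue {U : Opens X} {ι : Type*} (N : ι → Opens X) (hN : ∀ i, N i ≤ U)
    (hc : ∀ x ∈ U, ∃ i, x ∈ N i) (f : ∀ i, ℱ.leafFun (N i))
    (hf : ∀ i j, ℱ.resLeafFun (inf_le_left : N i ⊓ N j ≤ N i) (f i) =
      ℱ.resLeafFun (inf_le_right : N i ⊓ N j ≤ N j) (f j)) :
    ∃! g : ℱ.leafFun U, ∀ i, ℱ.resLeafFun (hN i) g = f i := by
  obtain ⟨g, hg⟩ := exists_glue N hN hc (fun i => (f i).1) (fun i j => congrArg Subtype.val (hf i j))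
  refine ⟨⟨g, fun x => ?_⟩, fun i => Subtype.ext (hg i), fun g' hg' => ?_⟩
  · obtain ⟨i, hi⟩ := hc x x.2
    obtain ⟨M, hM, h⟩ := (f i).2 ⟨x, hi⟩
    refine ⟨M ∩ N i, Filter.inter_mem hM (ℱ.mem_nhds_leaf ((N i).isOpen.mem_nhds hi)), fun y hy hl => ?_⟩
    have h1 := h ⟨y, hy.2⟩ hy.1 hl
    rw [← hg i] at h1
    exact h1
  · refine Subtype.ext (holFun_ext_local fun x => ?_)
    obtain ⟨i, hi⟩ := hc x x.2
    exact ⟨N i, hN i, hi, (congrArg Subtype.val (hg' i)).trans (hg i).symm⟩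

/-- The sheaf `𝒪_ℱ` of holomorphic functions that are locally constant along the leaves. -/
noncomputable def leafSheaf : VectSheaf X where
  obj :=
    { obj := fun U => ModuleCat.of ℂ (ℱ.leafFun U.unop)
      map := fun i => ModuleCat.ofHom (ℱ.resLeafFun i.unop.le)
      map_id := fun _ => rfl
      map_comp := fun _ _ => rfl }
  property := isSheaf_of_glue _ fun _ _ N hN hc s hs => ℱ.leafFun_glue N hN hc s hs

/-- The tangent spaces of the leaves are the images of the anchor. -/
def IsTangentTo (A : HolomorphicLieAlgebroid E F V) : Prop :=
  ∀ φ ∈ ℱ.atlas, ∀ x ∈ φ.source, LinearMap.range (A.anchor x) =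
    (mfderiv 𝓘(ℂ, E) 𝓘(ℂ, Fin ℱ.q → ℂ) (fun y => (φ y).2) x).ker

end HolomorphicFoliation

end

end HolGeom

set_option linter.unusedSectionVars false

section Nemytskii
variable {𝕜 K E G : Type*} [NontriviallyNormedField 𝕜] [TopologicalSpace K] [CompactSpace K]
  [NormedAddCommGroup E] [NormedSpace 𝕜 E] [NormedAddCommGroup G] [NormedSpace 𝕜 G]

/-- The pointwise application of a continuous multilinear map to continuous functions. -/
noncomputable def ContinuousMultilinearMap.pointwise (K : Type*) [TopologicalSpace K] [CompactSpace K]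
    {ι : Type*} [Fintype ι] (p : ContinuousMultilinearMap 𝕜 (fun _ : ι => E) G) :
    ContinuousMultilinearMap 𝕜 (fun _ : ι => C(K, E)) C(K, G) :=
  MultilinearMap.mkContinuous
    { toFun := fun γ => ⟨fun t => p fun i => γ i t,
        p.cont.comp (continuous_pi fun i => (γ i).continuous)⟩
      map_update_add' := by
        intro _ γ i x y
        ext t
        have h (z : C(K, E)) : (fun j => Function.update γ i z j t) =
            Function.update (fun j => γ j t) i (z t) := by
          funext j
          by_cases hj : j = i
          · subst hj; simp
          · simp [hj]
        simp only [ContinuousMap.coe_mk, ContinuousMap.add_apply, h, p.map_update_add]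
      map_update_smul' := by
        intro _ γ i c x
        ext t
        have h (z : C(K, E)) : (fun j => Function.update γ i z j t) =
            Function.update (fun j => γ j t) i (z t) := by
          funext j
          by_cases hj : j = i
          · subst hj; simp
          · simp [hj]
        simp only [ContinuousMap.coe_mk, ContinuousMap.smul_apply, h, p.map_update_smul] } ‖p‖
    fun γ => by
      refine (ContinuousMap.norm_le _ (by positivity)).2 fun t => ?_
      refine (p.le_opNorm _).trans ?_
      gcongr with i
      exact (γ i).norm_coe_le_norm t

theorem ContinuousMultilinearMap.norm_pointwise_le {ι : Type*} [Fintype ι]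
    (p : ContinuousMultilinearMap 𝕜 (fun _ : ι => E) G) : ‖p.pointwise K‖ ≤ ‖p‖ :=
  MultilinearMap.mkContinuous_norm_le _ (norm_nonneg p) _

/-- The superposition operator of an analytic function is analytic. -/
theorem HasFPowerSeriesOnBall.exists_superposition [CompleteSpace G] (K : Type*)
    [TopologicalSpace K] [CompactSpace K] {f : E → G} {p : FormalMultilinearSeries 𝕜 E G}
    {r : ENNReal} (hf : HasFPowerSeriesOnBall f p 0 r) :
    ∃ (N : C(K, E) → C(K, G)) (P : FormalMultilinearSeries 𝕜 C(K, E) C(K, G)),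
      HasFPowerSeriesOnBall N P 0 r ∧ ∀ γ ∈ Metric.eball 0 r, ∀ t, N γ t = f (γ t) := by
  let P : FormalMultilinearSeries 𝕜 C(K, E) C(K, G) := fun n => (p n).pointwise K
  have hP : p.radius ≤ P.radius :=
    FormalMultilinearSeries.radius_le_of_le fun n => (p n).norm_pointwise_le
  have hr : r ≤ P.radius := hf.r_le.trans hP
  have hN := (P.hasFPowerSeriesOnBall (hf.r_pos.trans_le hr)).mono hf.r_pos hr
  refine ⟨P.sum, P, hN, fun γ hγ t => ?_⟩
  have h1 := hN.hasSum hγ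
  have hγt : γ t ∈ Metric.eball (0 : E) r := by
    rw [Metric.mem_eball, edist_zero_right] at hγ ⊢
    refine lt_of_le_of_lt ?_ hγ
    exact enorm_le_iff_norm_le.2 (γ.norm_coe_le_norm t)
  have h2 := hf.hasSum hγt
  rw [zero_add] at h1 h2
  have h3 := h1.map (ContinuousMap.evalCLM 𝕜 t) (ContinuousMap.evalCLM 𝕜 t).continuous
  exact h3.unique h2

end Nemytskii

section Volterra
open MeasureTheory intervalIntegral unitInterval
variable {Q : Type*} [NormedAddCommGroup Q] [NormedSpace ℂ Q] [CompleteSpace Q]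

/-- The Volterra operator `γ ↦ (s ↦ ∫₀ˢ γ)` on continuous paths. -/
noncomputable def volterra (Q : Type*) [NormedAddCommGroup Q] [NormedSpace ℂ Q] [CompleteSpace Q] :
    C(I, Q) →L[ℂ] C(I, Q) :=
  LinearMap.mkContinuous
    { toFun := fun γ => ⟨fun s => ∫ τ in (0 : ℝ)..s, Set.IccExtend zero_le_one γ τ,
        (continuous_primitive (fun a b => (γ.continuous.Icc_extend' (h := zero_le_one)).intervalIntegrable a b)
          0).comp continuous_subtype_val⟩
      map_add' := fun γ γ' => by
        ext s
        exact integral_add ((γ.continuous.Icc_extend' (h := zero_le_one)).intervalIntegrable _ _)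
          ((γ'.continuous.Icc_extend' (h := zero_le_one)).intervalIntegrable _ _)
      map_smul' := fun c γ => by
        ext s
        exact integral_smul c (Set.IccExtend (zero_le_one (α := ℝ)) γ) } 1
    fun γ => by
      rw [one_mul]
      refine (ContinuousMap.norm_le _ (norm_nonneg _)).2 fun s => ?_
      refine (norm_integral_le_of_norm_le_const (C := ‖γ‖) fun τ _ => γ.norm_coe_le_norm _).trans ?_
      rw [sub_zero, abs_of_nonneg s.2.1]
      exact mul_le_of_le_one_right (norm_nonneg _) s.2.2

theorem volterra_eq_integral (γ : C(I, Q)) (s : I) (g : ℝ → Q) (hg : ∀ τ : I, γ τ = g τ) :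
    volterra Q γ s = ∫ τ in (0 : ℝ)..s, g τ := by
  refine integral_congr fun τ hτ => ?_
  rw [Set.uIcc_of_le s.2.1] at hτ
  have hτ' : τ ∈ Set.Icc (0 : ℝ) 1 := ⟨hτ.1, hτ.2.trans s.2.2⟩
  change Set.IccExtend zero_le_one γ τ = g τ
  rw [Set.IccExtend_of_mem _ _ hτ', hg]

end Volterra

section Radial
open MeasureTheory intervalIntegral unitInterval Filter
variable {P Q : Type*} [NormedAddCommGroup P] [NormedSpace ℂ P]
  [NormedAddCommGroup Q] [NormedSpace ℂ Q]

/-- The map `((x, y), γ) ↦ (s ↦ ((s x, γ s), x))`. -/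
noncomputable def radialLift (P Q : Type*) [NormedAddCommGroup P] [NormedSpace ℂ P]
    [NormedAddCommGroup Q] [NormedSpace ℂ Q] :
    ((P × Q) × C(I, Q)) →L[ℂ] C(I, (P × Q) × P) :=
  LinearMap.mkContinuous
    { toFun := fun v => ⟨fun s => (((s : ℝ) • v.1.1, v.2 s), v.1.1), by fun_prop⟩
      map_add' := fun v w => by ext s <;> simp
      map_smul' := fun c v => by ext s <;> simp [smul_comm c] } 1
    fun v => by
      rw [one_mul]
      refine (ContinuousMap.norm_le _ (norm_nonneg _)).2 fun s => ?_
      have h1 : ‖v.1.1‖ ≤ ‖v‖ := (norm_fst_le v.1).trans (norm_fst_le v)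
      have h2 : ‖v.2 s‖ ≤ ‖v‖ := (v.2.norm_coe_le_norm s).trans (norm_snd_le v)
      have h3 : ‖(s : ℝ) • v.1.1‖ ≤ ‖v‖ := by
        rw [norm_smul, Real.norm_of_nonneg s.2.1]
        exact (mul_le_of_le_one_left (norm_nonneg _) s.2.2).trans h1
      exact max_le (max_le h3 h2) h1

theorem radialLift_apply (v : (P × Q) × C(I, Q)) (s : I) :
    radialLift P Q v s = (((s : ℝ) • v.1.1, v.2 s), v.1.1) := rfl

theorem norm_radialLift_le (v : (P × Q) × C(I, Q)) : ‖radialLift P Q v‖ ≤ ‖v‖ := by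
  have := (radialLift P Q).le_of_opNorm_le (LinearMap.mkContinuous_norm_le _ zero_le_one _) v
  rwa [one_mul] at this

theorem norm_smul_fst_le {s : ℝ} (h0 : 0 ≤ s) (h1 : s ≤ 1) (z : P × Q) : ‖(s • z.1, z.2)‖ ≤ ‖z‖ := by
  refine max_le ?_ (norm_snd_le z)
  rw [norm_smul, Real.norm_of_nonneg h0]
  exact (mul_le_of_le_one_left (norm_nonneg _) h1).trans (norm_fst_le z)

theorem hasDerivAt_comp_smul_fst {G : Type*} [NormedAddCommGroup G] [NormedSpace ℂ G] {f : P × Q → G}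
    {x : P} {y : Q} {s : ℝ} (hf : DifferentiableAt ℂ f (s • x, y)) :
    HasDerivAt (fun t : ℝ => f (t • x, y)) (fderiv ℂ f (s • x, y) (x, 0)) s := by
  have h1 : HasDerivAt (fun t : ℝ => (t • x, y)) (x, (0 : Q)) s := by
    simpa using ((hasDerivAt_id s).smul_const x).prodMk (hasDerivAt_const s y)
  exact (hf.hasFDerivAt.restrictScalars ℝ).comp_hasDerivAt s h1

variable [CompleteSpace P] [CompleteSpace Q]

/-- The integral equation satisfied along rays. -/
theorem exists_radial_integral {B : P × Q → P →L[ℂ] Q} (hB : ContDiffAt ℂ ω B 0) :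
    ∃ Γ : P × Q → C(I, Q), ContDiffAt ℂ ω Γ 0 ∧ ∃ δ > 0, ∀ z ∈ Metric.ball (0 : P × Q) δ, ∀ s : I,
      Γ ((s : ℝ) • z.1, z.2) 1 = Γ z s ∧
      Γ z s = z.2 + ∫ τ in (0 : ℝ)..s, B (τ • z.1, Set.IccExtend zero_le_one (Γ z) τ) z.1 := by
  let F : (P × Q) × P → Q := fun w => B w.1 w.2
  have hF : ContDiffAt ℂ ω F 0 :=
    ContDiffAt.clm_apply (ContDiffAt.comp (0 : (P × Q) × P) hB contDiffAt_fst) contDiffAt_snd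
  obtain ⟨p, r, hp⟩ := hF.analyticAt
  obtain ⟨N, R, hN, hNF⟩ := hp.exists_superposition I
  let Ψ : (P × Q) × C(I, Q) → C(I, Q) := fun v =>
    v.2 - ContinuousLinearMap.const ℂ I v.1.2 - volterra Q (N (radialLift P Q v))
  have hΨa : ContDiffAt ℂ ω Ψ 0 := by
    have h1 : ContDiffAt ℂ ω N (radialLift P Q 0) := by
      rw [map_zero]; exact hN.analyticAt.contDiffAt
    have h2 := (volterra Q).contDiff.contDiffAt.comp (0 : (P × Q) × C(I, Q))
      (h1.comp (0 : (P × Q) × C(I, Q)) (radialLift P Q).contDiff.contDiffAt)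
    have h3 : ContDiffAt ℂ ω (fun v : (P × Q) × C(I, Q) =>
        v.2 - ContinuousLinearMap.const ℂ I v.1.2) 0 := by fun_prop
    exact h3.sub h2
  have hr : ∀ᶠ v : (P × Q) × C(I, Q) in 𝓝 0, v ∈ Metric.eball 0 r := Metric.eball_mem_nhds _ hp.r_pos
  have hval : ∀ v ∈ Metric.eball (0 : (P × Q) × C(I, Q)) r, ∀ s : I,
      Ψ v s = v.2 s - v.1.2 -
        ∫ τ in (0 : ℝ)..s, B (τ • v.1.1, Set.IccExtend zero_le_one v.2 τ) v.1.1 := by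
    intro v hv s
    have h1 : radialLift P Q v ∈ Metric.eball 0 r := by
      rw [Metric.mem_eball, edist_zero_right] at hv ⊢
      exact lt_of_le_of_lt (enorm_le_iff_norm_le.2 (norm_radialLift_le v)) hv
    have h2 := volterra_eq_integral (N (radialLift P Q v)) s
      (fun τ => B (τ • v.1.1, Set.IccExtend zero_le_one v.2 τ) v.1.1) fun τ => by
        rw [hNF _ h1, radialLift_apply, Set.IccExtend_val]
    rw [← h2]
    rfl
  have hfd : fderiv ℂ Ψ 0 ∘L .inr ℂ (P × Q) C(I, Q) = ContinuousLinearMap.id ℂ C(I, Q) := by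
    have h1 : HasFDerivAt (fun γ => Ψ (0, γ)) (fderiv ℂ Ψ 0 ∘L .inr ℂ (P × Q) C(I, Q)) 0 :=
      HasFDerivAt.comp (g := Ψ) (0 : C(I, Q)) (hΨa.differentiableAt (by simp)).hasFDerivAt
        (ContinuousLinearMap.inr ℂ (P × Q) C(I, Q)).hasFDerivAt
    refine h1.unique ((hasFDerivAt_id (0 : C(I, Q))).congr_of_eventuallyEq ?_)
    have hc : Tendsto (fun γ : C(I, Q) => ((0 : P × Q), γ)) (𝓝 0) (𝓝 0) := by
      have : Continuous (fun γ : C(I, Q) => ((0 : P × Q), γ)) := by fun_prop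
      exact this.tendsto 0
    filter_upwards [hc.eventually hr] with γ hγ
    ext s
    rw [hval _ hγ]
    simp
  have hinv : (fderiv ℂ Ψ ((0 : P × Q), (0 : C(I, Q))) ∘L .inr ℂ (P × Q) C(I, Q)).IsInvertible := by
    change (fderiv ℂ Ψ 0 ∘L .inr ℂ (P × Q) C(I, Q)).IsInvertible
    rw [hfd]
    exact ⟨ContinuousLinearEquiv.refl ℂ _, rfl⟩
  have hΨa' : ContDiffAt ℂ ω Ψ ((0 : P × Q), (0 : C(I, Q))) := hΨa
  let Γ := hΨa'.implicitFunction (by simp) hinv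
  have hΓ : ContDiffAt ℂ ω Γ 0 := hΨa'.contDiffAt_implicitFunction (by simp) hinv
  have hΓ0 : Γ 0 = 0 := hΨa'.implicitFunction_apply_self (by simp) hinv
  have hΨ0 : Ψ ((0 : P × Q), (0 : C(I, Q))) = 0 := by
    have h0 : (0 : (P × Q) × C(I, Q)) ∈ Metric.eball 0 r := Metric.mem_eball_self hp.r_pos
    ext s
    have := hval 0 h0 s
    rw [show ((0 : P × Q), (0 : C(I, Q))) = 0 from rfl, this]
    simp
  have hiff : ∀ᶠ v in 𝓝 (0 : (P × Q) × C(I, Q)), Ψ v = 0 ↔ Γ v.1 = v.2 := by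
    have := hΨa'.eventually_apply_eq_iff_implicitFunction (by simp) hinv
    rw [hΨ0] at this
    exact this
  obtain ⟨ε, hε, hεb⟩ := Metric.eventually_nhds_iff_ball.1 (hiff.and hr)
  have hΓs : ∀ᶠ z in 𝓝 (0 : P × Q), ‖Γ z‖ < ε := by
    have := hΓ.continuousAt.norm.eventually_lt_const (u := ε) (by simpa [hΓ0])
    exact this
  obtain ⟨δ, hδ, hδb⟩ := Metric.eventually_nhds_iff_ball.1 hΓs
  refine ⟨Γ, hΓ, min δ ε, lt_min hδ hε, fun z hz s => ?_⟩
  rw [mem_ball_zero_iff, lt_min_iff] at hz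
  have hzΓ := hδb z (mem_ball_zero_iff.2 hz.1)
  have hmem {z' : P × Q} {γ : C(I, Q)} (h : ‖z'‖ ≤ ‖z‖) (h' : ‖γ‖ ≤ ‖Γ z‖) :
      (z', γ) ∈ Metric.ball (0 : (P × Q) × C(I, Q)) ε :=
    mem_ball_zero_iff.2 (max_lt (h.trans_lt hz.2) (h'.trans_lt hzΓ))
  have heq (s : I) : Γ z s = z.2 + ∫ τ in (0 : ℝ)..s,
      B (τ • z.1, Set.IccExtend zero_le_one (Γ z) τ) z.1 := by
    obtain ⟨h1, h2⟩ := hεb _ (hmem (le_refl ‖z‖) (le_refl ‖Γ z‖))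
    have h3 := hval _ h2 s
    rw [h1.2 rfl, ContinuousMap.zero_apply] at h3
    rw [← sub_eq_zero, ← sub_sub]
    exact h3.symm
  refine ⟨?_, heq s⟩
  let γ : C(I, Q) := ⟨fun τ => Γ z (s * τ), by fun_prop⟩
  have hγ : ‖γ‖ ≤ ‖Γ z‖ :=
    (ContinuousMap.norm_le _ (norm_nonneg _)).2 fun τ => (Γ z).norm_coe_le_norm _
  obtain ⟨h1, h2⟩ := hεb _ (hmem (norm_smul_fst_le s.2.1 s.2.2 z) hγ)
  have h3 : Ψ (((s : ℝ) • z.1, z.2), γ) = 0 := by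
    ext τ
    rw [hval _ h2, ContinuousMap.zero_apply, sub_sub, sub_eq_zero]
    change Γ z (s * τ) = _
    rw [heq, Set.Icc.coe_mul]
    congr 1
    have h4 := smul_integral_comp_mul_left (a := 0) (b := τ)
      (fun t => B (t • z.1, Set.IccExtend zero_le_one (Γ z) t) z.1) (s : ℝ)
    rw [mul_zero] at h4
    rw [← h4, ← intervalIntegral.integral_smul]
    refine integral_congr fun t ht => ?_
    rw [Set.uIcc_of_le τ.2.1] at ht
    have ht' : t ∈ I := ⟨ht.1, ht.2.trans τ.2.2⟩
    simp only []
    rw [Set.IccExtend_of_mem _ _ ht', Set.IccExtend_of_mem _ _ (mul_mem s.2 ht'), ContinuousLinearMap.map_smul_of_tower,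
      smul_smul t, mul_comm t]
    rfl
  have h5 := DFunLike.congr_fun (h1.1 h3) 1
  rw [h5]
  change Γ z (s * 1) = Γ z s
  rw [mul_one]

/-- Solution of `∂ₓu(x, y) x = B(x, u(x, y)) x` with `u(0, y) = y`. -/
theorem exists_radial_solution {B : P × Q → P →L[ℂ] Q} (hB : ContDiffAt ℂ ω B 0) :
    ∃ u : P × Q → Q, ContDiffAt ℂ ω u 0 ∧ (∀ᶠ z in 𝓝 (0 : P × Q), z.1 = 0 → u z = z.2) ∧
      ∀ᶠ z in 𝓝 (0 : P × Q), fderiv ℂ u z (z.1, 0) = B (z.1, u z) z.1 := by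
  obtain ⟨Γ, hΓ, δ, hδ, h⟩ := exists_radial_integral hB
  let u : P × Q → Q := fun z => Γ z 1
  have hu : ContDiffAt ℂ ω u 0 :=
    (ContinuousMap.evalCLM (M := Q) ℂ (1 : I)).contDiff.contDiffAt.comp (0 : P × Q) hΓ
  have hball : ∀ᶠ z in 𝓝 (0 : P × Q), z ∈ Metric.ball (0 : P × Q) δ := Metric.ball_mem_nhds _ hδ
  have hu0 : ∀ z ∈ Metric.ball (0 : P × Q) δ, z.1 = 0 → u z = z.2 := by
    intro z hz hz0
    have := (h z hz 1).2
    simp only [hz0, map_zero, intervalIntegral.integral_zero, add_zero] at this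
    exact this
  refine ⟨u, hu, hball.mono hu0, ?_⟩
  have hG : ContDiffAt ℂ ω (fun z : P × Q => (z.1, u z)) 0 := contDiffAt_fst.prodMk hu
  have hG0 : ((0 : P × Q).1, u 0) = 0 := by
    rw [hu0 0 (Metric.mem_ball_self hδ) rfl]
  have hBc : ∀ᶠ w in 𝓝 (0 : P × Q), ContinuousAt B w :=
    (hB.eventually (by simp)).mono fun w hw => hw.continuousAt
  rw [← hG0] at hBc
  have hBG := hG.continuousAt.eventually hBc
  have hud := hu.eventually (by simp)
  obtain ⟨ε, hε, hεb⟩ := Metric.eventually_nhds_iff_ball.1 (hball.and (hBG.and hud))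
  filter_upwards [Metric.ball_mem_nhds (0 : P × Q) hε] with z hz
  have hz1 := (hεb z hz).1
  have hsz (s : I) : ((s : ℝ) • z.1, z.2) ∈ Metric.ball (0 : P × Q) ε :=
    mem_ball_zero_iff.2 ((norm_smul_fst_le s.2.1 s.2.2 z).trans_lt (mem_ball_zero_iff.1 hz))
  have hus (s : I) : u ((s : ℝ) • z.1, z.2) = Γ z s := (h z hz1 s).1
  have hcont : ContinuousOn (fun τ : ℝ => B (τ • z.1, Set.IccExtend zero_le_one (Γ z) τ) z.1)
      (Set.Icc 0 1) := by
    intro τ hτ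
    have h1 : ContinuousAt B (τ • z.1, Set.IccExtend zero_le_one (Γ z) τ) := by
      rw [Set.IccExtend_of_mem _ _ hτ]
      have h2 := (hεb _ (hsz ⟨τ, hτ⟩)).2.1
      have h3 := hus ⟨τ, hτ⟩
      simp only at h2 h3
      rwa [h3] at h2
    have h4 : ContinuousAt (fun τ : ℝ => (τ • z.1, Set.IccExtend zero_le_one (Γ z) τ)) τ :=
      Continuous.continuousAt ((continuous_id.smul continuous_const).prodMk
        ((Γ z).continuous.Icc_extend' (h := zero_le_one)))
    exact ((ContinuousAt.comp (f := fun τ : ℝ => (τ • z.1, Set.IccExtend zero_le_one (Γ z) τ)) h1 h4).clm_apply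
      continuousAt_const).continuousWithinAt
  have hd1 : HasDerivWithinAt (fun t : ℝ => u (t • z.1, z.2)) (fderiv ℂ u z (z.1, 0)) (Set.Icc 0 1) 1 := by
    have := hasDerivAt_comp_smul_fst (f := u) (x := z.1) (y := z.2) (s := 1)
      (by rw [one_smul]; exact (hεb z hz).2.2.differentiableAt (by simp))
    rw [one_smul] at this
    exact this.hasDerivWithinAt
  have hd2 : HasDerivWithinAt (fun t : ℝ => u (t • z.1, z.2)) (B (z.1, u z) z.1) (Set.Icc 0 1) 1 := by
    have h1 : HasDerivWithinAt (fun t : ℝ => ∫ τ in (0 : ℝ)..t,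
        B (τ • z.1, Set.IccExtend zero_le_one (Γ z) τ) z.1)
        (B ((1 : ℝ) • z.1, Set.IccExtend zero_le_one (Γ z) 1) z.1) (Set.Icc 0 1) 1 := by
      have : Fact ((1 : ℝ) ∈ Set.Icc (0 : ℝ) 1) := ⟨by simp⟩
      refine integral_hasDerivWithinAt_right (t := Set.Icc 0 1) ?_ ?_ (hcont 1 (by simp))
      · exact hcont.intervalIntegrable_of_Icc zero_le_one
      · exact hcont.stronglyMeasurableAtFilter_nhdsWithin measurableSet_Icc _
    rw [one_smul, Set.IccExtend_of_mem _ _ (by simp : (1 : ℝ) ∈ Set.Icc (0 : ℝ) 1)] at h1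
    refine (h1.const_add z.2).congr_of_mem (fun t ht => ?_) (by simp)
    exact (hus ⟨t, ht⟩).trans (h z hz1 ⟨t, ht⟩).2
  exact (uniqueDiffOn_Icc (zero_lt_one' ℝ) 1 (by simp)).eq_deriv _ hd1 hd2

end Radial

section Frobenius
open Filter
variable {P Q : Type*} [NormedAddCommGroup P] [NormedSpace ℂ P] [CompleteSpace P]
  [NormedAddCommGroup Q] [NormedSpace ℂ Q] [CompleteSpace Q]

set_option synthInstance.maxHeartbeats 200000 in
/-- The analytic Frobenius theorem, for the total differential equation `∂ₓu(x, y) = B(x, u(x, y))`. -/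
theorem exists_solution_of_integrable {B : P × Q → P →L[ℂ] Q} (hB : ContDiffAt ℂ ω B 0)
    (hint : ∀ᶠ w in 𝓝 (0 : P × Q), ∀ ξ η : P,
      fderiv ℂ B w (ξ, B w ξ) η = fderiv ℂ B w (η, B w η) ξ) :
    ∃ u : P × Q → Q, ContDiffAt ℂ ω u 0 ∧ (∀ᶠ z in 𝓝 (0 : P × Q), z.1 = 0 → u z = z.2) ∧
      ∀ᶠ z in 𝓝 (0 : P × Q), ∀ h, fderiv ℂ u z (h, 0) = B (z.1, u z) h := by
  obtain ⟨u, hu, hu0, hrad⟩ := exists_radial_solution hB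
  refine ⟨u, hu, hu0, ?_⟩
  let G : P × Q → P × Q := fun z => (z.1, u z)
  have hG : ContDiffAt ℂ ω G 0 := contDiffAt_fst.prodMk hu
  have hG0 : G 0 = 0 := by
    change ((0 : P), u 0) = 0
    rw [hu0.self_of_nhds rfl]; rfl
  have hGt : Tendsto G (𝓝 0) (𝓝 0) := by
    have := hG.continuousAt.tendsto
    rwa [hG0] at this
  have hω : (ω : WithTop ℕ∞) ≠ 0 := by simp
  -- The defect of the equation; it satisfies a linear radial equation.
  let e : P × Q → P →L[ℂ] Q := fun z => fderiv ℂ u z ∘L .inl ℂ P Q - B (G z)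
  have key : ∀ᶠ z in 𝓝 (0 : P × Q), DifferentiableAt ℂ e z ∧ ∀ h : P,
      fderiv ℂ e z (z.1, 0) h = fderiv ℂ B (G z) (0, e z h) z.1 - e z h := by
    filter_upwards [hrad.eventually_nhds, hGt.eventually hint, hGt.eventually (hB.eventually (by simp)),
      hu.eventually (by simp)] with z h1 h2 h3 h4
    have hz1 := h1.self_of_nhds
    have hdu : HasFDerivAt (fderiv ℂ u) (fderiv ℂ (fderiv ℂ u) z) z :=
      ((h4.fderiv_right (m := ω) le_top).differentiableAt hω).hasFDerivAt
    have hduinl : HasFDerivAt (fun z => fderiv ℂ u z ∘L .inl ℂ P Q)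
        (((ContinuousLinearMap.compL ℂ P (P × Q) Q).flip (.inl ℂ P Q)) ∘L fderiv ℂ (fderiv ℂ u) z) z :=
      (((ContinuousLinearMap.compL ℂ P (P × Q) Q).flip (.inl ℂ P Q)).hasFDerivAt).comp z hdu
    have hGz : HasFDerivAt G ((ContinuousLinearMap.fst ℂ P Q).prod (fderiv ℂ u z)) z :=
      hasFDerivAt_fst.prodMk (h4.differentiableAt hω).hasFDerivAt
    have hBG : HasFDerivAt (fun z => B (G z))
        (fderiv ℂ B (G z) ∘L (ContinuousLinearMap.fst ℂ P Q).prod (fderiv ℂ u z)) z :=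
      (h3.differentiableAt hω).hasFDerivAt.comp z hGz
    have he := hduinl.sub hBG
    have hef : fderiv ℂ e z = _ := he.fderiv
    have hev (v : P × Q) (k : P) : fderiv ℂ e z v k =
        fderiv ℂ (fderiv ℂ u) z v (k, 0) - fderiv ℂ B (G z) (v.1, fderiv ℂ u z v) k := by
      rw [hef]; rfl
    have hsymm : IsSymmSndFDerivAt ℂ u z := h4.isSymmSndFDerivAt le_top
    refine ⟨he.differentiableAt, fun h => ?_⟩
    have hediff : HasFDerivAt e (fderiv ℂ e z) z := he.differentiableAt.hasFDerivAt
    have hprod : HasFDerivAt (fun z => e z z.1) _ z := hediff.clm_apply hasFDerivAt_fst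
    have hzero : (fun z : P × Q => e z z.1) =ᶠ[𝓝 z] fun _ => 0 := by
      filter_upwards [h1] with z' h1'
      exact sub_eq_zero.2 h1'
    have h5 := hprod.unique ((hasFDerivAt_const (0 : Q) z).congr_of_eventuallyEq hzero)
    have h6 : e z h + fderiv ℂ e z (h, 0) z.1 = 0 := DFunLike.congr_fun h5 (h, 0)
    rw [hev] at h6 ⊢
    have h7 : fderiv ℂ u z (h, 0) = e z h + B (G z) h := by
      change _ = fderiv ℂ u z (h, 0) - B (G z) h + B (G z) h
      rw [sub_add_cancel]
    have h8 : fderiv ℂ B (G z) (h, fderiv ℂ u z (h, 0)) z.1 =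
        fderiv ℂ B (G z) (h, B (G z) h) z.1 + fderiv ℂ B (G z) (0, e z h) z.1 := by
      have h10 : (h, e z h + B (G z) h) = (h, B (G z) h) + (0, e z h) := by
        rw [Prod.mk_add_mk, add_zero, add_comm]
      rw [h7, h10, map_add, add_apply]
    have h9 : fderiv ℂ (fderiv ℂ u) z (z.1, 0) (h, 0) = fderiv ℂ (fderiv ℂ u) z (h, 0) (z.1, 0) :=
      hsymm _ _
    rw [h9, hz1, h2 z.1 h]
    simp only [h8] at h6
    refine sub_eq_zero.1 (Eq.trans ?_ h6)
    abel
  have hbound : ∃ K : ℝ, ∀ᶠ z in 𝓝 (0 : P × Q), ‖fderiv ℂ B (G z)‖ ≤ K := by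
    have h1 : ContinuousAt (fderiv ℂ B) (G 0) := by
      rw [hG0]
      exact (hB.fderiv_right (m := ω) le_top).continuousAt
    have h2 : ContinuousAt (fun z => ‖fderiv ℂ B (G z)‖) 0 :=
      (continuous_norm (E := P × Q →L[ℂ] P →L[ℂ] Q)).continuousAt.comp
        (ContinuousAt.comp (f := G) h1 hG.continuousAt)
    exact ⟨_, (h2.eventually_lt_const (lt_add_one _)).mono fun z hz => hz.le⟩
  obtain ⟨K, hK⟩ := hbound
  obtain ⟨ε, hε, hεb⟩ := Metric.eventually_nhds_iff_ball.1 (key.and hK)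
  filter_upwards [Metric.ball_mem_nhds (0 : P × Q) hε] with z hz h
  have hsz (s : ℝ) (hs : s ∈ Set.Icc (0 : ℝ) 1) : (s • z.1, z.2) ∈ Metric.ball (0 : P × Q) ε :=
    mem_ball_zero_iff.2 ((norm_smul_fst_le hs.1 hs.2 z).trans_lt (mem_ball_zero_iff.1 hz))
  let φ : ℝ → Q := fun s => s • e (s • z.1, z.2) h
  let φ' : ℝ → Q := fun s => fderiv ℂ B (G (s • z.1, z.2)) (0, φ s) z.1
  have hφ (s : ℝ) (hs : s ∈ Set.Icc (0 : ℝ) 1) : HasDerivAt φ (φ' s) s := by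
    obtain ⟨⟨h1, h2⟩, -⟩ := hεb _ (hsz s hs)
    have h3 := hasDerivAt_comp_smul_fst (f := fun z => e z h) (h1.clm_apply (differentiableAt_const h))
    have h4 : fderiv ℂ (fun z => e z h) (s • z.1, z.2) (z.1, 0) =
        fderiv ℂ e (s • z.1, z.2) (z.1, 0) h := by
      have := (h1.hasFDerivAt.clm_apply (hasFDerivAt_const h _)).fderiv
      rw [this]
      simp
    rw [h4] at h3
    have h5 := (hasDerivAt_id s).smul h3
    refine h5.congr_deriv ?_
    have h6 := h2 h
    simp only at h6
    have h7 : ((s • z.1, 0) : P × Q) = s • (z.1, 0) := by simp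
    rw [h7, ContinuousLinearMap.map_smul_of_tower, smul_apply,
      ContinuousLinearMap.map_smul_of_tower] at h6
    have h8 : ((0, φ s) : P × Q) = s • (0, e (s • z.1, z.2) h) := by simp [φ]
    simp only [φ', h8, id, one_smul, h6]
    rw [ContinuousLinearMap.map_smul_of_tower, smul_apply]
    abel
  have := eq_zero_of_abs_deriv_le_mul_abs_self_of_eq_zero_right (f := φ) (f' := φ') (K := K * ‖z.1‖)
    (a := 0) (b := 1) (fun s hs => (hφ s hs).continuousAt.continuousWithinAt)
    (fun s hs => (hφ s ⟨hs.1, hs.2.le⟩).hasDerivWithinAt) (by simp [φ]) (fun s hs => ?_) 1 (by simp)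
  · simp only [φ, one_smul] at this
    exact sub_eq_zero.1 this
  · have h1 := (hεb _ (hsz s ⟨hs.1, hs.2.le⟩)).2
    calc ‖φ' s‖ ≤ ‖fderiv ℂ B (G (s • z.1, z.2))‖ * ‖((0, φ s) : P × Q)‖ * ‖z.1‖ :=
          ContinuousLinearMap.le_opNorm₂ (fderiv ℂ B (G (s • z.1, z.2))) _ _
      _ ≤ K * ‖φ s‖ * ‖z.1‖ := by
          rw [show ‖((0, φ s) : P × Q)‖ = ‖φ s‖ by simp]
          gcongr
      _ = K * ‖z.1‖ * ‖φ s‖ := by ring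

end Frobenius

section HomologicalAlgebra
open CategoryTheory Limits

variable {C : Type*} [Category* C] [Abelian C]

/-- A resolution of `L` is quasi-isomorphic to `L`. -/
theorem CochainComplex.quasiIso_fromSingle₀ (K : CochainComplex C ℕ) {L : C} (f : L ⟶ K.X 0) [Mono f]
    (w : f ≫ K.d 0 1 = 0) (h0 : (ShortComplex.mk f (K.d 0 1) w).Exact)
    (h : ∀ k, 0 < k → K.ExactAt k) :
    QuasiIso ((CochainComplex.fromSingle₀Equiv K L).symm ⟨f, w⟩) := by
  refine ⟨fun n => ?_⟩
  cases n with
  | zero =>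
    rw [CochainComplex.quasiIsoAt₀_iff, ShortComplex.quasiIso_iff_of_zeros]
    · refine (ShortComplex.exact_and_mono_f_iff_of_iso ?_).2 ⟨h0, ‹_›⟩
      exact ShortComplex.isoMk (Iso.refl _) (Iso.refl _) (Iso.refl _)
        (by
          simp
          exact (Category.id_comp f).trans (Category.comp_id f).symm)
        (by
          simp
          exact (Category.id_comp (K.d 0 1)).trans (Category.comp_id (K.d 0 1)).symm)
    · rfl
    · rfl
    · exact K.shape _ _ (by simp)
  | succ n =>
    rw [quasiIsoAt_iff_exactAt]
    · exact h _ (Nat.succ_pos n)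
    · exact CochainComplex.exactAt_succ_single_obj _ _

/-- `Ext` groups can be computed from a resolution of the second argument. -/
theorem CochainComplex.nonempty_ext_linearEquiv {R : Type*} [Ring R] [Linear R C] [HasExt C]
    [HasDerivedCategory C]
    (K : CochainComplex C ℕ) {L : C} (f : L ⟶ K.X 0) [Mono f]
    (w : f ≫ K.d 0 1 = 0) (h0 : (ShortComplex.mk f (K.d 0 1) w).Exact)
    (h : ∀ k, 0 < k → K.ExactAt k) (Y : C) (k : ℕ) :
    Nonempty (Abelian.Ext Y L k ≃ₗ[R] ShiftedHom ((DerivedCategory.singleFunctor C 0).obj Y)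
      (DerivedCategory.Q.obj (K.extend ComplexShape.embeddingUpNat)) (k : ℤ)) := by
  have := K.quasiIso_fromSingle₀ f w h0 h
  let φ := HomologicalComplex.extendMap ((CochainComplex.fromSingle₀Equiv K L).symm ⟨f, w⟩)
    ComplexShape.embeddingUpNat
  have : IsIso (DerivedCategory.Q.map φ) := by
    rw [DerivedCategory.isIso_Q_map_iff_quasiIso]
    infer_instance
  let e : (DerivedCategory.singleFunctor C 0).obj L ≅
      DerivedCategory.Q.obj (K.extend ComplexShape.embeddingUpNat) :=
    (DerivedCategory.singleFunctorIsoCompQ C 0).app L ≪≫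
      DerivedCategory.Q.mapIso (HomologicalComplex.extendSingleIso ComplexShape.embeddingUpNat L
        0 0 rfl).symm ≪≫ asIso (DerivedCategory.Q.map φ)
  exact ⟨Abelian.Ext.homLinearEquiv.trans (Linear.homCongr R (Iso.refl _)
    ((CategoryTheory.shiftFunctor (DerivedCategory C) (k : ℤ)).mapIso e))⟩

end HomologicalAlgebra

namespace HolGeom
open CategoryTheory Opposite

/-- A complex of sheaves is exact if it is so locally. -/
theorem VectSheaf.exact_of_local {X : Type u} [TopologicalSpace X] (S : ShortComplex (VectSheaf X))
    (h : ∀ (U : Opens X) (s : S.X₂.obj.obj (op U)), S.g.hom.app (op U) s = 0 → ∀ x ∈ U,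
      ∃ (W : Opens X) (hW : W ≤ U), x ∈ W ∧ ∃ t : S.X₁.obj.obj (op W),
        S.f.hom.app (op W) t = S.X₂.obj.map (homOfLE hW).op s) : S.Exact := by
  rw [ShortComplex.exact_iff_epi_kernel_lift, ← Sheaf.isLocallySurjective_iff_epi' (ModuleCat.{u} ℂ)]
  let ι := Limits.kernel.ι S.g
  have hι (U) : Function.Injective (ι.hom.app U) := by
    have : Mono ι.hom := (Sheaf.Hom.mono_iff_presheaf_mono _ _ ι).1 inferInstance
    exact (ModuleCat.mono_iff_injective _).1 ((NatTrans.mono_iff_mono_app ι.hom).1 this U)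
  refine ⟨fun {U} s => ?_⟩
  intro x hx
  have h1 : S.g.hom.app (op U) (ι.hom.app (op U) s) = 0 := by
    have h2 := congrArg (fun g => g.hom.app (op U)) (Limits.kernel.condition S.g)
    exact congrArg (fun g => g.hom s) h2
  obtain ⟨W, hW, hxW, t, ht⟩ := h U (ι.hom.app (op U) s) h1 x hx
  refine ⟨W, homOfLE hW, ⟨t, hι _ ?_⟩, hxW⟩
  have h3 := congrArg (fun g => g.hom.app (op W)) (Limits.kernel.lift_ι S.g S.f S.zero)
  have h4 : ι.hom.app (op W) ((Limits.kernel.lift S.g S.f S.zero).hom.app (op W) t) =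
    S.f.hom.app (op W) t := congrArg (fun g => g.hom t) h3
  exact h4.trans (ht.trans (ConcreteCategory.congr_hom (ι.hom.naturality (homOfLE hW).op) s).symm)

theorem VectSheaf.mono_of_injective {X : Type u} [TopologicalSpace X] {F G : VectSheaf X} (f : F ⟶ G)
    (h : ∀ U, Function.Injective (f.hom.app (op U))) : Mono f := by
  have : Mono f.hom := (NatTrans.mono_iff_mono_app f.hom).2 fun U =>
    (ModuleCat.mono_iff_injective _).2 (h U.unop)
  exact Sheaf.Hom.mono_of_presheaf_mono _ _ f

end HolGeom

namespace LieRinehartCochain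
section Poincare
open Equiv

variable {A L ι : Type*} [CommRing A] [Algebra ℂ A] [LieRing L] [Module A L] [LieRingModule L A]
  [Fintype ι] [DecidableEq ι]

/-- The cochain with the given (antisymmetric) coefficients in a basis. -/
noncomputable def ofCoeff (b : Module.Basis ι A L) (k : ℕ) (g : (Fin k → ι) → A) : Cochain A L k :=
  MultilinearMap.alternatization (∑ I : Fin k → ι, (algebraMap ℂ A (k.factorial : ℂ)⁻¹ * g I) •
    (MultilinearMap.mkPiAlgebra A (Fin k) A).compLinearMap fun j => b.coord (I j))

theorem ofCoeff_apply_basis (b : Module.Basis ι A L) {k : ℕ} {g : (Fin k → ι) → A}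
    (hg : ∀ I (σ : Perm (Fin k)), g (I ∘ σ) = Perm.sign σ • g I) (J : Fin k → ι) :
    ofCoeff b k g (fun j => b (J j)) = g J := by
  have h1 (J : Fin k → ι) : (∑ I : Fin k → ι, (algebraMap ℂ A (k.factorial : ℂ)⁻¹ * g I) •
      (MultilinearMap.mkPiAlgebra A (Fin k) A).compLinearMap fun j => b.coord (I j))
      (fun j => b (J j)) = algebraMap ℂ A (k.factorial : ℂ)⁻¹ * g J := by
    rw [sum_apply, Finset.sum_eq_single J]
    · simp
    · intro I _ hI
      obtain ⟨j, hj⟩ := Function.ne_iff.1 hI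
      simp only [smul_apply, MultilinearMap.compLinearMap_apply,
        MultilinearMap.mkPiAlgebra_apply, smul_eq_mul]
      rw [Finset.prod_eq_zero (Finset.mem_univ j), mul_zero]
      simp [Ne.symm hj]
    · simp
  rw [ofCoeff, MultilinearMap.alternatization_apply]
  have h2 (σ : Perm (Fin k)) : Perm.sign σ • (MultilinearMap.domDomCongr σ (∑ I : Fin k → ι,
      (algebraMap ℂ A (k.factorial : ℂ)⁻¹ * g I) •
      (MultilinearMap.mkPiAlgebra A (Fin k) A).compLinearMap fun j => b.coord (I j)))
      (fun j => b (J j)) = algebraMap ℂ A (k.factorial : ℂ)⁻¹ * g J := by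
    rw [MultilinearMap.domDomCongr_apply]
    refine (congrArg _ (h1 (J ∘ σ))).trans ?_
    rw [hg, mul_smul_comm, smul_smul, Int.units_mul_self, one_smul]
  refine (Finset.sum_congr rfl fun σ _ => h2 σ).trans ?_
  rw [Finset.sum_const, Finset.card_univ, Fintype.card_perm, Fintype.card_fin, nsmul_eq_mul, ← mul_assoc,
    ← map_natCast (algebraMap ℂ A), ← map_mul, mul_inv_cancel₀, map_one, one_mul]
  exact_mod_cast k.factorial_ne_zero

variable [LieRinehartRing A L]

theorem lieDeriv_apply_basis (b : Module.Basis ι A L) {R : L} (hR : ∀ i, ⁅R, b i⁆ = -b i) {k : ℕ}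
    (α : Cochain A L k) (J : Fin k → ι) : lieDeriv R α (fun j => b (J j)) =
      ⁅R, α (fun j => b (J j))⁆ + k * α (fun j => b (J j)) := by
  rw [lieDeriv_apply]
  have h (i : Fin k) : α (Function.update (fun j => b (J j)) i ⁅R, b (J i)⁆) =
      -α (fun j => b (J j)) := by
    rw [hR, AlternatingMap.map_update_neg, Function.update_eq_self]
  rw [Finset.sum_congr rfl fun i _ => h i]
  simp

/-- The Poincaré lemma in the presence of an Euler vector field. -/
theorem exists_differential_eq (b : Module.Basis ι A L) {R : L} (hR : ∀ i, ⁅R, b i⁆ = -b i)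
    (hinj : ∀ (k : ℕ) (f : A), 0 < k → ⁅R, f⁆ + k * f = 0 → f = 0) {k : ℕ} (α : Cochain A L (k + 1))
    (hα : differential α = 0)
    (hex : ∀ J : Fin (k + 1) → ι, ∃ g, ⁅R, g⁆ + ((k + 1 : ℕ) : A) * g = α fun j => b (J j)) :
    ∃ β, differential β = α := by
  have hL {k : ℕ} (hk : 0 < k) (η : Cochain A L k) (h : lieDeriv R η = 0) : η = 0 := by
    refine b.ext_alternating fun J _ => hinj k _ hk ?_
    rw [← lieDeriv_apply_basis b hR, h]
    rfl
  choose g hg using hex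
  have hanti (I : Fin (k + 1) → ι) (σ : Perm (Fin (k + 1))) : g (I ∘ σ) = Perm.sign σ • g I := by
    refine sub_eq_zero.1 (hinj (k + 1) _ k.succ_pos ?_)
    have h1 := hg (I ∘ σ)
    have h2 : (α fun j => b ((I ∘ σ) j)) = Perm.sign σ • α fun j => b (I j) :=
      α.map_perm (fun j => b (I j)) σ
    rw [h2, ← hg I] at h1
    rcases Int.units_eq_one_or (Perm.sign σ) with h | h
    · rw [h, one_smul] at h1 ⊢
      rw [lie_sub]
      linear_combination h1
    · rw [h, Units.neg_smul, one_smul] at h1 ⊢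
      rw [lie_sub, lie_neg]
      linear_combination h1
  let α' := ofCoeff b (k + 1) g
  have h1 : lieDeriv R α' = α := by
    refine b.ext_alternating fun J _ => ?_
    rw [lieDeriv_apply_basis b hR, ofCoeff_apply_basis b hanti, hg]
  have h2 : differential α' = 0 := by
    refine hL (Nat.succ_pos _) _ ?_
    rw [lieDeriv_differential, h1, hα]
  refine ⟨α'.curryLeft R, ?_⟩
  have h3 := curryLeft_differential α' R
  rw [h2, h1] at h3
  exact (sub_eq_zero.1 h3.symm).symm

end Poincare
end LieRinehartCochain

section Euler
open MeasureTheory intervalIntegral unitInterval Filter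
variable {P Q : Type*} [NormedAddCommGroup P] [NormedSpace ℂ P] [NormedAddCommGroup Q] [NormedSpace ℂ Q]

/-- The map `(x, y) ↦ (s ↦ (s x, y))`. -/
noncomputable def rayLift (P Q : Type*) [NormedAddCommGroup P] [NormedSpace ℂ P]
    [NormedAddCommGroup Q] [NormedSpace ℂ Q] : (P × Q) →L[ℂ] C(I, P × Q) :=
  LinearMap.mkContinuous
    { toFun := fun z => ⟨fun s => ((s : ℝ) • z.1, z.2), by fun_prop⟩
      map_add' := fun v w => by ext s <;> simp
      map_smul' := fun c v => by ext s <;> simp [smul_comm c] } 1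
    fun z => by
      rw [one_mul]
      exact (ContinuousMap.norm_le _ (norm_nonneg _)).2 fun s => norm_smul_fst_le s.2.1 s.2.2 z

theorem rayLift_apply (z : P × Q) (s : I) : rayLift P Q z s = ((s : ℝ) • z.1, z.2) := rfl

theorem norm_rayLift_le (z : P × Q) : ‖rayLift P Q z‖ ≤ ‖z‖ := by
  have := (rayLift P Q).le_of_opNorm_le (LinearMap.mkContinuous_norm_le _ zero_le_one _) z
  rwa [one_mul] at this

theorem smul_fst_mem_eball {s : ℝ} (h0 : 0 ≤ s) (h1 : s ≤ 1) {z : P × Q} {r : ENNReal}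
    (hz : z ∈ Metric.eball 0 r) : (s • z.1, z.2) ∈ Metric.eball (0 : P × Q) r := by
  rw [Metric.mem_eball, edist_zero_right] at hz ⊢
  exact lt_of_le_of_lt (enorm_le_iff_norm_le.2 (norm_smul_fst_le h0 h1 z)) hz

theorem exists_euler_primitive_zero {f : P × Q → ℂ} {p : FormalMultilinearSeries ℂ (P × Q) ℂ}
    {r : ENNReal} (hf : HasFPowerSeriesOnBall f p 0 r) (k : ℕ) :
    ∃ g : P × Q → ℂ, AnalyticOnNhd ℂ g (Metric.eball 0 r) ∧
      ∀ z ∈ Metric.eball 0 r, fderiv ℂ g z (z.1, 0) + ((k + 1 : ℕ) : ℂ) * g z = f z := by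
  obtain ⟨N, R, hN, hNf⟩ := hf.exists_superposition I
  let m : C(I, ℂ) := ⟨fun s => ((s : ℝ) : ℂ) ^ k, by fun_prop⟩
  let T : C(I, ℂ) →L[ℂ] ℂ :=
    ContinuousMap.evalCLM ℂ (1 : I) ∘L volterra ℂ ∘L ContinuousLinearMap.mul ℂ C(I, ℂ) m
  let g : P × Q → ℂ := fun z => T (N (rayLift P Q z))
  have hmem {z : P × Q} (hz : z ∈ Metric.eball 0 r) : rayLift P Q z ∈ Metric.eball 0 r := by
    rw [Metric.mem_eball, edist_zero_right] at hz ⊢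
    exact lt_of_le_of_lt (enorm_le_iff_norm_le.2 (norm_rayLift_le z)) hz
  have hga : AnalyticOnNhd ℂ g (Metric.eball 0 r) := fun z hz =>
    (T.analyticAt _).comp ((hN.analyticAt_of_mem (hmem hz)).comp ((rayLift P Q).analyticAt z))
  have hg {z : P × Q} (hz : z ∈ Metric.eball 0 r) :
      g z = ∫ s in (0 : ℝ)..1, (s : ℂ) ^ k * f (s • z.1, z.2) :=
    volterra_eq_integral (m * N (rayLift P Q z)) 1 (fun s : ℝ => (s : ℂ) ^ k * f (s • z.1, z.2))
      fun s => by
        rw [ContinuousMap.mul_apply, hNf _ (hmem hz), rayLift_apply]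
        rfl
  refine ⟨g, hga, fun z hz => ?_⟩
  let h : ℝ → ℂ := fun s => (s : ℂ) ^ k * f (s • z.1, z.2)
  have hscale {t : ℝ} (ht : t ∈ Set.Icc (0 : ℝ) 1) :
      (t : ℂ) ^ (k + 1) * g (t • z.1, z.2) = ∫ s in (0 : ℝ)..t, h s := by
    have h1 := smul_integral_comp_mul_left (a := 0) (b := 1) h t
    rw [mul_zero, mul_one] at h1
    rw [← h1, hg (smul_fst_mem_eball ht.1 ht.2 hz), ← intervalIntegral.integral_smul,
      ← intervalIntegral.integral_const_mul]
    refine integral_congr fun s _ => ?_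
    simp only [h, smul_smul, mul_comm s t, Complex.real_smul, Complex.ofReal_mul]
    ring
  have hcont : ContinuousOn h (Set.Icc 0 1) := by
    intro t ht
    have h1 : ContinuousAt f (t • z.1, z.2) :=
      (hf.analyticAt_of_mem (smul_fst_mem_eball ht.1 ht.2 hz)).continuousAt
    have h2 : ContinuousAt (fun t : ℝ => (t • z.1, z.2)) t := by fun_prop
    have h3 : ContinuousAt (fun t : ℝ => f (t • z.1, z.2)) t := ContinuousAt.comp (f := fun t : ℝ => (t • z.1, z.2)) h1 h2
    exact ContinuousAt.continuousWithinAt (ContinuousAt.mul (by fun_prop) h3)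
  have hd1 : HasDerivWithinAt (fun t : ℝ => (t : ℂ) ^ (k + 1) * g (t • z.1, z.2))
      (((k + 1 : ℕ) : ℂ) * g z + fderiv ℂ g z (z.1, 0)) (Set.Icc 0 1) 1 := by
    have h1 := hasDerivAt_comp_smul_fst (f := g) (x := z.1) (y := z.2) (s := 1)
      (by rw [one_smul]; exact (hga z hz).differentiableAt)
    have h2 : HasDerivAt (fun t : ℝ => (t : ℂ) ^ (k + 1)) (((k + 1 : ℕ) : ℂ)) 1 := by
      have := ((hasDerivAt_id (1 : ℝ)).ofReal_comp).fun_pow (k + 1)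
      simpa using this
    have h3 := h2.mul h1
    simp only [Complex.ofReal_one, one_pow, one_mul, one_smul] at h3
    exact h3.hasDerivWithinAt
  have hd2 : HasDerivWithinAt (fun t : ℝ => (t : ℂ) ^ (k + 1) * g (t • z.1, z.2)) (f z)
      (Set.Icc 0 1) 1 := by
    have : Fact ((1 : ℝ) ∈ Set.Icc (0 : ℝ) 1) := ⟨by simp⟩
    have h1 : HasDerivWithinAt (fun t : ℝ => ∫ s in (0 : ℝ)..t, h s) (h 1) (Set.Icc 0 1) 1 :=
      integral_hasDerivWithinAt_right (t := Set.Icc 0 1) (hcont.intervalIntegrable_of_Icc zero_le_one)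
        (hcont.stronglyMeasurableAtFilter_nhdsWithin measurableSet_Icc _) (hcont 1 (by simp))
    have h2 : h 1 = f z := by simp [h]
    rw [h2] at h1
    exact h1.congr_of_mem (fun t ht => hscale ht) (by simp)
  rw [add_comm]
  exact (uniqueDiffOn_Icc (zero_lt_one' ℝ) 1 (by simp)).eq_deriv _ hd1 hd2

/-- The equation `(x - x₀) ∂ₓg + (k + 1) g = f` can be solved on polydiscs. -/
theorem exists_euler_primitive {f : P × Q → ℂ} {p : FormalMultilinearSeries ℂ (P × Q) ℂ} {z₀ : P × Q}
    {r : ENNReal} (hf : HasFPowerSeriesOnBall f p z₀ r) (k : ℕ) :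
    ∃ g : P × Q → ℂ, AnalyticOnNhd ℂ g (Metric.eball z₀ r) ∧
      ∀ z ∈ Metric.eball z₀ r, fderiv ℂ g z (z.1 - z₀.1, 0) + ((k + 1 : ℕ) : ℂ) * g z = f z := by
  have hf' : HasFPowerSeriesOnBall (fun z => f (z + z₀)) p 0 r := by
    have := hf.comp_sub (-z₀)
    simpa only [sub_neg_eq_add, add_neg_cancel] using this
  obtain ⟨g, hg, hgf⟩ := exists_euler_primitive_zero hf' k
  have hmem {z : P × Q} (hz : z ∈ Metric.eball z₀ r) : z - z₀ ∈ Metric.eball 0 r := by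
    rwa [Metric.mem_eball, edist_zero_right, ← edist_eq_enorm_sub]
  refine ⟨fun z => g (z - z₀), fun z hz => ?_, fun z hz => ?_⟩
  · exact AnalyticAt.comp (g := g) (f := fun z => z - z₀) (hg _ (hmem hz)) (by fun_prop)
  · have := hgf _ (hmem hz)
    rw [sub_add_cancel] at this
    rw [fderiv_comp_sub]
    exact this

theorem eq_zero_of_euler {g : P × Q → ℂ} {z₀ : P × Q} {ρ : ℝ} {k : ℕ} (hk : 0 < k)
    (hg : ∀ z ∈ Metric.ball z₀ ρ, DifferentiableAt ℂ g z)
    (h : ∀ z ∈ Metric.ball z₀ ρ, fderiv ℂ g z (z.1 - z₀.1, 0) + (k : ℂ) * g z = 0)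
    {z : P × Q} (hz : z ∈ Metric.ball z₀ ρ) : g z = 0 := by
  obtain ⟨k, rfl⟩ := Nat.exists_eq_succ_of_ne_zero hk.ne'
  let c : ℝ → P × Q := fun t => (t • (z.1 - z₀.1) + z₀.1, z.2)
  have hc {t : ℝ} (ht : t ∈ Set.Icc (0 : ℝ) 1) : c t ∈ Metric.ball z₀ ρ := by
    rw [mem_ball_iff_norm] at hz ⊢
    have : c t - z₀ = (t • (z - z₀).1, (z - z₀).2) := by
      ext <;> simp [c]
    rw [this]
    exact (norm_smul_fst_le ht.1 ht.2 _).trans_lt hz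
  have hd (t : ℝ) (ht : t ∈ Set.Icc (0 : ℝ) 1) :
      HasDerivAt (fun t : ℝ => (t : ℂ) ^ (k + 1) * g (c t)) 0 t := by
    have h1 : HasDerivAt c (z.1 - z₀.1, 0) t := by
      simpa using (((hasDerivAt_id t).smul_const (z.1 - z₀.1)).add_const z₀.1).prodMk
        (hasDerivAt_const t z.2)
    have h2 := ((hg _ (hc ht)).hasFDerivAt.restrictScalars ℝ).comp_hasDerivAt t h1
    have h3 := (((hasDerivAt_id t).ofReal_comp).fun_pow (k + 1)).mul h2
    refine h3.congr_deriv ?_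
    have h4 := h _ (hc ht)
    have h5 : ((c t).1 - z₀.1, (0 : Q)) = t • (z.1 - z₀.1, 0) := by simp [c]
    rw [h5, ContinuousLinearMap.map_smul_of_tower, Complex.real_smul] at h4
    simp only [Function.comp_apply, id, Complex.ofReal_one, mul_one, Nat.add_sub_cancel,
      ContinuousLinearMap.coe_restrictScalars']
    linear_combination (t : ℂ) ^ k * h4
  have h1 := constant_of_has_deriv_right_zero (a := 0) (b := 1)
    (fun t ht => (hd t ht).continuousAt.continuousWithinAt)
    (fun t ht => (hd t ⟨ht.1, ht.2.le⟩).hasDerivWithinAt) 1 (by simp)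
  simpa [c] using h1

end Euler

namespace HolGeom
open Set LieRinehartCochain

section
variable {X : Type u} [TopologicalSpace X] {E : Type u} [NormedAddCommGroup E] [NormedSpace ℂ E]
  [ChartedSpace E X] [IsManifold 𝓘(ℂ, E) ω X]

theorem holFun_isUnit {U : Opens X} (f : holFun E U) (h : ∀ x, f.1 x ≠ 0) : IsUnit f := by
  have h1 : (fun x => (f.1 x)⁻¹) ∈ holFun E U := by
    refine (ContMDiffOn.inv₀ f.2 fun x hx => ?_).congr fun x hx => ?_
    · rw [extendZero_of_mem _ hx]
      exact h ⟨x, hx⟩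
    · rw [extendZero_of_mem _ hx, extendZero_of_mem _ hx]
  refine IsUnit.of_mul_eq_one ⟨_, h1⟩ (Subtype.ext (funext fun x => ?_))
  exact mul_inv_cancel₀ (h x)

variable [FiniteDimensional ℂ E] {F : Type*} [NormedAddCommGroup F] [NormedSpace ℂ F] {V : X → Type*}
  [∀ x, AddCommGroup (V x)] [∀ x, Module ℂ (V x)] [∀ x, TopologicalSpace (V x)]
  [TopologicalSpace (TotalSpace F V)] [FiberBundle F V] [VectorBundle ℂ F V]

instance (x : X) : FiniteDimensional ℂ (TangentSpace 𝓘(ℂ, E) x) :=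
  inferInstanceAs (FiniteDimensional ℂ E)

namespace HolomorphicLieAlgebroid
variable (A : HolomorphicLieAlgebroid E F V)

theorem image_apply_mem_range {U : Opens X} (v : A.image U) (x : U) :
    v.1 x ∈ LinearMap.range (A.anchor x) := by
  obtain ⟨W, hW, hx, s, -, h⟩ := v.2 x
  exact ⟨s ⟨x, hx⟩, (congrFun h ⟨x, hx⟩).symm⟩

/-- Locally the image of the anchor is spanned by finitely many of its sections. -/
theorem exists_span_eq_range [FiniteDimensional ℂ F] [ContMDiffVectorBundle ω F V 𝓘(ℂ, E)] (x₀ : X) :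
    ∃ (W : Opens X) (n : ℕ) (w : Fin n → A.image W), x₀ ∈ W ∧
      ∀ x : W, Submodule.span ℂ (Set.range fun j => (w j).1 x) = LinearMap.range (A.anchor x) := by
  let e := trivializationAt F V x₀
  let b := Module.finBasis ℂ F
  let W : Opens X := ⟨e.baseSet, e.open_baseSet⟩
  have hs (j) : (fun x : W => e.localFrame b j x) ∈ holSec E F V W := by
    refine (e.contMDiffOn_localFrame_baseSet ω b j).congr fun x hx => ?_
    rw [extendZero_of_mem _ hx]
  refine ⟨W, _, fun j => ⟨fun x => A.anchor x (e.localFrame b j x), fun x =>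
    ⟨W, le_rfl, x.2, _, hs j, rfl⟩⟩, FiberBundle.mem_baseSet_trivializationAt' x₀, fun x => ?_⟩
  have h1 := (e.isLocalFrameOn_localFrame_baseSet 𝓘(ℂ, E) ω b).generating x.2
  have h2 : Submodule.span ℂ (Set.range fun j => e.localFrame b j (x : X)) = ⊤ := top_le_iff.1 h1
  rw [LinearMap.range_eq_map, ← h2, Submodule.map_span, ← Set.range_comp]
  rfl

/-- The functions `y` are coordinates for the sections `v` of the image of the anchor. -/
def IsFrame {r : ℕ} {W : Opens X} (y : Fin r → holFun E W) (v : Fin r → A.image W) : Prop :=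
  (∀ x : W, Module.finrank ℂ (LinearMap.range (A.anchor x)) = r) ∧
    ∀ i j, ⁅v i, y j⁆ = if i = j then 1 else 0

variable {A}

theorem IsFrame.restrict {r : ℕ} {W W' : Opens X} {y : Fin r → holFun E W} {v : Fin r → A.image W}
    (h : A.IsFrame y v) (hW : W' ≤ W) :
    A.IsFrame (fun i => resFun hW (y i)) (fun i => A.resImage hW (v i)) := by
  refine ⟨fun x => h.1 ⟨x, hW x.2⟩, fun i j => ?_⟩
  rw [← A.resFun_lie, h.2]
  split_ifs <;> rfl

theorem zero_lie_fun {W : Opens X} (f : holFun E W) : ⁅(0 : A.image W), f⁆ = 0 := zero_lie f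

theorem add_lie_fun {W : Opens X} (v w : A.image W) (f : holFun E W) : ⁅v + w, f⁆ = ⁅v, f⁆ + ⁅w, f⁆ :=
  add_lie v w f

theorem smul_lie_fun {W : Opens X} (c : holFun E W) (v : A.image W) (f : holFun E W) :
    ⁅c • v, f⁆ = c * ⁅v, f⁆ := LieRinehartRing.lie_smul_eq_mul c f v

theorem lie_lie_fun {W : Opens X} (v w : A.image W) (f : holFun E W) :
    ⁅⁅v, w⁆, f⁆ = ⁅v, ⁅w, f⁆⁆ - ⁅w, ⁅v, f⁆⁆ := lie_lie v w f

theorem sum_smul_lie {W : Opens X} {ι : Type*} (s : Finset ι) (c : ι → holFun E W) (v : ι → A.image W)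
    (f : holFun E W) : ⁅∑ i ∈ s, c i • v i, f⁆ = ∑ i ∈ s, c i * ⁅v i, f⁆ := by
  classical
  induction s using Finset.induction_on with
  | empty => exact zero_lie_fun f
  | insert a s ha ih => rw [Finset.sum_insert ha, Finset.sum_insert ha, add_lie_fun, ih,
      smul_lie_fun]

theorem IsFrame.sum_smul_lie {r : ℕ} {W : Opens X} {y : Fin r → holFun E W} {v : Fin r → A.image W}
    (h : A.IsFrame y v) (c : Fin r → holFun E W) (j : Fin r) : ⁅∑ i, c i • v i, y j⁆ = c j := by
  rw [HolomorphicLieAlgebroid.sum_smul_lie]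
  simp [h.2]

theorem coe_sum_smul {W : Opens X} {ι : Type*} (s : Finset ι) (c : ι → holFun E W) (v : ι → A.image W)
    (x : W) : (∑ i ∈ s, c i • v i).1 x = ∑ i ∈ s, (c i).1 x • (v i).1 x := by
  rw [AddSubmonoidClass.coe_finsetSum, Finset.sum_apply]
  rfl

theorem IsFrame.span_eq {r : ℕ} {W : Opens X} {y : Fin r → holFun E W} {v : Fin r → A.image W}
    (h : A.IsFrame y v) (x : W) :
    Submodule.span ℂ (Set.range fun i => (v i).1 x) = LinearMap.range (A.anchor x) := by
  have hli : LinearIndependent ℂ fun i => (v i).1 x := by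
    rw [Fintype.linearIndependent_iff]
    intro c hc j
    have h1 := congrArg (fun w => mvfderiv 𝓘(ℂ, E) (extendZero (V := fun _ => ℂ) (y j).1) (x : X) w) hc
    simp only [map_sum, map_smul, map_zero] at h1
    have h2 (i) : mvfderiv 𝓘(ℂ, E) (extendZero (V := fun _ => ℂ) (y j).1) (x : X) ((v i).1 x) =
        if i = j then 1 else 0 := by
      have := congrArg (fun f : holFun E W => f.1 x) (h.2 i j)
      refine this.trans ?_
      split_ifs <;> rfl
    simpa [h2] using h1
  refine Submodule.eq_of_le_of_finrank_eq (Submodule.span_le.2 ?_) ?_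
  · rintro _ ⟨i, rfl⟩
    exact A.image_apply_mem_range (v i) x
  · rw [finrank_span_eq_card hli, h.1, Fintype.card_fin]

theorem IsFrame.eq_sum {r : ℕ} {W : Opens X} {y : Fin r → holFun E W} {v : Fin r → A.image W}
    (h : A.IsFrame y v) (w : A.image W) : w = ∑ i, ⁅w, y i⁆ • v i := by
  refine Subtype.ext (funext fun x => ?_)
  rw [coe_sum_smul]
  have h1 := A.image_apply_mem_range w x
  rw [← h.span_eq x, Submodule.mem_span_range_iff_exists_fun] at h1
  obtain ⟨c, hc⟩ := h1
  rw [← hc]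
  refine Finset.sum_congr rfl fun i _ => ?_
  congr 1
  change _ = mvfderiv 𝓘(ℂ, E) (extendZero (V := fun _ => ℂ) (y i).1) (x : X) (w.1 x)
  have h2 (j) : mvfderiv 𝓘(ℂ, E) (extendZero (V := fun _ => ℂ) (y i).1) (x : X) ((v j).1 x) =
      if j = i then 1 else 0 := by
    have := congrArg (fun f : holFun E W => f.1 x) (h.2 j i)
    refine this.trans ?_
    split_ifs <;> rfl
  rw [← hc]
  simp [h2]

theorem IsFrame.lie_eq_zero {r : ℕ} {W : Opens X} {y : Fin r → holFun E W} {v : Fin r → A.image W}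
    (h : A.IsFrame y v) (i j : Fin r) : ⁅v i, v j⁆ = 0 := by
  rw [h.eq_sum ⁅v i, v j⁆]
  refine Finset.sum_eq_zero fun l _ => ?_
  have h1 (i j l : Fin r) : ⁅v i, ⁅v j, y l⁆⁆ = 0 := by
    rw [h.2]
    split_ifs
    · exact Subtype.ext (dirDeriv_const (v i).1 1)
    · exact lie_zero _
  rw [lie_lie_fun, h1, h1, sub_zero, zero_smul]

/-- The basis given by a frame. -/
noncomputable def IsFrame.basis {r : ℕ} {W : Opens X} {y : Fin r → holFun E W} {v : Fin r → A.image W}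
    (h : A.IsFrame y v) : Module.Basis (Fin r) (holFun E W) (A.image W) :=
  Module.Basis.mk (v := v)
    (Fintype.linearIndependent_iff.2 fun c hc j => by rw [← h.sum_smul_lie c j, hc, zero_lie_fun])
    fun w _ => (Submodule.mem_span_range_iff_exists_fun _).2 ⟨_, (h.eq_sum w).symm⟩

theorem IsFrame.basis_apply {r : ℕ} {W : Opens X} {y : Fin r → holFun E W} {v : Fin r → A.image W}
    (h : A.IsFrame y v) (i : Fin r) : h.basis i = v i := Module.Basis.mk_apply _ _ i

variable (A)

/-- Functions whose differentials at a point separate the image of the anchor are coordinates for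
a local frame. -/
theorem exists_isFrame [FiniteDimensional ℂ F] [ContMDiffVectorBundle ω F V 𝓘(ℂ, E)] {r : ℕ}
    (hr : ∀ x, Module.finrank ℂ (LinearMap.range (A.anchor x)) = r) {U : Opens X}
    (y : Fin r → holFun E U) (x₀ : U)
    (hy : ∀ w ∈ LinearMap.range (A.anchor x₀),
      (∀ j, mvfderiv 𝓘(ℂ, E) (extendZero (V := fun _ => ℂ) (y j).1) (x₀ : X) w = 0) → w = 0) :
    ∃ (W : Opens X) (hW : W ≤ U) (v : Fin r → A.image W), (x₀ : X) ∈ W ∧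
      A.IsFrame (fun i => resFun hW (y i)) v := by
  obtain ⟨W₁, n, w₁, hx₁, hspan₁⟩ := A.exists_span_eq_range (x₀ : X)
  let W := W₁ ⊓ U
  have hWU : W ≤ U := inf_le_right
  let x : W := ⟨x₀, hx₁, x₀.2⟩
  let w : Fin n → A.image W := fun j => A.resImage inf_le_left (w₁ j)
  let L : TangentSpace 𝓘(ℂ, E) (x₀ : X) →ₗ[ℂ] (Fin r → ℂ) := LinearMap.pi fun j =>
    (mvfderiv 𝓘(ℂ, E) (extendZero (V := fun _ => ℂ) (y j).1) (x₀ : X)).toLinearMap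
  let L' : LinearMap.range (A.anchor x₀) →ₗ[ℂ] (Fin r → ℂ) := L ∘ₗ Submodule.subtype _
  have hinj : Function.Injective L' := by
    rw [injective_iff_map_eq_zero]
    exact fun w hw => Subtype.ext (hy w.1 w.2 fun j => congrFun hw j)
  have hsurj : Function.Surjective L' :=
    (LinearMap.injective_iff_surjective_of_finrank_eq_finrank (by simp [hr])).1 hinj
  have hex (i : Fin r) : ∃ c : Fin n → ℂ, L (∑ j, c j • (w j).1 x) = Pi.single i 1 := by
    obtain ⟨a, ha⟩ := hsurj (Pi.single i 1)
    have h1 : a.1 ∈ Submodule.span ℂ (Set.range fun j => (w₁ j).1 ⟨x₀, hx₁⟩) := by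
      rw [hspan₁]; exact a.2
    obtain ⟨c, hc⟩ := (Submodule.mem_span_range_iff_exists_fun _).1 h1
    refine ⟨c, ?_⟩
    rw [← ha]
    exact congrArg L hc
  choose c hc using hex
  let z : Fin r → A.image W := fun i => ∑ j, algebraMap ℂ (holFun E W) (c i j) • w j
  let N : Matrix (Fin r) (Fin r) (holFun E W) := fun i j => ⁅z i, resFun hWU (y j)⁆
  have hN : ∀ i j, (N i j).1 x = (1 : Matrix (Fin r) (Fin r) ℂ) i j := by
    intro i j
    have h1 : (z i).1 x = ∑ l, c i l • (w l).1 x := by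
      rw [coe_sum_smul]
      rfl
    have h2 := congrFun (hc i) j
    have h3 : (N i j).1 x = mvfderiv 𝓘(ℂ, E) (extendZero (V := fun _ => ℂ) (y j).1) (x₀ : X) ((z i).1 x) :=
      mvfderiv_congr (extendZero_restrict_eventuallyEq (V := fun _ => ℂ) hWU (y j).1 x.2) _
    rw [h3, h1]
    refine h2.trans ?_
    rw [Matrix.one_apply, Pi.single_apply]
    simp only [eq_comm]
  let ev : holFun E W →+* ℂ :=
    { toFun := fun f => f.1 x, map_one' := rfl, map_mul' := fun _ _ => rfl, map_zero' := rfl,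
      map_add' := fun _ _ => rfl }
  have hdet : N.det.1 x = 1 := by
    change ev N.det = 1
    rw [RingHom.map_det]
    have : ev.mapMatrix N = 1 := by
      ext i j
      exact hN i j
    rw [this, Matrix.det_one]
  let O : Opens X := ⟨{p | ∃ h : p ∈ W, N.det.1 ⟨p, h⟩ ≠ 0}, by
    have h1 : ContinuousOn (extendZero (V := fun _ => ℂ) N.det.1) W := ContMDiffOn.continuousOn N.det.2
    have h2 := h1.isOpen_inter_preimage W.isOpen isOpen_compl_singleton (t := {(0 : ℂ)}ᶜ)
    convert h2 using 1
    ext p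
    constructor
    · rintro ⟨h, hp⟩
      refine ⟨h, ?_⟩
      rw [mem_preimage, extendZero_of_mem _ h]
      exact hp
    · rintro ⟨h, hp⟩
      rw [mem_preimage, extendZero_of_mem _ h] at hp
      exact ⟨h, hp⟩⟩
  have hOW : O ≤ W := fun p hp => hp.1
  let N' : Matrix (Fin r) (Fin r) (holFun E O) := fun i j => resFun hOW (N i j)
  let res : holFun E W →+* holFun E O :=
    { toFun := resFun hOW, map_one' := rfl, map_mul' := fun _ _ => rfl, map_zero' := rfl,
      map_add' := fun _ _ => rfl }
  have hN' : IsUnit N'.det := by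
    have h1 : N' = res.mapMatrix N := rfl
    rw [h1, ← RingHom.map_det]
    exact holFun_isUnit _ fun p => p.2.2
  refine ⟨O, hOW.trans hWU, fun i => ∑ j, N'⁻¹ i j • A.resImage hOW (z j), ⟨x.2, ?_⟩, fun p => hr p,
    fun i j => ?_⟩
  · change N.det.1 x ≠ 0
    rw [hdet]
    exact one_ne_zero
  · rw [sum_smul_lie]
    have h1 (l) : ⁅A.resImage hOW (z l), resFun (hOW.trans hWU) (y j)⁆ = N' l j :=
      (A.resFun_lie hOW (z l) (resFun hWU (y j))).symm
    simp only [h1]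
    rw [← Matrix.mul_apply, Matrix.nonsing_inv_mul _ hN', Matrix.one_apply]

end HolomorphicLieAlgebroid
end
end HolGeom

namespace HolGeom
open Set

section
variable {X : Type u} [TopologicalSpace X] {E : Type u} [NormedAddCommGroup E] [NormedSpace ℂ E]
  [ChartedSpace E X] {G G' : Type*} [NormedAddCommGroup G] [NormedSpace ℂ G]
  [NormedAddCommGroup G'] [NormedSpace ℂ G']

theorem mvfderiv_comp_fderiv {g : G → G'} {f : X → G} {x : X} (hg : DifferentiableAt ℂ g (f x))
    (hf : MDifferentiableAt 𝓘(ℂ, E) 𝓘(ℂ, G) f x) (w : TangentSpace 𝓘(ℂ, E) x) :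
    mvfderiv 𝓘(ℂ, E) (fun y => g (f y)) x w = fderiv ℂ g (f x) (mvfderiv 𝓘(ℂ, E) f x w) := by
  have h := mfderiv_comp x hg.mdifferentiableAt hf
  rw [mfderiv_eq_fderiv] at h
  exact DFunLike.congr_fun h w

variable (E) in
/-- Holomorphic charts with values in a normed space. -/
def IsHolChart (φ : OpenPartialHomeomorph X G) : Prop :=
  ContMDiffOn 𝓘(ℂ, E) 𝓘(ℂ, G) ω φ φ.source ∧ ContMDiffOn 𝓘(ℂ, G) 𝓘(ℂ, E) ω φ.symm φ.target

namespace IsHolChart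
variable {φ : OpenPartialHomeomorph X G}

theorem contMDiffAt (h : IsHolChart E φ) {x : X} (hx : x ∈ φ.source) :
    ContMDiffAt 𝓘(ℂ, E) 𝓘(ℂ, G) ω φ x := h.1.contMDiffAt (φ.open_source.mem_nhds hx)

theorem mdifferentiableAt (h : IsHolChart E φ) {x : X} (hx : x ∈ φ.source) :
    MDifferentiableAt 𝓘(ℂ, E) 𝓘(ℂ, G) φ x := (h.contMDiffAt hx).mdifferentiableAt (by simp)

theorem contMDiffAt_symm (h : IsHolChart E φ) {z : G} (hz : z ∈ φ.target) :
    ContMDiffAt 𝓘(ℂ, G) 𝓘(ℂ, E) ω φ.symm z := h.2.contMDiffAt (φ.open_target.mem_nhds hz)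

theorem contDiffAt_comp_symm (h : IsHolChart E φ) {f : X → G'} {z : G} (hz : z ∈ φ.target)
    (hf : ContMDiffAt 𝓘(ℂ, E) 𝓘(ℂ, G') ω f (φ.symm z)) : ContDiffAt ℂ ω (fun z => f (φ.symm z)) z :=
  contMDiffAt_iff_contDiffAt.1 (ContMDiffAt.comp z hf (h.contMDiffAt_symm hz))

theorem mvfderiv_eq (h : IsHolChart E φ) {f : X → G'} {x : X} (hx : x ∈ φ.source)
    (hf : ContMDiffAt 𝓘(ℂ, E) 𝓘(ℂ, G') ω f x) (w : TangentSpace 𝓘(ℂ, E) x) :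
    mvfderiv 𝓘(ℂ, E) f x w = fderiv ℂ (fun z => f (φ.symm z)) (φ x) (mvfderiv 𝓘(ℂ, E) φ x w) := by
  have h1 : DifferentiableAt ℂ (fun z => f (φ.symm z)) (φ x) :=
    (h.contDiffAt_comp_symm (φ.map_source hx) (by rwa [φ.left_inv hx])).differentiableAt (by simp)
  rw [← mvfderiv_comp_fderiv h1 (h.mdifferentiableAt hx)]
  have h2 : f =ᶠ[𝓝 x] fun y => f (φ.symm (φ y)) := by
    filter_upwards [φ.open_source.mem_nhds hx] with y hy
    rw [φ.left_inv hy]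
  simp only [mvfderiv, h2.mfderiv_eq, ContinuousLinearMap.comp_apply]
  rfl

theorem bijective_mvfderiv (h : IsHolChart E φ) {x : X} (hx : x ∈ φ.source) :
    Function.Bijective (mvfderiv 𝓘(ℂ, E) φ x) := by
  have h1 := (h.contMDiffAt_symm (φ.map_source hx)).mdifferentiableAt (by simp)
  have h2 := h.mdifferentiableAt hx
  have h2' : MDifferentiableAt 𝓘(ℂ, E) 𝓘(ℂ, G) φ (φ.symm (φ x)) := by rwa [φ.left_inv hx]
  constructor
  · have h3 := mfderiv_comp x h1 h2
    have h4 : φ.symm ∘ φ =ᶠ[𝓝 x] id := by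
      filter_upwards [φ.open_source.mem_nhds hx] with y hy
      exact φ.left_inv hy
    rw [h4.mfderiv_eq, mfderiv_id] at h3
    intro v w hvw
    have h5 := DFunLike.congr_fun h3 v
    have h6 := DFunLike.congr_fun h3 w
    refine h5.trans (Eq.trans ?_ h6.symm)
    exact congrArg (mfderiv 𝓘(ℂ, G) 𝓘(ℂ, E) φ.symm (φ x)) hvw
  · have h3 := mfderiv_comp_of_eq h2 h1 (φ.left_inv hx)
    have h4 : φ ∘ φ.symm =ᶠ[𝓝 (φ x)] id := by
      filter_upwards [φ.open_target.mem_nhds (φ.map_source hx)] with y hy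
      exact φ.right_inv hy
    rw [h4.mfderiv_eq, mfderiv_id] at h3
    intro w
    have h5 (y : X) (hy : y = x) (u : E) : (show G from mfderiv 𝓘(ℂ, E) 𝓘(ℂ, G) φ y u) =
        mfderiv 𝓘(ℂ, E) 𝓘(ℂ, G) φ x u := by subst hy; rfl
    refine ⟨mfderiv 𝓘(ℂ, G) 𝓘(ℂ, E) φ.symm (φ x) w, ?_⟩
    exact (h5 _ (φ.left_inv hx) _).symm.trans (DFunLike.congr_fun h3 w).symm

/-- The pull-back of a function by a chart. -/
theorem comp_mem_holFun (h : IsHolChart E φ) {g : G → ℂ} {W : Opens X} (hW : (W : Set X) ⊆ φ.source)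
    (hg : ∀ x ∈ W, ContDiffAt ℂ ω g (φ x)) : (fun x : W => g (φ x)) ∈ holFun E W := by
  intro x hx
  have h1 : ContMDiffAt 𝓘(ℂ, E) 𝓘(ℂ, ℂ) ω (fun x => g (φ x)) x :=
    ContMDiffAt.comp x (contMDiffAt_iff_contDiffAt.2 (hg x hx)) (h.contMDiffAt (hW hx))
  refine ContMDiffAt.contMDiffWithinAt (h1.congr_of_eventuallyEq ?_)
  filter_upwards [W.isOpen.mem_nhds hx] with y hy
  rw [extendZero_of_mem _ hy]

theorem transHomeomorph_contDiff (h : IsHolChart E φ) {e : G ≃ₜ G'} (he : ContDiff ℂ ω e)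
    (he' : ContDiff ℂ ω e.symm) : IsHolChart E (φ.transHomeomorph e) := by
  refine ⟨he.contMDiff.comp_contMDiffOn h.1, ?_⟩
  exact h.2.comp he'.contMDiff.contMDiffOn fun z hz => hz

end IsHolChart
end

section
variable {X : Type u} [TopologicalSpace X] {E : Type u} [NormedAddCommGroup E] [NormedSpace ℂ E]
  [ChartedSpace E X] [IsManifold 𝓘(ℂ, E) ω X]

theorem isHolChart_chartAt (x : X) : IsHolChart E (chartAt E x) :=
  ⟨contMDiffOn_chart, contMDiffOn_chart_symm⟩

variable {P Q : Type*} [NormedAddCommGroup P] [NormedSpace ℂ P]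
  [NormedAddCommGroup Q] [NormedSpace ℂ Q] {φ : OpenPartialHomeomorph X (P × Q)}

theorem IsHolChart.mvfderiv_snd (h : IsHolChart E φ) {x : X} (hx : x ∈ φ.source)
    (w : TangentSpace 𝓘(ℂ, E) x) :
    mvfderiv 𝓘(ℂ, E) (fun y => (φ y).2) x w = (mvfderiv 𝓘(ℂ, E) φ x w).2 := by
  have := mvfderiv_comp_fderiv (g := (Prod.snd : P × Q → Q)) differentiableAt_snd
    (h.mdifferentiableAt hx) w
  rwa [fderiv_snd] at this

/-- A function whose derivative vanishes along the slices `P × {y}` is constant on the slices of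
balls. -/
theorem eq_of_fderiv_inl_eq_zero {G : Type*} [NormedAddCommGroup G] [NormedSpace ℂ G] {f : P × Q → G}
    {z₀ : P × Q} {ε : ℝ}
    (hf : ∀ z ∈ Metric.ball z₀ ε, DifferentiableAt ℂ f z ∧ ∀ ξ, fderiv ℂ f z (ξ, 0) = 0)
    {z z' : P × Q} (hz : z ∈ Metric.ball z₀ ε) (hz' : z' ∈ Metric.ball z₀ ε) (h : z.2 = z'.2) :
    f z = f z' := by
  have hmem {t : P} (ht : t ∈ Metric.ball z₀.1 ε) : (t, z.2) ∈ Metric.ball z₀ ε := by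
    rw [← ball_prod_same, mem_prod] at hz ⊢
    exact ⟨ht, hz.2⟩
  have hd (t : P) (ht : t ∈ Metric.ball z₀.1 ε) : HasFDerivAt (fun t => f (t, z.2)) (0 : P →L[ℂ] G) t := by
    obtain ⟨h1, h2⟩ := hf _ (hmem ht)
    have h3 := HasFDerivAt.comp (f := fun t => (t, z.2)) t h1.hasFDerivAt
      ((hasFDerivAt_id t).prodMk (hasFDerivAt_const z.2 t))
    refine h3.congr_fderiv ?_
    ext ξ
    exact h2 ξ
  have h1 := (convex_ball z₀.1 ε).isPreconnected
  have h2 := Metric.isOpen_ball.is_const_of_fderiv_eq_zero (𝕜 := ℂ) h1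
    (fun t ht => (hd t ht).differentiableAt.differentiableWithinAt) (fun t ht => (hd t ht).fderiv)
    (x := z.1) (y := z'.1) (by rw [← ball_prod_same, mem_prod] at hz; exact hz.1)
    (by rw [← ball_prod_same, mem_prod] at hz'; exact hz'.1)
  rw [show z = (z.1, z.2) from rfl, h2, h]

end
end HolGeom

section
variable {P Q : Type*} [NormedAddCommGroup P] [NormedSpace ℂ P] [CompleteSpace P]
  [NormedAddCommGroup Q] [NormedSpace ℂ Q] [CompleteSpace Q]

/-- An integrable distribution that is the graph of `B` is straightened by a change of
coordinates. -/
theorem exists_straightening {B : P × Q → P →L[ℂ] Q} (hB : ContDiffAt ℂ ω B 0)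
    (hint : ∀ᶠ w in 𝓝 0, ∀ ξ η, fderiv ℂ B w (ξ, B w ξ) η = fderiv ℂ B w (η, B w η) ξ) :
    ∃ ψ : OpenPartialHomeomorph (P × Q) (P × Q), 0 ∈ ψ.source ∧ ContDiffOn ℂ ω ψ ψ.source ∧
      ContDiffOn ℂ ω ψ.symm ψ.target ∧
      ∀ z ∈ ψ.source, ∀ ξ, fderiv ℂ ψ z (ξ, B z ξ) = (ξ, 0) := by
  obtain ⟨u, hu, hu0, hud⟩ := exists_solution_of_integrable hB hint
  let G : P × Q → P × Q := fun z => (z.1, u z)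
  have hG : ContDiffAt ℂ ω G 0 := contDiffAt_fst.prodMk hu
  have hu00 : u 0 = 0 := hu0.self_of_nhds rfl
  have hG0 : G 0 = 0 := Prod.ext rfl hu00
  have hGd : ∀ z, DifferentiableAt ℂ u z → HasFDerivAt G
      ((ContinuousLinearMap.fst ℂ P Q).prod (fderiv ℂ u z)) z := fun z hz =>
    hasFDerivAt_fst.prodMk hz.hasFDerivAt
  have hud0 := hu.differentiableAt (by simp)
  have hd2 (η : Q) : fderiv ℂ u 0 (0, η) = η := by
    have h1 : HasFDerivAt (fun y : Q => u (0, y)) ((fderiv ℂ u 0).comp (.inr ℂ P Q)) 0 :=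
      HasFDerivAt.comp (f := fun y : Q => ((0 : P), y)) (0 : Q) hud0.hasFDerivAt (hasFDerivAt_prodMk_right 0 0)
    have h2 : (fun y : Q => u (0, y)) =ᶠ[𝓝 0] id := by
      have : Filter.Tendsto (fun y : Q => ((0 : P), y)) (𝓝 0) (𝓝 0) :=
        Continuous.tendsto' (by fun_prop) _ _ rfl
      filter_upwards [this.eventually hu0] with y hy
      exact hy rfl
    exact DFunLike.congr_fun (h1.unique ((hasFDerivAt_id (0 : Q)).congr_of_eventuallyEq h2)) η
  let e : (P × Q) ≃L[ℂ] (P × Q) := ContinuousLinearEquiv.equivOfInverse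
    ((ContinuousLinearMap.fst ℂ P Q).prod (fderiv ℂ u 0))
    ((ContinuousLinearMap.fst ℂ P Q).prod (.snd ℂ P Q - (fderiv ℂ u 0).comp
      ((ContinuousLinearMap.inl ℂ P Q).comp (.fst ℂ P Q))))
    (fun z => Prod.ext rfl (by
      change fderiv ℂ u 0 z - fderiv ℂ u 0 (z.1, 0) = z.2
      rw [← map_sub, show z - (z.1, 0) = (0, z.2) by ext <;> simp, hd2]))
    (fun z => Prod.ext rfl (by
      change fderiv ℂ u 0 (z.1, z.2 - fderiv ℂ u 0 (z.1, 0)) = z.2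
      rw [show (z.1, z.2 - fderiv ℂ u 0 (z.1, 0)) =
        (z.1, 0) + (0, z.2 - fderiv ℂ u 0 (z.1, 0)) by simp, map_add, hd2]
      abel))
  have he : HasFDerivAt G (e : (P × Q) →L[ℂ] (P × Q)) 0 := hGd 0 hud0
  let ψ₁ := hG.toOpenPartialHomeomorph G he (by simp)
  have hs : (0 : P × Q) ∈ ψ₁.source := hG.mem_toOpenPartialHomeomorph_source he (by simp)
  have hsymm : ContDiffAt ℂ ω ψ₁.symm (ψ₁ 0) :=
    ψ₁.contDiffAt_symm (f₀' := e) (ψ₁.map_source hs) (by rw [ψ₁.left_inv hs]; exact he)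
      (by rw [ψ₁.left_inv hs]; exact hG)
  let ψ₂ := ψ₁.restrContDiff ℂ ω (by simp)
  obtain ⟨N, hN, hNo, h0N⟩ := eventually_nhds_iff.1 hud
  let ψ₃ := ψ₂.restrOpen N hNo
  have h3 : (0 : P × Q) ∈ ψ₃.source := ⟨⟨hs, hG, hsymm⟩, h0N⟩
  have hφ : ContDiffOn ℂ ω ψ₃ ψ₃.source := (ψ₁.contDiffOn_restrContDiff_source ℂ (n := ω) (by simp)).mono fun z hz => hz.1
  have hφ' : ContDiffOn ℂ ω ψ₃.symm ψ₃.target :=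
    (ψ₁.contDiffOn_restrContDiff_target ℂ (n := ω) (by simp)).mono fun z hz => hz.1
  refine ⟨ψ₃.symm, ?_, hφ', hφ, fun z hz ξ => ?_⟩
  · have := ψ₃.map_source h3
    rwa [show ψ₃ 0 = 0 from hG0] at this
  · obtain ⟨p, hp, rfl⟩ : ∃ p ∈ ψ₃.source, ψ₃ p = z := ⟨_, ψ₃.map_target hz, ψ₃.right_inv hz⟩
    have hup : DifferentiableAt ℂ u p := by
      have := (hφ.contDiffAt (ψ₃.open_source.mem_nhds hp)).differentiableAt (by simp)
      exact this.snd
    have h1 := (hφ'.contDiffAt (ψ₃.open_target.mem_nhds hz)).differentiableAt (by simp)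
    have h2 := HasFDerivAt.comp p h1.hasFDerivAt (hGd p hup)
    have h4 : ψ₃.symm ∘ G =ᶠ[𝓝 p] id := by
      filter_upwards [ψ₃.open_source.mem_nhds hp] with y hy
      exact ψ₃.left_inv hy
    have h5 := DFunLike.congr_fun (h2.unique ((hasFDerivAt_id p).congr_of_eventuallyEq h4)) (ξ, 0)
    have h6 : fderiv ℂ u p (ξ, 0) = B (ψ₃ p) ξ := hN p hp.2 ξ
    rw [← h6]
    exact h5
end

namespace HolGeom
open Set

section
variable {X : Type u} [TopologicalSpace X] {E : Type u} [NormedAddCommGroup E] [NormedSpace ℂ E]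
  [ChartedSpace E X]

theorem IsHolChart.trans {G G' : Type*} [NormedAddCommGroup G] [NormedSpace ℂ G]
    [NormedAddCommGroup G'] [NormedSpace ℂ G'] {φ : OpenPartialHomeomorph X G}
    (h : IsHolChart E φ) {ψ : OpenPartialHomeomorph G G'} (hψ : ContDiffOn ℂ ω ψ ψ.source)
    (hψ' : ContDiffOn ℂ ω ψ.symm ψ.target) : IsHolChart E (φ.trans ψ) :=
  ⟨hψ.contMDiffOn.comp (h.1.mono fun _ hx => hx.1) fun _ hx => hx.2,
    h.2.comp (hψ'.contMDiffOn.mono fun _ hz => hz.1) fun _ hz => hz.2⟩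

theorem IsHolChart.restrOpen {G : Type*} [NormedAddCommGroup G] [NormedSpace ℂ G]
    {φ : OpenPartialHomeomorph X G} (h : IsHolChart E φ) {W : Set X} (hW : IsOpen W) :
    IsHolChart E (φ.restrOpen W hW) :=
  ⟨h.1.mono fun _ hx => hx.1, h.2.mono fun _ hz => hz.1⟩

variable [IsManifold 𝓘(ℂ, E) ω X] [FiniteDimensional ℂ E]

theorem exists_isHolChart_adapted {r q : ℕ} (hq : Module.finrank ℂ E = r + q) (x₀ : X)
    (S : Submodule ℂ (TangentSpace 𝓘(ℂ, E) x₀)) (hS : Module.finrank ℂ S = r) :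
    ∃ c : OpenPartialHomeomorph X ((Fin r → ℂ) × (Fin q → ℂ)), IsHolChart E c ∧ x₀ ∈ c.source ∧
      c x₀ = 0 ∧ ∀ w ∈ S, (mvfderiv 𝓘(ℂ, E) c x₀ w).1 = 0 → w = 0 := by
  let φ := chartAt E x₀
  have hφ : IsHolChart E φ := isHolChart_chartAt x₀
  have hx : x₀ ∈ φ.source := mem_chart_source E x₀
  let D := mvfderiv 𝓘(ℂ, E) φ x₀
  have hD : Function.Injective D := (hφ.bijective_mvfderiv hx).1
  let K : Submodule ℂ E := S.map D.toLinearMap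
  have hK : Module.finrank ℂ K = r := by
    rw [← hS]
    exact (Submodule.equivMapOfInjective D.toLinearMap hD S).finrank_eq.symm
  obtain ⟨K', hKK'⟩ := K.exists_isCompl
  have hK' : Module.finrank ℂ K' = q := by
    have := Submodule.finrank_add_eq_of_isCompl hKK'
    omega
  let l : E ≃ₗ[ℂ] (Fin r → ℂ) × (Fin q → ℂ) := (Submodule.prodEquivOfIsCompl K K' hKK').symm ≪≫ₗ
    (LinearEquiv.ofFinrankEq K (Fin r → ℂ) (by simp [hK])).prodCongr
      (LinearEquiv.ofFinrankEq K' (Fin q → ℂ) (by simp [hK']))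
  have hl (w : E) (hw : w ∈ K) (h : (l w).1 = 0) : w = 0 := by
    have h1 : (l w).2 = 0 := by
      simp [l, Submodule.prodEquivOfIsCompl_symm_apply_left K K' hKK' ⟨w, hw⟩]
    exact l.map_eq_zero_iff.1 (Prod.ext h h1)
  let L : E ≃L[ℂ] (Fin r → ℂ) × (Fin q → ℂ) := l.toContinuousLinearEquiv
  let e : E ≃ₜ (Fin r → ℂ) × (Fin q → ℂ) := (Homeomorph.subRight (φ x₀)).trans L.toHomeomorph
  have he : ContDiff ℂ ω e := L.contDiff.comp (contDiff_id.sub contDiff_const)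
  have he' : ContDiff ℂ ω e.symm := L.symm.contDiff.add contDiff_const
  refine ⟨φ.transHomeomorph e, hφ.transHomeomorph_contDiff he he', hx, ?_, fun w hw h => ?_⟩
  · change L (φ x₀ - φ x₀) = 0
    simp
  · have h1 := mvfderiv_comp_fderiv (he.differentiable (by simp) (φ x₀)) (hφ.mdifferentiableAt hx) w
    have h2 : HasFDerivAt e (L : E →L[ℂ] _) (φ x₀) :=
      L.hasFDerivAt.comp (φ x₀) ((hasFDerivAt_id _).sub_const _)
    rw [h2.fderiv] at h1
    have h3 : D w = 0 := hl (D w) ⟨w, hw, rfl⟩ ((congrArg Prod.fst h1).symm.trans h)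
    exact hD (h3.trans (map_zero D).symm)

end
end HolGeom

namespace HolGeom
open Set

section
variable {X : Type u} [TopologicalSpace X] {E : Type u} [NormedAddCommGroup E] [NormedSpace ℂ E]
  [ChartedSpace E X] [IsManifold 𝓘(ℂ, E) ω X]
  [FiniteDimensional ℂ E] {F : Type*} [NormedAddCommGroup F] [NormedSpace ℂ F] {V : X → Type*}
  [∀ x, AddCommGroup (V x)] [∀ x, Module ℂ (V x)] [∀ x, TopologicalSpace (V x)]
  [TopologicalSpace (TotalSpace F V)] [FiberBundle F V] [VectorBundle ℂ F V]

/-- The composition of a chart with a continuous linear functional. -/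
noncomputable def IsHolChart.coord {G : Type*} [NormedAddCommGroup G] [NormedSpace ℂ G]
    {φ : OpenPartialHomeomorph X G} (h : IsHolChart E φ) {W : Opens X} (hW : (W : Set X) ⊆ φ.source)
    (l : G →L[ℂ] ℂ) : holFun E W :=
  ⟨fun x => l (φ x), h.comp_mem_holFun hW fun _ _ => l.contDiff.contDiffAt⟩

theorem IsHolChart.mvfderiv_coord {G : Type*} [NormedAddCommGroup G] [NormedSpace ℂ G]
    {φ : OpenPartialHomeomorph X G} (h : IsHolChart E φ) {W : Opens X} (hW : (W : Set X) ⊆ φ.source)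
    (l : G →L[ℂ] ℂ) (x : W) (w : TangentSpace 𝓘(ℂ, E) (x : X)) :
    mvfderiv 𝓘(ℂ, E) (extendZero (V := fun _ => ℂ) (h.coord hW l).1) (x : X) w =
      l (mvfderiv 𝓘(ℂ, E) φ x w) := by
  have h1 : extendZero (V := fun _ => ℂ) (h.coord hW l).1 =ᶠ[𝓝 (x : X)] fun y => l (φ y) := by
    filter_upwards [W.isOpen.mem_nhds x.2] with y hy
    rw [extendZero_of_mem _ hy]
    rfl
  rw [mvfderiv_congr h1, mvfderiv_comp_fderiv l.differentiableAt (h.mdifferentiableAt (hW x.2)),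
    l.fderiv]

namespace HolomorphicLieAlgebroid
variable (A : HolomorphicLieAlgebroid E F V)

/-- A foliated chart, whose plaques are tangent to the image of the anchor. -/
def IsTangentChart {r q : ℕ} (φ : OpenPartialHomeomorph X ((Fin r → ℂ) × (Fin q → ℂ))) : Prop :=
  IsHolChart E φ ∧ ∀ x ∈ φ.source, ∀ w,
    w ∈ LinearMap.range (A.anchor x) ↔ (mvfderiv 𝓘(ℂ, E) φ x w).2 = 0

variable {A}

/-- The coefficients of the image of the anchor in coordinates. -/
theorem exists_integrable_coeff {r q : ℕ} {c : OpenPartialHomeomorph X ((Fin r → ℂ) × (Fin q → ℂ))}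
    (hc : IsHolChart E c) {W : Opens X} (hW : (W : Set X) ⊆ c.source) {v : Fin r → A.image W}
    (hv : A.IsFrame (fun i => hc.coord hW (.comp (.proj i) (.fst ℂ (Fin r → ℂ) (Fin q → ℂ)))) v) :
    ∃ B : (Fin r → ℂ) × (Fin q → ℂ) → (Fin r → ℂ) →L[ℂ] (Fin q → ℂ),
      (∀ x ∈ W, ContDiffAt ℂ ω B (c x)) ∧
      (∀ (x : W) i, mvfderiv 𝓘(ℂ, E) c (x : X) ((v i).1 x) = (Pi.single i 1, B (c x) (Pi.single i 1))) ∧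
      ∀ x ∈ W, ∀ ξ η, fderiv ℂ B (c x) (ξ, B (c x) ξ) η = fderiv ℂ B (c x) (η, B (c x) η) ξ := by
  let Y (l : Fin q) : holFun E W := hc.coord hW (.comp (.proj l) (.snd ℂ (Fin r → ℂ) (Fin q → ℂ)))
  let b (i : Fin r) (l : Fin q) : holFun E W := ⁅v i, Y l⁆
  let b' (i : Fin r) (l : Fin q) (z : (Fin r → ℂ) × (Fin q → ℂ)) : ℂ :=
    extendZero (V := fun _ => ℂ) (b i l).1 (c.symm z)
  let B (z : (Fin r → ℂ) × (Fin q → ℂ)) : (Fin r → ℂ) →L[ℂ] (Fin q → ℂ) :=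
    ∑ i, ∑ l, b' i l z • (ContinuousLinearMap.proj (R := ℂ) (φ := fun _ : Fin r => ℂ) i).smulRight
      (Pi.single l 1 : Fin q → ℂ)
  have hb' (x : X) (hx : x ∈ W) (i l) : ContDiffAt ℂ ω (b' i l) (c x) :=
    hc.contDiffAt_comp_symm (c.map_source (hW hx)) (by
      rw [c.left_inv (hW hx)]; exact contMDiffAt_extendZero (b i l).2 hx)
  have hb'x (x : W) (i l) : b' i l (c x) = (b i l).1 x := by
    simp only [b', c.left_inv (hW x.2), extendZero_of_mem _ x.2]
  have hB (z ξ l) : B z ξ l = ∑ i, ξ i * b' i l z := by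
    simp [B, Finset.sum_apply, Pi.single_apply, mul_comm]
  have hBc (x : X) (hx : x ∈ W) : ContDiffAt ℂ ω B (c x) :=
    ContDiffAt.sum fun i _ => ContDiffAt.sum fun l _ => (hb' x hx i l).smul contDiffAt_const
  have hdv (x : W) (i) : mvfderiv 𝓘(ℂ, E) c (x : X) ((v i).1 x) =
      (Pi.single i 1, B (c x) (Pi.single i 1)) := by
    refine Prod.ext (funext fun j => ?_) (funext fun l => ?_)
    · have h1 := congrArg (fun f : holFun E W => f.1 x) (hv.2 i j)
      have h2 := (hc.mvfderiv_coord hW _ x ((v i).1 x)).symm.trans h1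
      refine h2.trans ?_
      change _ = (Pi.single i 1 : Fin r → ℂ) j
      rw [Pi.single_apply]
      simp only [eq_comm (a := i)]
      split_ifs <;> rfl
    · have h2 := hc.mvfderiv_coord hW (.comp (.proj l) (.snd ℂ (Fin r → ℂ) (Fin q → ℂ))) x ((v i).1 x)
      change _ = B (c x) (Pi.single i 1) l
      rw [hB]
      simp only [hb'x, Pi.single_apply]
      simp only [ite_mul, one_mul, zero_mul, Finset.sum_ite_eq', Finset.mem_univ, if_true]
      exact h2.symm
  refine ⟨B, hBc, hdv, fun x hx ξ η => ?_⟩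
  have hs (i j l) : fderiv ℂ (b' i l) (c x) (Pi.single j 1, B (c x) (Pi.single j 1)) =
      fderiv ℂ (b' j l) (c x) (Pi.single i 1, B (c x) (Pi.single i 1)) := by
    have h1 (i j) : fderiv ℂ (b' i l) (c x) (Pi.single j 1, B (c x) (Pi.single j 1)) =
        (⁅v j, b i l⁆ : holFun E W).1 ⟨x, hx⟩ := by
      rw [← hdv ⟨x, hx⟩ j]
      exact (hc.mvfderiv_eq (hW hx) (contMDiffAt_extendZero (b i l).2 hx) _).symm
    have h2 : ⁅v j, b i l⁆ = ⁅v i, b j l⁆ := by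
      have := lie_lie_fun (v j) (v i) (Y l)
      rw [hv.lie_eq_zero, zero_lie_fun] at this
      exact sub_eq_zero.1 this.symm
    rw [h1, h1, h2]
  have hfd (w ζ l) : fderiv ℂ B (c x) w ζ l = ∑ i, ζ i * fderiv ℂ (b' i l) (c x) w := by
    let T : ((Fin r → ℂ) →L[ℂ] (Fin q → ℂ)) →L[ℂ] ℂ :=
      (ContinuousLinearMap.proj l).comp (ContinuousLinearMap.apply ℂ (Fin q → ℂ) ζ)
    have h1 : HasFDerivAt (fun z => T (B z)) (T.comp (fderiv ℂ B (c x))) (c x) :=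
      T.hasFDerivAt.comp (c x) ((hBc x hx).differentiableAt (by simp)).hasFDerivAt
    have h2 : HasFDerivAt (fun z => ∑ i, ζ i * b' i l z) (∑ i, ζ i • fderiv ℂ (b' i l) (c x)) (c x) :=
      HasFDerivAt.fun_sum fun i _ =>
        ((hb' x hx i l).differentiableAt (by simp)).hasFDerivAt.const_mul (ζ i)
    have h3 : (fun z => T (B z)) = fun z => ∑ i, ζ i * b' i l z := funext fun z => hB z ζ l
    rw [h3] at h1
    refine (DFunLike.congr_fun (h1.unique h2) w).trans ?_
    simp
  have hlin (i l) (ξ : Fin r → ℂ) : fderiv ℂ (b' i l) (c x) (ξ, B (c x) ξ) =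
      ∑ j, ξ j * fderiv ℂ (b' i l) (c x) (Pi.single j 1, B (c x) (Pi.single j 1)) := by
    let T : (Fin r → ℂ) →ₗ[ℂ] ℂ := (fderiv ℂ (b' i l) (c x)).toLinearMap ∘ₗ
      (LinearMap.id.prod (B (c x)).toLinearMap)
    refine (LinearMap.pi_apply_eq_sum_univ T ξ).trans (Finset.sum_congr rfl fun j _ => ?_)
    have : (fun j' => if j = j' then (1 : ℂ) else 0) = Pi.single j 1 := by
      funext j'; simp [Pi.single_apply, eq_comm]
    rw [this]
    rfl
  refine funext fun l => ?_
  have key (ξ η : Fin r → ℂ) : fderiv ℂ B (c x) (ξ, B (c x) ξ) η l = ∑ i, ∑ j, η i * (ξ j *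
      fderiv ℂ (b' i l) (c x) (Pi.single j 1, B (c x) (Pi.single j 1))) := by
    rw [hfd]
    refine Finset.sum_congr rfl fun i _ => ?_
    rw [hlin, Finset.mul_sum]
  rw [key, key, Finset.sum_comm]
  refine Finset.sum_congr rfl fun j _ => Finset.sum_congr rfl fun i _ => ?_
  rw [hs i j l]
  ring

/-- **Frobenius theorem** for the image of the anchor. -/
theorem exists_isTangentChart [FiniteDimensional ℂ F] [ContMDiffVectorBundle ω F V 𝓘(ℂ, E)] {r q : ℕ}
    (hr : ∀ x, Module.finrank ℂ (LinearMap.range (A.anchor x)) = r)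
    (hq : Module.finrank ℂ E = r + q) (x₀ : X) :
    ∃ φ : OpenPartialHomeomorph X ((Fin r → ℂ) × (Fin q → ℂ)), A.IsTangentChart φ ∧ x₀ ∈ φ.source := by
  obtain ⟨c, hc, hx₀, hc0, hinj⟩ := exists_isHolChart_adapted hq x₀ _ (hr x₀)
  let U : Opens X := ⟨c.source, c.open_source⟩
  have hU : (U : Set X) ⊆ c.source := subset_rfl
  obtain ⟨W, hWU, v, hxW, hv⟩ := A.exists_isFrame hr
    (fun i => hc.coord hU (.comp (.proj i) (.fst ℂ (Fin r → ℂ) (Fin q → ℂ)))) ⟨x₀, hx₀⟩ (by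
      refine fun w hw h => hinj w hw (funext fun i => ?_)
      have := h i
      rw [hc.mvfderiv_coord hU _ ⟨x₀, hx₀⟩] at this
      exact this)
  have hW : (W : Set X) ⊆ c.source := hWU
  obtain ⟨B, hB, hdv, hint⟩ := exists_integrable_coeff hc hW hv
  have hB0 := hB x₀ hxW
  rw [hc0] at hB0
  have hnear : ∀ᶠ z in 𝓝 (0 : (Fin r → ℂ) × (Fin q → ℂ)), z ∈ c.target ∧ c.symm z ∈ W := by
    have h1 : c.symm 0 = x₀ := by rw [← hc0, c.left_inv hx₀]
    have h2 : (0 : (Fin r → ℂ) × (Fin q → ℂ)) ∈ c.target := by rw [← hc0]; exact c.map_source hx₀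
    refine Filter.Eventually.and (c.open_target.mem_nhds h2)
      ((c.continuousAt_symm h2).eventually (p := fun x => x ∈ W) ?_)
    rw [h1]
    exact W.isOpen.mem_nhds hxW
  obtain ⟨ψ, h0, hψ, hψ', hψd⟩ := exists_straightening hB0 (by
    filter_upwards [hnear] with z ⟨hz, hzW⟩
    have := hint _ hzW
    rwa [c.right_inv hz] at this)
  have hφ : IsHolChart E ((c.restrOpen W W.isOpen).trans ψ) := (hc.restrOpen W.isOpen).trans hψ hψ'
  refine ⟨_, ⟨hφ, fun x hx w => ?_⟩, ⟨⟨hx₀, hxW⟩, ?_⟩⟩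
  · have hxW : x ∈ W := hx.1.2
    have hxψ : c x ∈ ψ.source := hx.2
    have hd (w) : mvfderiv 𝓘(ℂ, E) ((c.restrOpen W W.isOpen).trans ψ) x w =
        fderiv ℂ ψ (c x) (mvfderiv 𝓘(ℂ, E) c x w) :=
      mvfderiv_comp_fderiv ((hψ.contDiffAt (ψ.open_source.mem_nhds hxψ)).differentiableAt (by simp))
        (hc.mdifferentiableAt (hW hxW)) w
    have hdv' (i) : mvfderiv 𝓘(ℂ, E) ((c.restrOpen W W.isOpen).trans ψ) x ((v i).1 ⟨x, hxW⟩) =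
        (Pi.single i 1, 0) := by
      rw [hd, hdv ⟨x, hxW⟩, hψd _ hxψ]
    rw [← hv.span_eq ⟨x, hxW⟩, Submodule.mem_span_range_iff_exists_fun]
    constructor
    · rintro ⟨a, rfl⟩
      rw [map_sum, Prod.snd_sum]
      refine Finset.sum_eq_zero fun i _ => ?_
      rw [map_smul, hdv', Prod.smul_snd, smul_zero]
    · intro h
      refine ⟨(mvfderiv 𝓘(ℂ, E) ((c.restrOpen W W.isOpen).trans ψ) x w).1,
        (hφ.bijective_mvfderiv hx).1 ?_⟩
      rw [map_sum]
      simp only [map_smul, hdv']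
      refine Prod.ext (funext fun j => ?_) ?_
      · simp [Prod.fst_sum, Finset.sum_apply, Pi.single_apply]
      · rw [h]
        simp [Prod.snd_sum]
  · change c x₀ ∈ ψ.source
    rwa [hc0]

end HolomorphicLieAlgebroid
end
end HolGeom

namespace HolGeom
open Set LieRinehartCochain

section
variable {X : Type u} [TopologicalSpace X] {E : Type u} [NormedAddCommGroup E] [NormedSpace ℂ E]
  [ChartedSpace E X] [IsManifold 𝓘(ℂ, E) ω X]
  [FiniteDimensional ℂ E] {F : Type*} [NormedAddCommGroup F] [NormedSpace ℂ F] {V : X → Type*}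
  [∀ x, AddCommGroup (V x)] [∀ x, Module ℂ (V x)] [∀ x, TopologicalSpace (V x)]
  [TopologicalSpace (TotalSpace F V)] [FiberBundle F V] [VectorBundle ℂ F V]
  {A : HolomorphicLieAlgebroid E F V}

theorem IsHolChart.contMDiffAt_snd {P Q : Type*} [NormedAddCommGroup P] [NormedSpace ℂ P]
    [NormedAddCommGroup Q] [NormedSpace ℂ Q] {φ : OpenPartialHomeomorph X (P × Q)}
    (h : IsHolChart E φ) {x : X} (hx : x ∈ φ.source) :
    ContMDiffAt 𝓘(ℂ, E) 𝓘(ℂ, Q) ω (fun y => (φ y).2) x :=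
  ContMDiffAt.comp (g := (Prod.snd : P × Q → Q)) x (contMDiffAt_iff_contDiffAt.2 contDiffAt_snd)
    (h.contMDiffAt hx)

namespace HolomorphicLieAlgebroid

/-- A function whose differential vanishes on the image of the anchor is locally constant along the
plaques of a tangent chart. -/
theorem IsTangentChart.exists_nhds_eq {r q : ℕ}
    {φ : OpenPartialHomeomorph X ((Fin r → ℂ) × (Fin q → ℂ))} (h : A.IsTangentChart φ)
    {G : Type*} [NormedAddCommGroup G] [NormedSpace ℂ G] {f : X → G} {p : X} (hp : p ∈ φ.source)
    (hf : ∀ᶠ x in 𝓝 p, ContMDiffAt 𝓘(ℂ, E) 𝓘(ℂ, G) ω f x ∧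
      ∀ w ∈ LinearMap.range (A.anchor x), mvfderiv 𝓘(ℂ, E) f x w = 0) :
    ∃ N ∈ 𝓝 p, ∀ x ∈ N, ∀ y ∈ N, (φ x).2 = (φ y).2 → f x = f y := by
  have h1 : ∀ᶠ z in 𝓝 (φ p), DifferentiableAt ℂ (fun z => f (φ.symm z)) z ∧
      ∀ ξ, fderiv ℂ (fun z => f (φ.symm z)) z (ξ, 0) = 0 := by
    have h2 := φ.continuousAt_symm (φ.map_source hp)
    rw [ContinuousAt, φ.left_inv hp] at h2
    filter_upwards [φ.open_target.mem_nhds (φ.map_source hp), h2.eventually hf] with z hz ⟨h3, h4⟩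
    have h5 : φ.symm z ∈ φ.source := φ.map_target hz
    refine ⟨(h.1.contDiffAt_comp_symm hz h3).differentiableAt (by simp), fun ξ => ?_⟩
    obtain ⟨w, hw⟩ := (h.1.bijective_mvfderiv h5).2 (ξ, 0)
    have h6 := h.1.mvfderiv_eq h5 h3 w
    rw [hw, φ.right_inv hz] at h6
    rw [← h6]
    exact h4 w ((h.2 _ h5 w).2 (by rw [hw]))
  obtain ⟨ε, hε, hball⟩ := Metric.eventually_nhds_iff_ball.1 h1
  refine ⟨φ.source ∩ φ ⁻¹' Metric.ball (φ p) ε, Filter.inter_mem (φ.open_source.mem_nhds hp)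
    (φ.continuousAt hp (Metric.ball_mem_nhds _ hε)), fun x hx y hy hxy => ?_⟩
  have := eq_of_fderiv_inl_eq_zero hball hx.2 hy.2 hxy
  simpa only [φ.left_inv hx.1, φ.left_inv hy.1] using this

theorem IsTangentChart.range_eq_ker {r q : ℕ}
    {φ : OpenPartialHomeomorph X ((Fin r → ℂ) × (Fin q → ℂ))} (h : A.IsTangentChart φ) {x : X}
    (hx : x ∈ φ.source) : LinearMap.range (A.anchor x) =
      (mfderiv 𝓘(ℂ, E) 𝓘(ℂ, Fin q → ℂ) (fun y => (φ y).2) x).ker := by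
  ext w
  rw [h.2 x hx w, ← h.1.mvfderiv_snd hx]
  rfl

variable (A) in
/-- A regular Lie algebroid induces a foliation. -/
theorem exists_foliation [FiniteDimensional ℂ F] [ContMDiffVectorBundle ω F V 𝓘(ℂ, E)]
    (hA : A.IsRegular) : ∃ ℱ : HolomorphicFoliation X E, ℱ.IsTangentTo A := by
  obtain ⟨r, hr⟩ := hA
  let q := Module.finrank ℂ E - r
  refine ⟨{
    m := r
    q := q
    atlas := {φ | A.IsTangentChart φ}
    holomorphic := fun φ hφ => hφ.1.1
    holomorphic_symm := fun φ hφ => hφ.1.2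
    cover := fun x => ?_
    compatible := fun φ hφ ψ hψ p hp => ?_ }, fun φ hφ x hx => hφ.range_eq_ker hx⟩
  · refine A.exists_isTangentChart hr ?_ x
    have h1 : Module.finrank ℂ (LinearMap.range (A.anchor x)) ≤ Module.finrank ℂ E :=
      (LinearMap.range (A.anchor x)).finrank_le
    rw [hr] at h1
    omega
  · have hψ' : A.IsTangentChart ψ := hψ
    refine IsTangentChart.exists_nhds_eq hφ (f := fun x => (ψ x).2) hp.1 ?_
    filter_upwards [ψ.open_source.mem_nhds hp.2] with x hx
    have h1 := hψ'.1.contMDiffAt_snd hx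
    refine ⟨h1, fun w hw => ?_⟩
    rw [hψ'.1.mvfderiv_snd hx]
    exact (hψ'.2 x hx w).1 hw

end HolomorphicLieAlgebroid

namespace HolomorphicFoliation
variable {ℱ : HolomorphicFoliation X E}

theorem IsTangentTo.isTangentChart (h : ℱ.IsTangentTo A) {φ} (hφ : φ ∈ ℱ.atlas) :
    A.IsTangentChart φ := by
  have h1 : IsHolChart E φ := ⟨ℱ.holomorphic φ hφ, ℱ.holomorphic_symm φ hφ⟩
  refine ⟨h1, fun x hx w => ?_⟩
  rw [h φ hφ x hx, ← h1.mvfderiv_snd hx]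
  rfl

variable (ℱ) in
/-- The plaques are parametrized continuously for the leaf topology. -/
theorem tendsto_plaque {φ} (hφ : φ ∈ ℱ.atlas) {t : Fin ℱ.m → ℂ} {c : Fin ℱ.q → ℂ}
    (ht : (t, c) ∈ φ.target) :
    Filter.Tendsto (fun s => φ.symm (s, c)) (𝓝 t) (@nhds X ℱ.leafTopology (φ.symm (t, c))) := by
  refine TopologicalSpace.tendsto_nhds_generateFrom_iff.2 ?_
  rintro _ ⟨ψ, hψ, W, hW, d, rfl⟩ ⟨h1, h2, h3⟩
  have h4 : Filter.Tendsto (fun s => (s, c)) (𝓝 t) (𝓝 (t, c)) := Continuous.tendsto (by fun_prop) t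
  have h5 : Filter.Tendsto (fun s => φ.symm (s, c)) (𝓝 t) (𝓝 (φ.symm (t, c))) :=
    (φ.continuousAt_symm ht).tendsto.comp h4
  obtain ⟨N, hN, hNe⟩ := ℱ.compatible φ hφ ψ hψ _ ⟨φ.map_target ht, h1⟩
  filter_upwards [h4 (φ.open_target.mem_nhds ht), h5 hN, h5 (ψ.open_source.mem_nhds h1),
    h5 (ψ.continuousAt h1 (hW.mem_nhds h2))] with s hs hsN hsψ hsW
  refine ⟨hsψ, hsW, ?_⟩
  rw [← h3]
  refine hNe _ hsN _ (mem_of_mem_nhds hN) ?_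
  rw [φ.right_inv hs, φ.right_inv ht]

theorem eventually_mem_leaf {φ} (hφ : φ ∈ ℱ.atlas) {x : X} (hx : x ∈ φ.source) :
    ∀ᶠ t in 𝓝 (φ x).1, φ.symm (t, (φ x).2) ∈ ℱ.leaf x := by
  obtain ⟨ε, hε, hball⟩ := Metric.mem_nhds_iff.1 (φ.open_target.mem_nhds (φ.map_source hx))
  have hmem {t} (ht : t ∈ Metric.ball (φ x).1 ε) : (t, (φ x).2) ∈ φ.target := by
    refine hball ?_
    rw [← ball_prod_same]
    exact ⟨ht, Metric.mem_ball_self hε⟩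
  filter_upwards [Metric.ball_mem_nhds (φ x).1 hε] with t ht
  have h1 : @IsPreconnected X ℱ.leafTopology
      ((fun s => φ.symm (s, (φ x).2)) '' Metric.ball (φ x).1 ε) :=
    @IsPreconnected.image _ X _ ℱ.leafTopology _ (convex_ball (φ x).1 ε).isPreconnected _ fun s hs =>
      (ℱ.tendsto_plaque hφ (hmem hs)).mono_left nhdsWithin_le_nhds
  refine @IsPreconnected.subset_connectedComponent X ℱ.leafTopology _ _ h1
    ⟨_, Metric.mem_ball_self hε, ?_⟩ _ ⟨t, ht, rfl⟩
  exact φ.left_inv hx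

theorem IsTangentTo.mem_leafFun_iff (h : ℱ.IsTangentTo A) {U : Opens X} (f : holFun E U) :
    f ∈ ℱ.leafFun U ↔ ∀ x : U, ∀ w ∈ LinearMap.range (A.anchor x),
      mvfderiv 𝓘(ℂ, E) (extendZero (V := fun _ => ℂ) f.1) (x : X) w = 0 := by
  constructor
  · intro hf x w hw
    obtain ⟨φ, hφ, hx⟩ := ℱ.cover x
    have hφt := h.isTangentChart hφ
    obtain ⟨N, hN, hNf⟩ := hf x
    have hc := contMDiffAt_extendZero f.2 x.2
    rw [hφt.1.mvfderiv_eq hx hc w]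
    have h2 := (hφt.2 x hx w).1 hw
    generalize mvfderiv 𝓘(ℂ, E) φ (x : X) w = w' at h2
    obtain ⟨ξ, η⟩ := w'
    obtain rfl : η = 0 := h2
    have hd := ((hφt.1.contDiffAt_comp_symm (φ.map_source hx)
      (by rwa [φ.left_inv hx])).differentiableAt (by simp)).hasFDerivAt
    have hd' := HasFDerivAt.comp (f := fun s => (s, (φ x).2)) (φ x).1 hd
      (hasFDerivAt_prodMk_left (φ x).1 (φ x).2)
    have hev : (fun s => extendZero (V := fun _ => ℂ) f.1 (φ.symm (s, (φ x).2))) =ᶠ[𝓝 (φ x).1]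
        fun _ => f.1 x := by
      have h3 := ℱ.tendsto_plaque hφ (t := (φ x).1) (c := (φ x).2) (φ.map_source hx)
      rw [show φ.symm ((φ x).1, (φ x).2) = x from φ.left_inv hx] at h3
      have h5 : ∀ᶠ s in 𝓝 (φ x).1, φ.symm (s, (φ x).2) ∈ U :=
        h3 (ℱ.mem_nhds_leaf (U.isOpen.mem_nhds x.2))
      filter_upwards [h3 hN, h5, eventually_mem_leaf hφ hx] with s hsN hsU hsl
      rw [extendZero_of_mem _ hsU]
      exact hNf ⟨_, hsU⟩ hsN hsl
    exact DFunLike.congr_fun (hd'.unique ((hasFDerivAt_const _ _).congr_of_eventuallyEq hev)) ξ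
  · intro hf x
    obtain ⟨φ, hφ, hx⟩ := ℱ.cover x
    obtain ⟨N, hN, hNf⟩ := (h.isTangentChart hφ).exists_nhds_eq
      (f := extendZero (V := fun _ => ℂ) f.1) hx (by
        filter_upwards [U.isOpen.mem_nhds x.2] with y hy
        exact ⟨contMDiffAt_extendZero f.2 hy, hf ⟨y, hy⟩⟩)
    have hP : φ.source ∩ φ ⁻¹' (φ.target ∩ φ.symm ⁻¹' interior N) ∩ {y | (φ y).2 = (φ x).2} ∈
        @nhds X ℱ.leafTopology (x : X) := by
      refine @IsOpen.mem_nhds X ℱ.leafTopology (x : X) _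
        (TopologicalSpace.isOpen_generateFrom_of_mem ⟨φ, hφ, φ.target ∩ φ.symm ⁻¹' interior N,
          φ.isOpen_inter_preimage_symm isOpen_interior, (φ x).2, ?_⟩)
        ⟨⟨hx, φ.map_source hx, ?_⟩, rfl⟩
      · ext y
        exact and_assoc
      · rw [mem_preimage, φ.left_inv hx]
        exact mem_interior_iff_mem_nhds.2 hN
    refine ⟨_, hP, fun y hy _ => ?_⟩
    have h1 : (y : X) ∈ N := by
      have := hy.1.2.2
      rw [mem_preimage, φ.left_inv hy.1.1] at this
      exact interior_subset this
    have h2 := hNf y h1 x (mem_of_mem_nhds hN) hy.2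
    rwa [extendZero_of_mem _ y.2, extendZero_of_mem _ x.2] at h2

end HolomorphicFoliation

namespace HolomorphicLieAlgebroid

variable (A) in
theorem dForm_zeroForm_apply {U : Opens X} (f : holFun E U) (W : {W : Opens X // W ≤ U})
    (v : Fin 1 → A.image W.1) :
    (A.dForm 0 U (A.zeroForm U f)).1 W v = ⁅v 0, resFun W.2 f⁆ := by
  change formula (AlternatingMap.constOfIsEmpty (holFun E W.1) (A.image W.1) (Fin 0) (resFun W.2 f)) v = _
  simp [formula]

end HolomorphicLieAlgebroid

/-- The kernel of the differential on functions. -/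
theorem HolomorphicFoliation.IsTangentTo.dForm_zeroForm_eq_zero_iff [FiniteDimensional ℂ F]
    [ContMDiffVectorBundle ω F V 𝓘(ℂ, E)] {ℱ : HolomorphicFoliation X E} (h : ℱ.IsTangentTo A)
    {U : Opens X} (f : holFun E U) : A.dForm 0 U (A.zeroForm U f) = 0 ↔ f ∈ ℱ.leafFun U := by
  rw [h.mem_leafFun_iff]
  have hres {W : Opens X} (hW : W ≤ U) (v : A.image W) (x : W) : (⁅v, resFun hW f⁆ : holFun E W).1 x =
      mvfderiv 𝓘(ℂ, E) (extendZero (V := fun _ => ℂ) f.1) (x : X) (v.1 x) :=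
    mvfderiv_congr (extendZero_restrict_eventuallyEq (V := fun _ => ℂ) hW f.1 x.2) _
  constructor
  · intro hf x w hw
    obtain ⟨W, n, v, hxW, hv⟩ := A.exists_span_eq_range (x : X)
    rw [← hv ⟨x, hxW⟩] at hw
    refine Submodule.span_induction (p := fun w _ => mvfderiv 𝓘(ℂ, E)
      (extendZero (V := fun _ => ℂ) f.1) (x : X) w = 0) ?_ (map_zero _)
      (fun w w' _ _ h h' => by rw [map_add, h, h', add_zero])
      (fun c w _ h => by rw [map_smul, h, smul_zero]) hw
    rintro _ ⟨j, rfl⟩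
    have h1 := A.dForm_zeroForm_apply f ⟨W ⊓ U, inf_le_right⟩ fun _ => A.resImage inf_le_left (v j)
    rw [hf] at h1
    have h2 := congrArg (fun g : holFun E (W ⊓ U) => g.1 ⟨x, hxW, x.2⟩) h1
    exact (h2.trans (hres _ _ _)).symm
  · intro hf
    refine Subtype.ext (funext fun W => AlternatingMap.ext fun v => ?_)
    refine (A.dForm_zeroForm_apply f W v).trans (Subtype.ext (funext fun x => ?_))
    exact (hres W.2 (v 0) x).trans (hf ⟨x, W.2 x.2⟩ _ (A.image_apply_mem_range (v 0) x))

end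
end HolGeom

namespace HolGeom
open Set LieRinehartCochain

section
variable {X : Type u} [TopologicalSpace X] {E : Type u} [NormedAddCommGroup E] [NormedSpace ℂ E]
  [ChartedSpace E X] [IsManifold 𝓘(ℂ, E) ω X]
  [FiniteDimensional ℂ E] {F : Type*} [NormedAddCommGroup F] [NormedSpace ℂ F] {V : X → Type*}
  [∀ x, AddCommGroup (V x)] [∀ x, Module ℂ (V x)] [∀ x, TopologicalSpace (V x)]
  [TopologicalSpace (TotalSpace F V)] [FiberBundle F V] [VectorBundle ℂ F V]
  {A : HolomorphicLieAlgebroid E F V}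

namespace HolomorphicLieAlgebroid

section
variable {r : ℕ} {W : Opens X} {y : Fin r → holFun E W} {v : Fin r → A.image W}

theorem IsFrame.apply_eq_sum (h : A.IsFrame y v) {k : ℕ} (ξ : Cochain (holFun E W) (A.image W) k)
    (w : Fin k → A.image W) :
    ξ w = ∑ J : Fin k → Fin r, (∏ j, ⁅w j, y (J j)⁆) * ξ fun j => v (J j) := by
  have h1 : w = fun j => ∑ i, ⁅w j, y i⁆ • v i := funext fun j => h.eq_sum (w j)
  conv_lhs => rw [h1]
  refine (ξ.toMultilinearMap.map_sum _).trans (Finset.sum_congr rfl fun J _ => ?_)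
  exact ξ.toMultilinearMap.map_smul_univ _ _

theorem resFun_prod {W W' : Opens X} (h : W' ≤ W) {ι : Type*} (s : Finset ι) (f : ι → holFun E W) :
    resFun h (∏ i ∈ s, f i) = ∏ i ∈ s, resFun h (f i) :=
  map_prod ({ toFun := resFun h, map_one' := rfl, map_mul' := resFun_mul h } :
    holFun E W →* holFun E W') f s

/-- Compatibility of cochains with restriction can be checked on a frame. -/
theorem IsFrame.resFun_apply (h : A.IsFrame y v) {W' : Opens X} (hW : W' ≤ W) {k : ℕ}
    {ξ : Cochain (holFun E W) (A.image W) k} {ξ' : Cochain (holFun E W') (A.image W') k}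
    (hξ : ∀ J : Fin k → Fin r, resFun hW (ξ fun j => v (J j)) = ξ' fun j => A.resImage hW (v (J j)))
    (w : Fin k → A.image W) : resFun hW (ξ w) = ξ' fun j => A.resImage hW (w j) := by
  rw [h.apply_eq_sum ξ w, (h.restrict hW).apply_eq_sum ξ', resFun_sum]
  refine Finset.sum_congr rfl fun J _ => ?_
  rw [resFun_mul, hξ, resFun_prod]
  simp only [resFun_lie]

/-- Forms are determined by their coefficients in a frame. -/
theorem IsFrame.form_ext (h : A.IsFrame y v) {k : ℕ} {α β : A.form k W}
    (hαβ : ∀ J : Fin k → Fin r, (α.1 ⟨W, le_rfl⟩ fun j => v (J j)) = β.1 ⟨W, le_rfl⟩ fun j => v (J j)) :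
    α = β := by
  refine Subtype.ext (funext fun W' => AlternatingMap.ext fun w => ?_)
  rw [(h.restrict W'.2).apply_eq_sum, (h.restrict W'.2).apply_eq_sum (β.1 W')]
  refine Finset.sum_congr rfl fun J _ => ?_
  rw [← α.2 ⟨W, le_rfl⟩ W' W'.2 fun j => v (J j), ← β.2 ⟨W, le_rfl⟩ W' W'.2 fun j => v (J j), hαβ]

/-- In the presence of a frame cochains extend to forms. -/
theorem IsFrame.exists_form (h : A.IsFrame y v) {k : ℕ} (ξ : Cochain (holFun E W) (A.image W) k) :
    ∃ β : A.form k W, β.1 ⟨W, le_rfl⟩ = ξ := by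
  let c (W' : {W' : Opens X // W' ≤ W}) (J : Fin k → Fin r) : holFun E W'.1 :=
    resFun W'.2 (ξ fun j => v (J j))
  have hc (W' J) (σ : Equiv.Perm (Fin k)) : c W' (J ∘ σ) = Equiv.Perm.sign σ • c W' J := by
    have h1 := ξ.map_perm (fun j => v (J j)) σ
    refine (congrArg (resFun W'.2) h1).trans ?_
    rcases Int.units_eq_one_or (Equiv.Perm.sign σ) with h | h <;> rw [h]
    · rw [one_smul, one_smul]
    · rw [Units.neg_smul, Units.neg_smul, one_smul, one_smul]
      rfl
  let β (W' : {W' : Opens X // W' ≤ W}) : Cochain (holFun E W'.1) (A.image W'.1) k :=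
    ofCoeff (h.restrict W'.2).basis k (c W')
  have hβ (W' J) : (β W' fun j => A.resImage W'.2 (v (J j))) = c W' J := by
    rw [← ofCoeff_apply_basis (h.restrict W'.2).basis (hc W') J]
    simp only [IsFrame.basis_apply]
    rfl
  refine ⟨⟨β, fun W₁ W₂ h₁₂ w => (h.restrict W₁.2).resFun_apply h₁₂ (fun J => ?_) w⟩, ?_⟩
  · rw [hβ]
    exact (hβ W₂ J).symm
  · refine AlternatingMap.ext fun w => ?_
    rw [h.apply_eq_sum, h.apply_eq_sum ξ]
    refine Finset.sum_congr rfl fun J _ => ?_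
    exact congrArg _ (hβ ⟨W, le_rfl⟩ J)

end

section
variable {r q : ℕ} {φ : OpenPartialHomeomorph X ((Fin r → ℂ) × (Fin q → ℂ))}

/-- The restrictions to `W` of the leafwise coordinates of a chart. -/
noncomputable def leafCoord (hφ : IsHolChart E φ) {W : Opens X} (hW : (W : Set X) ⊆ φ.source)
    (i : Fin r) : holFun E W :=
  hφ.coord hW (.comp (.proj i) (.fst ℂ (Fin r → ℂ) (Fin q → ℂ)))

theorem IsTangentChart.exists_isFrame [FiniteDimensional ℂ F] [ContMDiffVectorBundle ω F V 𝓘(ℂ, E)]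
    (hr : ∀ x, Module.finrank ℂ (LinearMap.range (A.anchor x)) = r) (h : A.IsTangentChart φ)
    {U : Opens X} {x : X} (hxU : x ∈ U) (hx : x ∈ φ.source) :
    ∃ (W : Opens X) (_ : W ≤ U) (hW : (W : Set X) ⊆ φ.source) (v : Fin r → A.image W), x ∈ W ∧
      A.IsFrame (leafCoord h.1 hW) v := by
  let U' : Opens X := U ⊓ ⟨φ.source, φ.open_source⟩
  have hU' : (U' : Set X) ⊆ φ.source := fun _ hx => hx.2
  obtain ⟨W, hW, v, hxW, hv⟩ := A.exists_isFrame hr (leafCoord h.1 hU') ⟨x, hxU, hx⟩ (by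
    refine fun w hw h0 => (h.1.bijective_mvfderiv hx).1 ?_
    rw [map_zero]
    refine Prod.ext (funext fun i => ?_) ((h.2 x hx w).1 hw)
    exact (h.1.mvfderiv_coord hU' _ ⟨x, hxU, hx⟩ w).symm.trans (h0 i))
  exact ⟨W, hW.trans inf_le_left, fun p hp => hU' (hW hp), v, hxW, hv⟩

theorem IsTangentChart.mvfderiv_frame (h : A.IsTangentChart φ) {W : Opens X}
    {hW : (W : Set X) ⊆ φ.source} {v : Fin r → A.image W} (hv : A.IsFrame (leafCoord h.1 hW) v)
    (x : W) (i : Fin r) : mvfderiv 𝓘(ℂ, E) φ (x : X) ((v i).1 x) = (Pi.single i 1, 0) := by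
  refine Prod.ext (funext fun j => ?_) ((h.2 x (hW x.2) _).1 (A.image_apply_mem_range (v i) x))
  have h1 := congrArg (fun f : holFun E W => f.1 x) (hv.2 i j)
  refine (h.1.mvfderiv_coord hW _ x ((v i).1 x)).symm.trans (h1.trans ?_)
  change _ = (Pi.single i 1 : Fin r → ℂ) j
  rw [Pi.single_apply]
  simp only [eq_comm (a := i)]
  split_ifs <;> rfl

/-- The Euler vector field along the plaques. -/
noncomputable def euler (hφ : IsHolChart E φ) {W : Opens X} (hW : (W : Set X) ⊆ φ.source)
    (v : Fin r → A.image W) (t : Fin r → ℂ) : A.image W :=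
  ∑ i, (leafCoord hφ hW i - algebraMap ℂ (holFun E W) (t i)) • v i

theorem IsTangentChart.euler_lie_fun (h : A.IsTangentChart φ) {W : Opens X}
    {hW : (W : Set X) ⊆ φ.source} {v : Fin r → A.image W} (hv : A.IsFrame (leafCoord h.1 hW) v)
    (t : Fin r → ℂ) {f : holFun E W} {g : (Fin r → ℂ) × (Fin q → ℂ) → ℂ}
    (hfg : ∀ x : W, f.1 x = g (φ x)) (x : W) (hg : DifferentiableAt ℂ g (φ x)) :
    (⁅euler h.1 hW v t, f⁆ : holFun E W).1 x = fderiv ℂ g (φ x) ((φ x).1 - t, 0) := by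
  have h1 : extendZero (V := fun _ => ℂ) f.1 =ᶠ[𝓝 (x : X)] fun y => g (φ y) := by
    filter_upwards [W.isOpen.mem_nhds x.2] with y hy
    rw [extendZero_of_mem _ hy]
    exact hfg ⟨y, hy⟩
  refine (mvfderiv_congr h1 _).trans ?_
  rw [mvfderiv_comp_fderiv hg (h.1.mdifferentiableAt (hW x.2)), euler, coe_sum_smul, map_sum]
  simp only [map_smul, h.mvfderiv_frame hv]
  congr 1
  refine Prod.ext (funext fun j => ?_) ?_
  · simp only [Prod.smul_mk, Prod.fst_sum, Finset.sum_apply, Pi.smul_apply, Pi.single_apply, smul_eq_mul,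
      mul_ite, mul_one, mul_zero, Finset.sum_ite_eq, Finset.mem_univ, if_true]
    rfl
  · simp [Prod.snd_sum]

theorem IsTangentChart.euler_lie (h : A.IsTangentChart φ) {W : Opens X}
    {hW : (W : Set X) ⊆ φ.source} {v : Fin r → A.image W} (hv : A.IsFrame (leafCoord h.1 hW) v)
    (t : Fin r → ℂ) (j : Fin r) : ⁅euler h.1 hW v t, v j⁆ = -v j := by
  rw [hv.eq_sum ⁅euler h.1 hW v t, v j⁆]
  have h0 (w : A.image W) (c : ℂ) : ⁅w, algebraMap ℂ (holFun E W) c⁆ = 0 :=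
    Subtype.ext (dirDeriv_const w.1 c)
  have h1 (w : A.image W) (i) : ⁅w, ⁅v j, leafCoord h.1 hW i⁆⁆ = 0 := by
    rw [hv.2]
    split_ifs
    · exact (congrArg (Bracket.bracket w) (map_one (algebraMap ℂ (holFun E W))).symm).trans (h0 w 1)
    · exact lie_zero w
  have h2 (i) : ⁅⁅euler h.1 hW v t, v j⁆, leafCoord h.1 hW i⁆ = if j = i then -1 else 0 := by
    rw [lie_lie_fun, h1, euler, hv.sum_smul_lie]
    have h3 : ⁅v j, leafCoord h.1 hW i - algebraMap ℂ (holFun E W) (t i)⁆ =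
        ⁅v j, leafCoord h.1 hW i⁆ := (lie_sub _ _ _).trans (by rw [h0, sub_zero])
    rw [h3, hv.2]
    split_ifs <;> simp
  simp only [h2]
  simp

end
end HolomorphicLieAlgebroid
end
end HolGeom

theorem exists_common_ball {ι H : Type*} [Fintype ι] [NormedAddCommGroup H] [NormedSpace ℂ H]
    {f : ι → H → ℂ} {z₀ : H} (hf : ∀ i, AnalyticAt ℂ (f i) z₀) {P : H → Prop}
    (hP : ∀ᶠ z in 𝓝 z₀, P z) : ∃ ρ : NNReal, 0 < ρ ∧ (∀ z ∈ Metric.ball z₀ ρ, P z) ∧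
      ∀ i, ∃ p : FormalMultilinearSeries ℂ H ℂ, HasFPowerSeriesOnBall (f i) p z₀ ρ := by
  choose p R hR using hf
  obtain ⟨ε, hε, hball⟩ := Metric.eventually_nhds_iff_ball.1 hP
  have h0 : 0 < (Finset.univ.inf R) ⊓ ENNReal.ofReal ε :=
    lt_inf_iff.2 ⟨(Finset.lt_inf_iff (by simp)).2 fun i _ => (hR i).r_pos, ENNReal.ofReal_pos.2 hε⟩
  obtain ⟨ρ, hρ, hρ'⟩ := ENNReal.lt_iff_exists_nnreal_btwn.1 h0
  rw [lt_inf_iff] at hρ'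
  refine ⟨ρ, ENNReal.coe_pos.1 hρ, fun z hz => hball z (Metric.ball_subset_ball ?_ hz), fun i =>
    ⟨p i, (hR i).mono hρ (hρ'.1.le.trans (Finset.inf_le (Finset.mem_univ i)))⟩⟩
  have h2 := hρ'.2.le
  rw [← ENNReal.ofReal_coe_nnreal] at h2
  exact (ENNReal.ofReal_le_ofReal_iff hε.le).1 h2

namespace HolGeom
open Set LieRinehartCochain

section
variable {X : Type u} [TopologicalSpace X] {E : Type u} [NormedAddCommGroup E] [NormedSpace ℂ E]
  [ChartedSpace E X] [IsManifold 𝓘(ℂ, E) ω X]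
  [FiniteDimensional ℂ E] {F : Type*} [NormedAddCommGroup F] [NormedSpace ℂ F] {V : X → Type*}
  [∀ x, AddCommGroup (V x)] [∀ x, Module ℂ (V x)] [∀ x, TopologicalSpace (V x)]
  [TopologicalSpace (TotalSpace F V)] [FiberBundle F V] [VectorBundle ℂ F V]
  (A : HolomorphicLieAlgebroid E F V)

namespace HolomorphicLieAlgebroid

section
variable {A} {r q : ℕ} {φ : OpenPartialHomeomorph X ((Fin r → ℂ) × (Fin q → ℂ))}
  {W : Opens X} {hW : (W : Set X) ⊆ φ.source} {v : Fin r → A.image W}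
  {z₀ : (Fin r → ℂ) × (Fin q → ℂ)} {ρ : NNReal}

theorem IsTangentChart.eq_zero_of_euler_lie (h : A.IsTangentChart φ)
    (hv : A.IsFrame (leafCoord h.1 hW) v) (hWρ : ∀ y ∈ W, φ y ∈ Metric.ball z₀ ρ)
    (hρW : ∀ z ∈ Metric.ball z₀ ρ, z ∈ φ.target ∧ φ.symm z ∈ W) {k : ℕ} {g : holFun E W} (hk : 0 < k)
    (hg : ⁅euler h.1 hW v z₀.1, g⁆ + k * g = 0) : g = 0 := by
  let g' (z : (Fin r → ℂ) × (Fin q → ℂ)) : ℂ := extendZero (V := fun _ => ℂ) g.1 (φ.symm z)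
  have hg' (z) (hz : z ∈ Metric.ball z₀ ρ) : DifferentiableAt ℂ g' z :=
    (h.1.contDiffAt_comp_symm (hρW z hz).1
      (contMDiffAt_extendZero g.2 (hρW z hz).2)).differentiableAt (by simp)
  have hgg' (y : W) : g.1 y = g' (φ y) := by
    simp only [g', φ.left_inv (hW y.2), extendZero_of_mem _ y.2]
  refine Subtype.ext (funext fun y => ?_)
  rw [hgg']
  refine eq_zero_of_euler hk hg' (fun z hz => ?_) (hWρ y y.2)
  have h1 := congrArg (fun g : holFun E W => g.1 ⟨_, (hρW z hz).2⟩) hg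
  have h2 := h.euler_lie_fun hv z₀.1 hgg' ⟨_, (hρW z hz).2⟩
    (by rw [φ.right_inv (hρW z hz).1]; exact hg' z hz)
  have h3 := hgg' ⟨_, (hρW z hz).2⟩
  simp only [φ.right_inv (hρW z hz).1] at h2 h3
  rw [← h2, ← h3]
  exact h1

theorem IsTangentChart.exists_euler_lie_eq (h : A.IsTangentChart φ)
    (hv : A.IsFrame (leafCoord h.1 hW) v) (hWρ : ∀ y ∈ W, φ y ∈ Metric.ball z₀ ρ)
    {f' : (Fin r → ℂ) × (Fin q → ℂ) → ℂ} (hf' : ∃ p : FormalMultilinearSeries ℂ _ ℂ, HasFPowerSeriesOnBall f' p z₀ ρ) {f : holFun E W}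
    (hff' : ∀ y : W, f.1 y = f' (φ y)) (k : ℕ) :
    ∃ g : holFun E W, ⁅euler h.1 hW v z₀.1, g⁆ + ((k + 1 : ℕ) : holFun E W) * g = f := by
  obtain ⟨p, hp⟩ := hf'
  obtain ⟨g', hg', hgf⟩ := exists_euler_primitive hp k
  rw [Metric.eball_coe] at hg' hgf
  let g : holFun E W := ⟨fun y => g' (φ y), h.1.comp_mem_holFun hW fun y hy =>
    (hg' _ (hWρ y hy)).contDiffAt⟩
  refine ⟨g, Subtype.ext (funext fun y => ?_)⟩
  have h2 := h.euler_lie_fun hv z₀.1 (f := g) (fun _ => rfl) y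
    (hg' _ (hWρ y y.2)).differentiableAt
  rw [hff', ← hgf _ (hWρ y y.2), ← h2]
  rfl

end

/-- The Poincaré lemma for forms, in the presence of an Euler vector field. -/
theorem IsFrame.exists_dForm_eq {A : HolomorphicLieAlgebroid E F V} {r : ℕ} {W : Opens X}
    {y : Fin r → holFun E W} {v : Fin r → A.image W} (hv : A.IsFrame y v) {R : A.image W}
    (hR : ∀ i, ⁅R, v i⁆ = -v i)
    (hinj : ∀ (l : ℕ) (g : holFun E W), 0 < l → ⁅R, g⁆ + l * g = 0 → g = 0) {k : ℕ}
    {α : A.form (k + 1) W} (hα : A.dForm (k + 1) W α = 0)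
    (hex : ∀ J : Fin (k + 1) → Fin r, ∃ g : holFun E W,
      ⁅R, g⁆ + ((k + 1 : ℕ) : holFun E W) * g = α.1 ⟨W, le_rfl⟩ fun j => v (J j)) :
    ∃ β : A.form k W, A.dForm k W β = α := by
  obtain ⟨ξ, hξ⟩ := exists_differential_eq hv.basis (R := R)
    (fun i => by rw [hv.basis_apply]; exact hR i) hinj (α.1 ⟨W, le_rfl⟩)
    (congrFun (congrArg Subtype.val hα) ⟨W, le_rfl⟩)
    (fun J => by simp only [hv.basis_apply]; exact hex J)
  obtain ⟨β, hβ⟩ := hv.exists_form ξ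
  refine ⟨β, hv.form_ext fun J => ?_⟩
  change differential (β.1 ⟨W, le_rfl⟩) _ = _
  rw [hβ, hξ]

/-- The **Poincaré lemma** for the image of the anchor of a regular Lie algebroid. -/
theorem exists_dForm_eq [FiniteDimensional ℂ F] [ContMDiffVectorBundle ω F V 𝓘(ℂ, E)]
    (hA : A.IsRegular) {k : ℕ} {U : Opens X} (α : A.form (k + 1) U) (hα : A.dForm (k + 1) U α = 0)
    {x : X} (hxU : x ∈ U) :
    ∃ (W : Opens X) (hW : W ≤ U), x ∈ W ∧ ∃ β : A.form k W, A.dForm k W β = A.resForm (k + 1) hW α := by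
  obtain ⟨r, hr⟩ := hA
  obtain ⟨q, hq⟩ : ∃ q, Module.finrank ℂ E = r + q :=
    Nat.exists_eq_add_of_le ((hr x).symm.trans_le (LinearMap.range (A.anchor x)).finrank_le)
  obtain ⟨φ, hφ, hx⟩ := A.exists_isTangentChart hr hq x
  obtain ⟨W₁, hW₁U, hW₁, v₁, hxW₁, hv₁⟩ := hφ.exists_isFrame hr hxU hx
  let f (J : Fin (k + 1) → Fin r) : holFun E W₁ := α.1 ⟨W₁, hW₁U⟩ fun j => v₁ (J j)
  let f' (J : Fin (k + 1) → Fin r) (z : (Fin r → ℂ) × (Fin q → ℂ)) : ℂ :=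
    extendZero (V := fun _ => ℂ) (f J).1 (φ.symm z)
  have hf' (J) : ContDiffAt ℂ ω (f' J) (φ x) := hφ.1.contDiffAt_comp_symm (φ.map_source hx) (by
    rw [φ.left_inv hx]; exact contMDiffAt_extendZero (f J).2 hxW₁)
  have hnear : ∀ᶠ z in 𝓝 (φ x), z ∈ φ.target ∧ φ.symm z ∈ W₁ := by
    refine Filter.Eventually.and (φ.open_target.mem_nhds (φ.map_source hx))
      ((φ.continuousAt_symm (φ.map_source hx)).eventually (p := fun y => y ∈ W₁) ?_)
    rw [φ.left_inv hx]
    exact W₁.isOpen.mem_nhds hxW₁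
  obtain ⟨ρ, hρ, hball, hps⟩ := exists_common_ball (fun J => (hf' J).analyticAt) hnear
  let W : Opens X := ⟨W₁ ∩ φ ⁻¹' Metric.ball (φ x) ρ,
    (φ.continuousOn.mono hW₁).isOpen_inter_preimage W₁.isOpen Metric.isOpen_ball⟩
  have hWW₁ : W ≤ W₁ := fun _ h => h.1
  have hWU : W ≤ U := hWW₁.trans hW₁U
  have hW : (W : Set X) ⊆ φ.source := fun _ h => hW₁ h.1
  have hWρ : ∀ y ∈ W, φ y ∈ Metric.ball (φ x) ρ := fun y hy => hy.2
  have hρW : ∀ z ∈ Metric.ball (φ x) ρ, z ∈ φ.target ∧ φ.symm z ∈ W := fun z hz =>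
    ⟨(hball z hz).1, (hball z hz).2, by rwa [mem_preimage, φ.right_inv (hball z hz).1]⟩
  have hv : A.IsFrame (leafCoord hφ.1 hW) fun i => A.resImage hWW₁ (v₁ i) := hv₁.restrict hWW₁
  have hxW : x ∈ W := ⟨hxW₁, Metric.mem_ball_self hρ⟩
  have hff' (J : Fin (k + 1) → Fin r) (y : W) : (resFun hWW₁ (f J)).1 y = f' J (φ y) := by
    simp only [f', φ.left_inv (hW y.2), extendZero_of_mem _ (hWW₁ y.2)]
    rfl
  refine ⟨W, hWU, hxW, hv.exists_dForm_eq (hφ.euler_lie hv (φ x).1)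
    (fun l g hl hg => hφ.eq_zero_of_euler_lie hv hWρ hρW hl hg) (congrArg (A.resForm _ hWU) hα)
    fun J => ?_⟩
  have hαW : ((A.resForm (k + 1) hWU α).1 ⟨W, le_rfl⟩ fun j => A.resImage hWW₁ (v₁ (J j))) =
      resFun hWW₁ (f J) := (α.2 ⟨W₁, hW₁U⟩ ⟨W, hWU⟩ hWW₁ _).symm
  rw [hαW]
  exact hφ.exists_euler_lie_eq hv hWρ (hps J) (hff' J) k

end HolomorphicLieAlgebroid
end

section
open CategoryTheory Opposite
variable {X : Type u} [TopologicalSpace X] {E : Type u} [NormedAddCommGroup E] [NormedSpace ℂ E]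
  [ChartedSpace E X] [IsManifold 𝓘(ℂ, E) ω X]
  [FiniteDimensional ℂ E] {F : Type*} [NormedAddCommGroup F] [NormedSpace ℂ F] {V : X → Type*}
  [∀ x, AddCommGroup (V x)] [∀ x, Module ℂ (V x)] [∀ x, TopologicalSpace (V x)]
  [TopologicalSpace (TotalSpace F V)] [FiberBundle F V] [VectorBundle ℂ F V]
  [FiniteDimensional ℂ F] [ContMDiffVectorBundle ω F V 𝓘(ℂ, E)]
  (A : HolomorphicLieAlgebroid E F V)

/-- The complex `(Λ^•𝒟*, ∂_𝒟)` is exact in positive degree. -/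
theorem HolomorphicLieAlgebroid.formComplex_exactAt (hA : A.IsRegular) {k : ℕ} (hk : 0 < k) :
    A.formComplex.ExactAt k := by
  obtain ⟨k, rfl⟩ := Nat.exists_eq_succ_of_ne_zero hk.ne'
  rw [HomologicalComplex.exactAt_iff' _ k (k + 1) (k + 1 + 1) (by simp) (by simp)]
  have h : ((ShortComplex.mk (A.dSheaf k) (A.dSheaf (k + 1)) (by
      ext U α
      exact A.dForm_dForm k U.unop α))).Exact :=
    VectSheaf.exact_of_local _ fun U α hα x hx => A.exists_dForm_eq hA α hα hx
  convert h using 1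
  simp only [HomologicalComplex.sc', HolomorphicLieAlgebroid.formComplex, HomologicalComplex.shortComplexFunctor',
    CochainComplex.of_d]

/-- The functions that are locally constant along the leaves as closed `0`-forms. -/
noncomputable def HolomorphicFoliation.leafSheafToForm (ℱ : HolomorphicFoliation X E) :
    ℱ.leafSheaf ⟶ A.formSheaf 0 where
  hom :=
    { app := fun U => ModuleCat.ofHom ((A.zeroForm U.unop).toLinearMap ∘ₗ (ℱ.leafFun U.unop).subtype)
      naturality := fun _ _ _ => rfl }

variable {A}

theorem HolomorphicFoliation.IsTangentTo.nonempty_cohomology_equiv (hA : A.IsRegular)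
    {ℱ : HolomorphicFoliation X E} (h : ℱ.IsTangentTo A) (k : ℕ) :
    Nonempty (Cohomology ℱ.leafSheaf k ≃ₗ[ℂ] Hypercohomology A.formComplex k) := by
  have hmono : Mono (ℱ.leafSheafToForm A) := VectSheaf.mono_of_injective _ fun U =>
    (A.zeroForm U).injective.comp Subtype.val_injective
  have hd : A.formComplex.d 0 1 = A.dSheaf 0 := CochainComplex.of_d A.formSheaf A.dSheaf 0
  have hw : ℱ.leafSheafToForm A ≫ A.dSheaf 0 = 0 := by
    ext U f
    exact (h.dForm_zeroForm_eq_zero_iff f.1).2 f.2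
  have hex : (ShortComplex.mk (ℱ.leafSheafToForm A) (A.dSheaf 0) hw).Exact := by
    refine VectSheaf.exact_of_local _ fun U α hα x hx => ⟨U, le_rfl, hx, ?_⟩
    obtain ⟨f, rfl⟩ := (A.zeroForm U).surjective α
    exact ⟨⟨f, (h.dForm_zeroForm_eq_zero_iff f).1 hα⟩, rfl⟩
  have : Mono (C := VectSheaf X) (Y := A.formComplex.X 0) (ℱ.leafSheafToForm A) := hmono
  have key (d : A.formComplex.X 0 ⟶ A.formComplex.X 1) (hd : d = A.dSheaf 0)
      (w : (ℱ.leafSheafToForm A : ℱ.leafSheaf ⟶ A.formComplex.X 0) ≫ d = 0) :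
      (ShortComplex.mk (ℱ.leafSheafToForm A : ℱ.leafSheaf ⟶ A.formComplex.X 0) d w).Exact := by
    subst hd
    exact hex
  exact CochainComplex.nonempty_ext_linearEquiv A.formComplex (ℱ.leafSheafToForm A)
    (by rw [hd]; exact hw) (key _ hd _) (fun k hk => A.formComplex_exactAt hA hk) _ k

end
end HolGeom

theorem mainTheorem2 {E X : Type u} [NormedAddCommGroup E] [NormedSpace ℂ E] [FiniteDimensional ℂ E]
    [TopologicalSpace X] [ChartedSpace E X] [IsManifold 𝓘(ℂ, E) ω X]
    {F : Type*} [NormedAddCommGroup F] [NormedSpace ℂ F] [FiniteDimensional ℂ F]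
    {V : X → Type*} [∀ x, AddCommGroup (V x)] [∀ x, Module ℂ (V x)] [∀ x, TopologicalSpace (V x)]
    [TopologicalSpace (TotalSpace F V)] [FiberBundle F V] [VectorBundle ℂ F V]
    [ContMDiffVectorBundle ω F V 𝓘(ℂ, E)]
    (A : HolGeom.HolomorphicLieAlgebroid E F V) (hA : A.IsRegular) :
    (∃ ℱ : HolGeom.HolomorphicFoliation X E, ℱ.IsTangentTo A) ∧
    (∀ k : ℕ, 0 < k → A.formComplex.ExactAt k) ∧
    ∀ ℱ : HolGeom.HolomorphicFoliation X E, ℱ.IsTangentTo A →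
      (∀ U : Opens X, (A.dForm 0 U ∘ₗ (A.zeroForm U).toLinearMap).ker = ℱ.leafFun U) ∧
      ∀ k : ℕ, Nonempty
        (HolGeom.Cohomology ℱ.leafSheaf k ≃ₗ[ℂ] HolGeom.Hypercohomology A.formComplex k) := by
  refine ⟨A.exists_foliation hA, fun k hk => A.formComplex_exactAt hA hk, fun ℱ h =>
    ⟨fun U => Submodule.ext fun f => h.dForm_zeroForm_eq_zero_iff f,
      fun k => h.nonempty_cohomology_equiv hA k⟩⟩
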